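/- **Setting.** Let $D$ be a finite set of states and let $(\Omega,\mathcal F,(\mathcal F_t)_{t\ge 0},\mathbb P)$ be a filtered probability space. Let $\varepsilon=(\varepsilon(t))_{t\ge0}$ be an adapted right-continuous $D$-valued process with left limits, with switching times $0=\tau_0<\tau_1<\tau_2<\cdots\to\infty$ and $\mathbb P(\varepsilon(0)=i)>0$ for every $i\in D$. Put $N(t)=\max\{n:\tau_n\le t\}$ and $T_n=\tau_n-\tau_{n-1}$. For $i\ne j$ in $D$ let $\gamma_{ij}\ge 0$ be measurable and locally integrable on $[0,\infty)$ with $\int_0^\infty\gamma_{ij}(u)\,du=\infty$, and set $\gamma_i=\sum_{j\ne i}\gamma_{ij}$. Assume that $\varepsilon$ is semi-Markov with hazard rate functions $\gamma_{ij}$: for all $n\ge1$, $i\neq j$ and $t\ge0$, on the event $\{\varepsilon(\tau_{n-1})=i\}$, $$\mathbb P\{T_n>t,\ \varepsilon(\tau_n)=j\mid \tau_0,\varepsilon(\tau_0),\dots,\tau_{n-1},\varepsilon(\tau_{n-1})\}=\int_t^\infty\gamma_{ij}(u)\,e^{-\int_0^u\gamma_i(v)\,dv}\,du .$$ In particular,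 given $\varepsilon(\tau_{n-1})=i$, the time $T_n$ has survival function $\overline F_i(t)=e^{-\int_0^t\gamma_i(u)\,du}$ and hazard rate $\gamma_i$. Let $B$ be an $(\mathcal F_t)$-Brownian motion independent of $\varepsilon$. For $i\in D$ let $c_i,h_i,\sigma_i:[0,\infty)\to\mathbb R$ be deterministic measurable functions, with $c_i$ locally integrable and $\sigma_i$ locally square integrable. Consider the regime switching jump-diffusion process $$X(t)=\int_0^t c^\dagger(u)\,du+\sum_{n=1}^{N(t)}h_{\varepsilon(\tau_{n-1})}(T_n)+\int_0^t\sigma^\dagger(u)\,dB(u),\qquad t\ge0,$$ where $z^\dagger(u)=z_{\varepsilon(\tau_{n-1})}(u-\tau_{n-1})$ for $\tau_{n-1}\le u<\tau_n$, $n\ge1$, and the last integral is an Itô integral. Define $$l_i(s)=\int_0^s c_i(u)\,du,\qquad \mu_i(t)=\mathbb E[X(t)\mid\varepsilon(0)=i],\qquad \mu_i(t\,|\,s)=\mathbb E[X(t)\mid \varepsilon(0)=i,\ N(s)=0].$$ **Corollary 2.2.** The identities $$\mu_i(t)=0\quad(t\ge0,\ i\in D)\qquad\text{and}\qquad \mu_i(t\,|\,s)=l_i(s)\quad(t\ge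 s\ge0,\ i\in D)$$ hold (including that all these expectations exist as finite expectations) if and only if, for every $i\in D$, $$\gamma_i(t)\,h_i(t)+c_i(t)=0\qquad\text{for Lebesgue-almost every } t\ge0 .$$ -/

import Mathlib

open MeasureTheory ProbabilityTheory Filter Topology
open scoped NNReal ENNReal

noncomputable section

/-! ### The semi-Markov switching process -/

/-- Pathwise description of a right-continuous process `ε` with finitely many states whose
switching times are `0 = τ 0 < τ 1 < τ 2 < ...`, only finitely many of them in bounded time. -/
structure IsSwitchingProcess {Ω : Type*} {d : ℕ} [MeasurableSpace Ω]
    (ε : ℝ≥0 → Ω → Fin d) (τ : ℕ → Ω → ℝ≥0) : Prop where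
  measurable_time : ∀ n, Measurable (τ n)
  time_zero : ∀ ω, τ 0 ω = 0
  time_lt : ∀ n ω, τ n ω < τ (n + 1) ω
  time_tendsto : ∀ ω, Tendsto (fun n => τ n ω) atTop atTop
  const_between : ∀ n ω t, τ n ω ≤ t → t < τ (n + 1) ω → ε t ω = ε (τ n ω) ω
  state_ne : ∀ n ω, ε (τ (n + 1) ω) ω ≠ ε (τ n ω) ω

/-- The total hazard rate `γ_i = ∑_{j ≠ i} γ_{ij}`. -/
def totalHazard {d : ℕ} (γ : Fin d → Fin d → ℝ → ℝ) (i : Fin d) (t : ℝ) : ℝ :=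
  ∑ j ∈ Finset.univ.erase i, γ i j t

/-- The survival function `exp (-∫_0^t γ_i(u) du)` of the sojourn time in state `i`. -/
def survival {d : ℕ} (γ : Fin d → Fin d → ℝ → ℝ) (i : Fin d) (t : ℝ) : ℝ :=
  Real.exp (-∫ u in (0 : ℝ)..t, totalHazard γ i u)

/-- The σ-algebra generated by the first `n` switching times and the states entered at them. -/
@[reducible] def switchHistory {Ω : Type*} {d : ℕ} (ε : ℝ≥0 → Ω → Fin d) (τ : ℕ → Ω → ℝ≥0) (n : ℕ) :
    MeasurableSpace Ω :=
  MeasurableSpace.comap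
    (fun ω => fun k : Fin (n + 1) => (τ k ω, ε (τ k ω) ω)) inferInstance

/-- The (time-homogeneous) Markov renewal property with transition hazard rates `γ i j`:
given the past up to the `n`-th switching and the current state `i`, the next sojourn time
exceeds `t` and ends in a switch to `j` with probability
`∫_t^∞ γ_{ij}(u) exp (-∫_0^u γ_i) du`. -/
def IsSemiMarkov {Ω : Type*} {d : ℕ} [MeasurableSpace Ω] (P : Measure Ω)
    (γ : Fin d → Fin d → ℝ → ℝ) (ε : ℝ≥0 → Ω → Fin d) (τ : ℕ → Ω → ℝ≥0) : Prop :=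
  ∀ (n : ℕ) (i j : Fin d), i ≠ j → ∀ A : Set Ω, MeasurableSet[switchHistory ε τ n] A →
    ∀ t : ℝ≥0,
      P (A ∩ {ω | ε (τ n ω) ω = i} ∩
          {ω | τ n ω + t < τ (n + 1) ω ∧ ε (τ (n + 1) ω) ω = j}) =
        P (A ∩ {ω | ε (τ n ω) ω = i}) *
          ∫⁻ u in Set.Ioi (t : ℝ), ENNReal.ofReal (γ i j u * survival γ i u)

/-- The counting process `N(t) = max {n | τ_n ≤ t}`. -/
def switchCount {Ω : Type*} (τ : ℕ → Ω → ℝ≥0) (t : ℝ≥0) (ω : Ω) : ℕ :=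
  sSup {n : ℕ | τ n ω ≤ t}

/-- The process which equals `z_{ε(τ_n)}(t - τ_n)` for `τ_n ≤ t < τ_{n+1}`. -/
def dagger {Ω : Type*} {d : ℕ} (ε : ℝ≥0 → Ω → Fin d) (τ : ℕ → Ω → ℝ≥0)
    (z : Fin d → ℝ → ℝ) (t : ℝ) (ω : Ω) : ℝ :=
  ∑' n : ℕ, (Set.Ico (τ n ω : ℝ) (τ (n + 1) ω : ℝ)).indicator
    (fun v => z (ε (τ n ω) ω) (v - τ n ω)) t

/-- The telegraph process `∫_0^t c†(u) du`. -/
def telegraphPart {Ω : Type*} {d : ℕ} (ε : ℝ≥0 → Ω → Fin d) (τ : ℕ → Ω → ℝ≥0)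
    (c : Fin d → ℝ → ℝ) (t : ℝ≥0) (ω : Ω) : ℝ :=
  ∫ u in (0 : ℝ)..t, dagger ε τ c u ω

/-- The pure jump process: at the switching time `τ_{n+1}` it jumps by
`h_{ε(τ_n)}(τ_{n+1} - τ_n)`. -/
def jumpPart {Ω : Type*} {d : ℕ} (ε : ℝ≥0 → Ω → Fin d) (τ : ℕ → Ω → ℝ≥0)
    (h : Fin d → ℝ → ℝ) (t : ℝ≥0) (ω : Ω) : ℝ :=
  ∑ n ∈ Finset.range (switchCount τ t ω),
    h (ε (τ n ω) ω) ((τ (n + 1) ω : ℝ) - (τ n ω : ℝ))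

/-! ### Brownian motion and the Itô integral -/

/-- `B` is a standard Brownian motion relative to the filtration `F`. -/
structure IsBrownianRelTo {Ω : Type*} {mΩ : MeasurableSpace Ω} (P : Measure Ω)
    (F : Filtration ℝ≥0 mΩ) (B : ℝ≥0 → Ω → ℝ) : Prop where
  isBrownian : IsBrownianReal B P
  adapted : ∀ t, Measurable[F t] (B t)
  indep_increment : ∀ s t : ℝ≥0, s ≤ t →
    Indep (MeasurableSpace.comap (fun ω => B t ω - B s ω) inferInstance) (F s) P

/-- A bounded simple adapted process `∑_{k < size} coef k * 1_{(time k, time (k+1)]}`. -/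
structure SimpleItoProcess {Ω : Type*} {mΩ : MeasurableSpace Ω} (F : Filtration ℝ≥0 mΩ) where
  size : ℕ
  time : ℕ → ℝ≥0
  coef : ℕ → Ω → ℝ
  monotone_time : Monotone time
  measurable_coef : ∀ k, Measurable[F (time k)] (coef k)
  bounded_coef : ∃ C : ℝ, ∀ k ω, |coef k ω| ≤ C

/-- The value of a simple process at time `u`. -/
def SimpleItoProcess.value {Ω : Type*} {mΩ : MeasurableSpace Ω} {F : Filtration ℝ≥0 mΩ}
    (S : SimpleItoProcess F) (u : ℝ) (ω : Ω) : ℝ :=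
  ∑ k ∈ Finset.range S.size,
    (Set.Ioc (S.time k : ℝ) (S.time (k + 1) : ℝ)).indicator (fun _ => S.coef k ω) u

/-- The elementary integral of a simple process against `B` over `[0, t]`. -/
def SimpleItoProcess.integral {Ω : Type*} {mΩ : MeasurableSpace Ω} {F : Filtration ℝ≥0 mΩ}
    (S : SimpleItoProcess F) (B : ℝ≥0 → Ω → ℝ) (t : ℝ≥0) (ω : Ω) : ℝ :=
  ∑ k ∈ Finset.range S.size,
    S.coef k ω * (B (min (S.time (k + 1)) t) ω - B (min (S.time k) t) ω)

/-- The random variable `I` is (a version of) the Itô integral `∫_0^t H(u) dB(u)`: it is the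
`L²(P)`-limit of the elementary integrals of simple adapted processes which converge to `H` in
`L²([0, t] × Ω)`. -/
def IsItoIntegral {Ω : Type*} {mΩ : MeasurableSpace Ω} (P : Measure Ω)
    (F : Filtration ℝ≥0 mΩ) (B : ℝ≥0 → Ω → ℝ) (H : ℝ → Ω → ℝ) (t : ℝ≥0) (I : Ω → ℝ) : Prop :=
  AEStronglyMeasurable I P ∧
    ∃ S : ℕ → SimpleItoProcess F,
      Tendsto (fun n => ∫⁻ ω, (∫⁻ u in Set.Ioc (0 : ℝ) t,
        ENNReal.ofReal (((S n).value u ω - H u ω) ^ 2)) ∂P) atTop (𝓝 0) ∧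
      Tendsto (fun n => eLpNorm (fun ω => (S n).integral B t ω - I ω) 2 P) atTop (𝓝 0)

/-! ### The jump-diffusion process with switching regimes -/

/-- `X` is the regime switching jump-diffusion process `T^c + N^h + W^σ` characterised by the
triplet `⟨c, h, σ⟩`, where `W^σ(t) = ∫_0^t σ†(u) dB(u)`. -/
def IsTelegraphJumpDiffusion {Ω : Type*} {mΩ : MeasurableSpace Ω} {d : ℕ} (P : Measure Ω)
    (F : Filtration ℝ≥0 mΩ) (ε : ℝ≥0 → Ω → Fin d) (τ : ℕ → Ω → ℝ≥0) (B : ℝ≥0 → Ω → ℝ)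
    (c h σ : Fin d → ℝ → ℝ) (X : ℝ≥0 → Ω → ℝ) : Prop :=
  ∃ W : ℝ≥0 → Ω → ℝ,
    (∀ t, IsItoIntegral P F B (dagger ε τ σ) t (W t)) ∧
    ∀ t ω, X t ω = telegraphPart ε τ c t ω + jumpPart ε τ h t ω + W t ω

/-- The random variable `Y` has a (finite) conditional expectation given the event `A`, and it
equals `m`. -/
def HasCondMean {Ω : Type*} [MeasurableSpace Ω] (P : Measure Ω) (A : Set Ω) (Y : Ω → ℝ)
    (m : ℝ) : Prop :=
  Integrable Y (ProbabilityTheory.cond P A) ∧ ∫ ω, Y ω ∂(ProbabilityTheory.cond P A) = m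

end

/-! ### Survival functions -/

/-! Write A(i,s) for the event that the process starts in i and does not switch up to s, and put f_i
= γ_i h_i + c_i. Everything rests on the formula E[X(t); A(i,s)] = P(A(i,s)) l_i(s) + E[∫_s^t f†(u)
du; A(i,s)] for s ≤ t, valid once the γ_i h_i are locally integrable.

Drift: on A(i,s) the integrand c† is c_i up to s. Jumps: on A(i,s) none occurs up to s, and
afterwards the jumps are compensated by (γh)†. Given the history at τ_n, this is Fubini for the law
with hazard rate γ_i (`lintegral_hazardLaw_shift`, `lintegral_jump_eq`), summed over n for the
positive and the negative part of h separately (`setLIntegral_jumpSum`, `setIntegral_jumpPart`). The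
sums are finite because the expected number of switchings in bounded time is finite: the Laplace
transforms at 1 of the finitely many sojourn laws are bounded by some q < 1.

Itô integral: it has mean zero on A(i,s) (`IsItoIntegral.setIntegral_stayEvent`). The martingale
property removes the part after s, but not the part before s, since A(i,s) is only known at time s.
There independence of B and ε is needed, and it cannot be applied directly because the approximating
simple processes may depend on both. On A(i,s), however, the integrand is the deterministic σ_i.
Freezing an approximating simple process along a well-chosen path gives a deterministic
approximation of σ_i, whose integral has mean zero on A(i,s) by independence. The error of this
replacement is controlled by an Itô isometry stopped just after τ_1.

If every f_i vanishes almost everywhere, so does f† along each path, and the formula gives all the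
means. Conversely, differentiating in t gives E[f†(u); A(i,s)] = 0 for almost every u > s. Letting
rational s increase to u yields f_i(u) P(A(i,u)) = 0, and P(A(i,u)) > 0 because survival functions
are positive. Local integrability of γ_i h_i is itself a consequence of integrability of X(t),
extracted from the paths with exactly one switch before t
(`intervalIntegrable_of_integrableOn_jumpPart`). -/

theorem AbsolutelyContinuousOnInterval.exp_neg {f : ℝ → ℝ} {a b : ℝ}
    (hf : AbsolutelyContinuousOnInterval f a b) (h0 : ∀ x ∈ Set.uIcc a b, 0 ≤ f x) :
    AbsolutelyContinuousOnInterval (fun x => Real.exp (-f x)) a b := by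
  -- On [0, ∞) the map x ↦ exp(-x) is 1-Lipschitz, so the δ belonging to f serves unchanged.
  have hlip : ∀ x y : ℝ, 0 ≤ x → 0 ≤ y → dist (Real.exp (-x)) (Real.exp (-y)) ≤ dist x y := by
    have key : ∀ x y : ℝ, 0 ≤ x → x ≤ y → Real.exp (-x) - Real.exp (-y) ≤ y - x := by
      intro x y hx hxy
      have h1 : Real.exp (-y) = Real.exp (-x) * Real.exp (x - y) := by
        rw [← Real.exp_add]; ring_nf
      have h2 := Real.add_one_le_exp (x - y)
      have h3 : Real.exp (-x) ≤ 1 := Real.exp_le_one_iff.2 (by linarith)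
      have h4 := Real.exp_pos (-x)
      rw [h1]
      nlinarith
    intro x y hx hy
    rw [Real.dist_eq, Real.dist_eq]
    rcases le_total x y with h | h
    · rw [abs_of_nonneg, abs_of_nonpos]
      · linarith [key x y hx h]
      · linarith
      · have := Real.exp_le_exp.2 (neg_le_neg h); linarith
    · rw [abs_of_nonpos, abs_of_nonneg]
      · linarith [key y x hy h]
      · linarith
      · have := Real.exp_le_exp.2 (neg_le_neg h); linarith
  rw [absolutelyContinuousOnInterval_iff] at hf ⊢
  intro ε hε
  obtain ⟨δ, hδ, H⟩ := hf ε hε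
  refine ⟨δ, hδ, fun E hE hl => lt_of_le_of_lt (Finset.sum_le_sum fun i hi => ?_) (H E hE hl)⟩
  have := hE.1 i hi
  exact hlip _ _ (h0 _ this.1) (h0 _ this.2)

/-- For a merely locally integrable g the survival function is differentiable only almost
everywhere; its absolute continuity is what makes the fundamental theorem of calculus available. -/
theorem integral_mul_exp_neg_integral {g : ℝ → ℝ} {t : ℝ} (ht : 0 ≤ t)
    (h0 : ∀ u, 0 < u → 0 ≤ g u) (hg : IntervalIntegrable g volume 0 t) :
    ∫ u in (0 : ℝ)..t, g u * Real.exp (-∫ v in (0 : ℝ)..u, g v) =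
      1 - Real.exp (-∫ v in (0 : ℝ)..t, g v) := by
  have hac := (hg.absolutelyContinuousOnInterval_intervalIntegral (c := 0) (by simp)).exp_neg
    (by
      intro x hx
      rw [Set.uIcc_of_le ht] at hx
      exact intervalIntegral.integral_nonneg_of_ae_restrict hx.1 (by
        rw [← restrict_Ioc_eq_restrict_Icc]
        exact (ae_restrict_mem measurableSet_Ioc).mono fun u hu => h0 u hu.1))
  have h1 := hac.integral_deriv_eq_sub
  simp only [intervalIntegral.integral_same, neg_zero, Real.exp_zero] at h1
  have h2 : ∫ u in (0 : ℝ)..t, g u * Real.exp (-∫ v in (0 : ℝ)..u, g v) =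
      ∫ u in (0 : ℝ)..t, -deriv (fun x => Real.exp (-∫ v in (0 : ℝ)..x, g v)) u := by
    refine intervalIntegral.integral_congr_ae ?_
    filter_upwards [hg.ae_hasDerivAt_integral] with x hx hx2
    have h3 : HasDerivAt (fun x => Real.exp (-∫ v in (0 : ℝ)..x, g v))
        (Real.exp (-∫ v in (0 : ℝ)..x, g v) * -g x) x :=
      ((hx (Set.uIoc_subset_uIcc hx2)) 0 (by simp)).neg.exp
    rw [h3.deriv]
    ring
  rw [h2, intervalIntegral.integral_neg, h1]
  ring

/-- Without integrability of g there is no continuity in t to appeal to. Both halves of the interval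
integral are integrals over sections of a measurable planar set instead. -/
theorem measurable_integral_zero_right {g : ℝ → ℝ} (hg : Measurable g) :
    Measurable fun t => ∫ u in (0 : ℝ)..t, g u := by
  have key : ∀ s : Set (ℝ × ℝ), MeasurableSet s →
      Measurable fun t => ∫ u, s.indicator (fun p => g p.2) (t, u) := by
    intro s hs
    exact ((hg.comp measurable_snd).indicator hs).stronglyMeasurable.integral_prod_right'.measurable
  have h1 := key {p | 0 < p.2 ∧ p.2 ≤ p.1}
    ((measurableSet_lt measurable_const measurable_snd).inter
      (measurableSet_le measurable_snd measurable_fst))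
  have h2 := key {p | p.1 < p.2 ∧ p.2 ≤ 0}
    ((measurableSet_lt measurable_fst measurable_snd).inter
      (measurableSet_le measurable_snd measurable_const))
  have h3 : (fun t => ∫ u in (0 : ℝ)..t, g u) = fun t =>
      (∫ u, {p : ℝ × ℝ | 0 < p.2 ∧ p.2 ≤ p.1}.indicator (fun p => g p.2) (t, u)) -
        ∫ u, {p : ℝ × ℝ | p.1 < p.2 ∧ p.2 ≤ 0}.indicator (fun p => g p.2) (t, u) := by
    funext t
    rw [intervalIntegral, ← integral_indicator measurableSet_Ioc,
      ← integral_indicator measurableSet_Ioc]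
    rfl
  rw [h3]
  exact h1.sub h2

/-- A function which is the hazard rate of an almost surely finite positive time. -/
structure IsHazard (g : ℝ → ℝ) : Prop where
  measurable : Measurable g
  nonneg : ∀ u, 0 < u → 0 ≤ g u
  integrable : ∀ t, 0 ≤ t → IntervalIntegrable g volume 0 t
  tendsto : Tendsto (fun t => ∫ u in (0 : ℝ)..t, g u) atTop atTop

/-- The law on `(0, ∞)` with hazard rate `g`. -/
noncomputable def hazardLaw (g : ℝ → ℝ) : Measure ℝ :=
  (volume.restrict (Set.Ioi 0)).withDensity
    fun u => ENNReal.ofReal (g u * Real.exp (-∫ v in (0 : ℝ)..u, g v))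

namespace IsHazard

variable {g : ℝ → ℝ}

theorem measurable_survival (hg : IsHazard g) :
    Measurable fun u => Real.exp (-∫ v in (0 : ℝ)..u, g v) :=
  (measurable_integral_zero_right hg.measurable).neg.exp

theorem measurable_density (hg : IsHazard g) :
    Measurable fun u => ENNReal.ofReal (g u * Real.exp (-∫ v in (0 : ℝ)..u, g v)) :=
  (hg.measurable.mul hg.measurable_survival).ennreal_ofReal

theorem integral_nonneg (hg : IsHazard g) {t : ℝ} (ht : 0 ≤ t) : 0 ≤ ∫ u in (0 : ℝ)..t, g u :=
  intervalIntegral.integral_nonneg_of_ae_restrict ht (by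
    rw [← restrict_Ioc_eq_restrict_Icc]
    exact (ae_restrict_mem measurableSet_Ioc).mono fun u hu => hg.nonneg u hu.1)

theorem survival_le_one (hg : IsHazard g) {t : ℝ} (ht : 0 ≤ t) :
    Real.exp (-∫ v in (0 : ℝ)..t, g v) ≤ 1 :=
  Real.exp_le_one_iff.2 (by linarith [hg.integral_nonneg ht])

theorem survival_anti (hg : IsHazard g) {s t : ℝ} (hs : 0 ≤ s) (hst : s ≤ t) :
    Real.exp (-∫ v in (0 : ℝ)..t, g v) ≤ Real.exp (-∫ v in (0 : ℝ)..s, g v) := by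
  have h1 : IntervalIntegrable g volume s t :=
    (hg.integrable s hs).symm.trans (hg.integrable t (hs.trans hst))
  rw [Real.exp_le_exp, neg_le_neg_iff,
    ← intervalIntegral.integral_add_adjacent_intervals (hg.integrable s hs) h1]
  have : 0 ≤ ∫ v in s..t, g v :=
    intervalIntegral.integral_nonneg_of_ae_restrict hst (by
      rw [← restrict_Ioc_eq_restrict_Icc]
      exact (ae_restrict_mem measurableSet_Ioc).mono fun u hu => hg.nonneg u (hs.trans_lt hu.1))
  linarith

theorem intervalIntegrable_density (hg : IsHazard g) {t : ℝ} (ht : 0 ≤ t) :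
    IntervalIntegrable (fun u => g u * Real.exp (-∫ v in (0 : ℝ)..u, g v)) volume 0 t := by
  refine (hg.integrable t ht).mono_fun
    (hg.measurable.mul hg.measurable_survival).aestronglyMeasurable ?_
  rw [Set.uIoc_of_le ht]
  filter_upwards [ae_restrict_mem measurableSet_Ioc] with u hu
  rw [norm_mul, Real.norm_of_nonneg (Real.exp_pos _).le]
  exact mul_le_of_le_one_right (norm_nonneg _) (hg.survival_le_one hu.1.le)

theorem lintegral_Ioi_density (hg : IsHazard g) {t : ℝ} (ht : 0 ≤ t) :
    ∫⁻ u in Set.Ioi t, ENNReal.ofReal (g u * Real.exp (-∫ v in (0 : ℝ)..u, g v)) =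
      ENNReal.ofReal (Real.exp (-∫ v in (0 : ℝ)..t, g v)) := by
  refine (aecover_Iic (μ := volume.restrict (Set.Ioi t))
    (tendsto_id (α := ℝ))).lintegral_eq_of_tendsto _ hg.measurable_density.aemeasurable ?_
  have h1 : ∀ᶠ b : ℝ in atTop, ENNReal.ofReal (Real.exp (-∫ v in (0 : ℝ)..t, g v) -
      Real.exp (-∫ v in (0 : ℝ)..b, g v)) = ∫⁻ u in Set.Iic b,
        ENNReal.ofReal (g u * Real.exp (-∫ v in (0 : ℝ)..u, g v)) ∂volume.restrict (Set.Ioi t) := by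
    filter_upwards [eventually_ge_atTop t] with b hb
    have h2 : Set.Iic b ∩ Set.Ioi t = Set.Ioc t b := by ext; simp [and_comm]
    have h3 : IntervalIntegrable (fun u => g u * Real.exp (-∫ v in (0 : ℝ)..u, g v)) volume t b :=
      (hg.intervalIntegrable_density ht).symm.trans (hg.intervalIntegrable_density (ht.trans hb))
    rw [Measure.restrict_restrict measurableSet_Iic, h2, ← ofReal_integral_eq_lintegral_ofReal
      ((intervalIntegrable_iff_integrableOn_Ioc_of_le hb).1 h3)]
    · congr 1
      rw [← intervalIntegral.integral_of_le hb]
      have h4 := intervalIntegral.integral_add_adjacent_intervals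
        (hg.intervalIntegrable_density ht) h3
      rw [integral_mul_exp_neg_integral ht hg.nonneg (hg.integrable t ht),
        integral_mul_exp_neg_integral (ht.trans hb) hg.nonneg (hg.integrable b (ht.trans hb))] at h4
      linarith
    · filter_upwards [ae_restrict_mem measurableSet_Ioc] with u hu
      exact mul_nonneg (hg.nonneg u (ht.trans_lt hu.1)) (Real.exp_pos _).le
  refine Tendsto.congr' h1 (ENNReal.tendsto_ofReal ?_)
  -- Divergence of the integrated hazard enters here: no mass escapes to infinity.
  have h5 : Tendsto (fun b : ℝ => Real.exp (-∫ v in (0 : ℝ)..b, g v)) atTop (𝓝 0) :=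
    Real.tendsto_exp_neg_atTop_nhds_zero.comp hg.tendsto
  simpa using (tendsto_const_nhds (x := Real.exp (-∫ v in (0 : ℝ)..t, g v))).sub h5

theorem hazardLaw_Ioi (hg : IsHazard g) {t : ℝ} (ht : 0 ≤ t) :
    hazardLaw g (Set.Ioi t) = ENNReal.ofReal (Real.exp (-∫ v in (0 : ℝ)..t, g v)) := by
  rw [hazardLaw, withDensity_apply _ measurableSet_Ioi,
    Measure.restrict_restrict measurableSet_Ioi, Set.Ioi_inter_Ioi, sup_of_le_left ht,
    hg.lintegral_Ioi_density ht]

theorem hazardLaw_Iic (g : ℝ → ℝ) {t : ℝ} (ht : t ≤ 0) : hazardLaw g (Set.Iic t) = 0 := by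
  rw [hazardLaw, withDensity_apply _ measurableSet_Iic,
    Measure.restrict_restrict measurableSet_Iic]
  have : Set.Iic t ∩ Set.Ioi 0 = ∅ := by
    ext x; simp only [Set.mem_inter_iff, Set.mem_Iic, Set.mem_Ioi, Set.mem_empty_iff_false,
      iff_false, not_and, not_lt]; exact fun h => h.trans ht
  simp [this]

theorem isProbabilityMeasure (hg : IsHazard g) : IsProbabilityMeasure (hazardLaw g) := by
  constructor
  have h : (Set.univ : Set ℝ) = Set.Iic 0 ∪ Set.Ioi 0 := by simp
  rw [h, measure_union (by simp) measurableSet_Ioi,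
    hazardLaw_Iic g le_rfl, hg.hazardLaw_Ioi le_rfl]
  simp

theorem lintegral_hazardLaw (hg : IsHazard g) {f : ℝ → ℝ≥0∞} (hf : Measurable f) :
    ∫⁻ u, f u ∂hazardLaw g = ∫⁻ u in Set.Ioi 0,
      ENNReal.ofReal (g u * Real.exp (-∫ v in (0 : ℝ)..u, g v)) * f u := by
  rw [hazardLaw, lintegral_withDensity_eq_lintegral_mul _ hg.measurable_density hf]
  rfl

/-- The Laplace transform of a positive time is smaller than one. -/
theorem lintegral_exp_neg_lt_one (hg : IsHazard g) :
    ∫⁻ u, ENNReal.ofReal (Real.exp (-u)) ∂hazardLaw g < 1 := by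
  have := hg.isProbabilityMeasure
  have hm : Measurable fun u : ℝ => ENNReal.ofReal (Real.exp (-u)) := by fun_prop
  have h0 : ∀ᵐ u ∂hazardLaw g, 0 < u := by
    rw [ae_iff]
    simpa [Set.Iic_def] using hazardLaw_Iic g le_rfl
  have hle : ∫⁻ u, ENNReal.ofReal (Real.exp (-u)) ∂hazardLaw g ≠ ∞ := by
    refine ((lintegral_mono_ae (g := fun _ => 1) ?_).trans_lt ?_).ne
    · filter_upwards [h0] with u hu
      rw [ENNReal.ofReal_le_one, Real.exp_le_one_iff]
      linarith
    · simp
  have h1 : ∫⁻ u, ENNReal.ofReal (Real.exp (-u)) ∂hazardLaw g < ∫⁻ _, 1 ∂hazardLaw g := by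
    refine lintegral_strict_mono (NeZero.ne _) aemeasurable_const hle ?_
    filter_upwards [h0] with u hu
    rw [ENNReal.ofReal_lt_one, Real.exp_lt_one_iff]
    linarith
  simpa using h1

end IsHazard

/-! ### The law of the sojourn times -/

theorem isHazard_totalHazard {d : ℕ} {γ : Fin d → Fin d → ℝ → ℝ}
    (hγ_meas : ∀ i j, i ≠ j → Measurable (γ i j))
    (hγ_nonneg : ∀ i j, i ≠ j → ∀ t : ℝ, 0 < t → 0 ≤ γ i j t)
    (hγ_int : ∀ i j, i ≠ j → ∀ t : ℝ, 0 ≤ t → IntervalIntegrable (γ i j) volume 0 t)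
    (hγ_top : ∀ i j, i ≠ j → Tendsto (fun t : ℝ => ∫ u in (0 : ℝ)..t, γ i j u) atTop atTop)
    (hd : ∀ i : Fin d, ∃ j, i ≠ j) (i : Fin d) : IsHazard (totalHazard γ i) := by
  have hne : ∀ j ∈ Finset.univ.erase i, i ≠ j := fun j hj => (Finset.ne_of_mem_erase hj).symm
  have hint : ∀ t, 0 ≤ t → IntervalIntegrable (totalHazard γ i) volume 0 t := by
    intro t ht
    have := IntervalIntegrable.sum (Finset.univ.erase i) (f := fun j => γ i j)
      (fun j hj => hγ_int i j (hne j hj) t ht)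
    have h : totalHazard γ i = ∑ j ∈ Finset.univ.erase i, γ i j := by
      funext u
      simp [totalHazard]
    rwa [h]
  refine ⟨Finset.measurable_fun_sum _ fun j hj => hγ_meas i j (hne j hj),
    fun u hu => Finset.sum_nonneg fun j hj => hγ_nonneg i j (hne j hj) u hu, hint, ?_⟩
  -- One outgoing rate with divergent integral suffices, the others being nonnegative.
  obtain ⟨j, hj⟩ := hd i
  refine tendsto_atTop_mono' _ ?_ (hγ_top i j hj)
  filter_upwards [eventually_ge_atTop 0] with t ht
  rw [intervalIntegral.integral_of_le ht, intervalIntegral.integral_of_le ht]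
  refine integral_mono_ae ((intervalIntegrable_iff_integrableOn_Ioc_of_le ht).1
    (hγ_int i j hj t ht)) ((intervalIntegrable_iff_integrableOn_Ioc_of_le ht).1 (hint t ht)) ?_
  filter_upwards [ae_restrict_mem measurableSet_Ioc] with u hu
  exact Finset.single_le_sum (f := fun k => γ i k u)
    (fun k hk => hγ_nonneg i k (hne k hk) u hu.1)
    (Finset.mem_erase.2 ⟨hj.symm, Finset.mem_univ j⟩)

/-- The first `n` switching times and the states entered at them. -/
def history {Ω : Type*} {d : ℕ} (ε : ℝ≥0 → Ω → Fin d) (τ : ℕ → Ω → ℝ≥0) (n : ℕ) (ω : Ω) :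
    Fin (n + 1) → ℝ≥0 × Fin d :=
  fun k => (τ k ω, ε (τ k ω) ω)

/-- The sojourn time between the `n`-th and the next switching. -/
def sojourn {Ω : Type*} (τ : ℕ → Ω → ℝ≥0) (n : ℕ) (ω : Ω) : ℝ :=
  (τ (n + 1) ω : ℝ) - τ n ω

namespace IsSwitchingProcess

variable {Ω : Type*} {mΩ : MeasurableSpace Ω} {P : Measure Ω} {d : ℕ}
  {γ : Fin d → Fin d → ℝ → ℝ} {ε : ℝ≥0 → Ω → Fin d} {τ : ℕ → Ω → ℝ≥0}

theorem strictMono (hs : IsSwitchingProcess ε τ) (ω : Ω) : StrictMono fun n => τ n ω :=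
  strictMono_nat_of_lt_succ fun n => hs.time_lt n ω

theorem exists_interval (hs : IsSwitchingProcess ε τ) (ω : Ω) (t : ℝ≥0) :
    ∃ n, τ n ω ≤ t ∧ t < τ (n + 1) ω := by
  classical
  obtain ⟨m, hm⟩ := ((tendsto_atTop.1 (hs.time_tendsto ω)) (t + 1)).exists
  have hm' : t < τ m ω := lt_of_lt_of_le (lt_add_of_pos_right t one_pos) hm
  have hex : ∃ m, t < τ m ω := ⟨m, hm'⟩
  have h0 : Nat.find hex ≠ 0 := by
    intro h
    have := Nat.find_spec hex
    rw [h, hs.time_zero] at this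
    exact absurd this (not_lt.2 zero_le)
  obtain ⟨k, hk⟩ := Nat.exists_eq_succ_of_ne_zero h0
  refine ⟨k, not_lt.1 (Nat.find_min hex (m := k) (by omega)), ?_⟩
  have := Nat.find_spec hex
  rwa [hk] at this

/-- The first switch happens on every path and changes the state. Hence the sum defining the total
hazard is never empty. -/
theorem exists_ne [Nonempty Ω] (hs : IsSwitchingProcess ε τ) (i : Fin d) :
    ∃ j : Fin d, i ≠ j := by
  obtain ⟨ω⟩ := ‹Nonempty Ω›
  by_contra! h
  exact hs.state_ne 0 ω ((h _).symm.trans (h _))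

/-- The interval [τ_n, τ_{n+1}) contains a rational time, so the state at a random time can be read
off at countably many deterministic times. -/
theorem measurable_state (hs : IsSwitchingProcess ε τ) (hε : ∀ t, Measurable (ε t)) (n : ℕ) :
    Measurable fun ω => ε (τ n ω) ω := by
  refine measurable_to_countable' fun j => ?_
  have h : (fun ω => ε (τ n ω) ω) ⁻¹' {j} = ⋃ q : ℚ,
      ({ω | τ n ω ≤ Real.toNNReal q} ∩ {ω | Real.toNNReal q < τ (n + 1) ω}) ∩
        ε (Real.toNNReal q) ⁻¹' {j} := by
    ext ω
    simp only [Set.mem_preimage, Set.mem_singleton_iff, Set.mem_iUnion, Set.mem_inter_iff,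
      Set.mem_ofPred_eq]
    constructor
    · intro hj
      obtain ⟨q, hq1, hq2⟩ := exists_rat_btwn (NNReal.coe_lt_coe.2 (hs.time_lt n ω))
      have h1 : τ n ω ≤ Real.toNNReal q := by
        exact NNReal.le_toNNReal_of_coe_le hq1.le
      have h2 : Real.toNNReal q < τ (n + 1) ω := by
        rwa [Real.toNNReal_lt_iff_lt_coe ((NNReal.coe_nonneg _).trans hq1.le)]
      exact ⟨q, ⟨h1, h2⟩, (hs.const_between n ω _ h1 h2).trans hj⟩
    · rintro ⟨q, ⟨h1, h2⟩, h3⟩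
      exact (hs.const_between n ω _ h1 h2).symm.trans h3
  rw [h]
  refine MeasurableSet.iUnion fun q => ?_
  exact ((measurableSet_le (hs.measurable_time n) measurable_const).inter
    (measurableSet_lt measurable_const (hs.measurable_time (n + 1)))).inter
      (hε _ (measurableSet_singleton j))

theorem measurable_history (hs : IsSwitchingProcess ε τ) (hε : ∀ t, Measurable (ε t)) (n : ℕ) :
    Measurable (history ε τ n) :=
  measurable_pi_lambda _ fun k => (hs.measurable_time k).prodMk (hs.measurable_state hε k)

theorem measurable_sojourn (hs : IsSwitchingProcess ε τ) (n : ℕ) : Measurable (sojourn τ n) :=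
  (hs.measurable_time (n + 1)).coe_nnreal_real.sub (hs.measurable_time n).coe_nnreal_real

theorem sojourn_pos (hs : IsSwitchingProcess ε τ) (n : ℕ) (ω : Ω) : 0 < sojourn τ n ω :=
  sub_pos.2 (NNReal.coe_lt_coe.2 (hs.time_lt n ω))

/-- Summation of the semi-Markov identity over the target j ≠ i; no path is lost, since a switch
always changes the state. -/
theorem measure_sojourn_gt (hs : IsSwitchingProcess ε τ) (hε : ∀ t, Measurable (ε t))
    (hγ_meas : ∀ i j, i ≠ j → Measurable (γ i j))
    (hγ_nonneg : ∀ i j, i ≠ j → ∀ t : ℝ, 0 < t → 0 ≤ γ i j t)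
    (hz : ∀ i, IsHazard (totalHazard γ i)) (hsm : IsSemiMarkov P γ ε τ)
    (n : ℕ) (i : Fin d) {A : Set Ω} (hA : MeasurableSet[switchHistory ε τ n] A) (t : ℝ≥0) :
    P (A ∩ {ω | ε (τ n ω) ω = i} ∩ {ω | (t : ℝ) < sojourn τ n ω}) =
      P (A ∩ {ω | ε (τ n ω) ω = i}) * hazardLaw (totalHazard γ i) (Set.Ioi (t : ℝ)) := by
  have hle : switchHistory ε τ n ≤ mΩ := (hs.measurable_history hε n).comap_le
  have hAi : MeasurableSet (A ∩ {ω | ε (τ n ω) ω = i}) :=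
    (hle A hA).inter (hs.measurable_state hε n (measurableSet_singleton i))
  have h1 : A ∩ {ω | ε (τ n ω) ω = i} ∩ {ω | (t : ℝ) < sojourn τ n ω} =
      ⋃ j ∈ Finset.univ.erase i, A ∩ {ω | ε (τ n ω) ω = i} ∩
          {ω | τ n ω + t < τ (n + 1) ω ∧ ε (τ (n + 1) ω) ω = j} := by
    ext ω
    have h2 : (t : ℝ) < sojourn τ n ω ↔ τ n ω + t < τ (n + 1) ω := by
      rw [sojourn, lt_sub_iff_add_lt', ← NNReal.coe_add, NNReal.coe_lt_coe]
    simp only [Set.mem_inter_iff, Set.mem_ofPred_eq, Set.mem_iUnion, h2, Finset.mem_erase,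
      Finset.mem_univ, and_true, exists_prop]
    constructor
    · rintro ⟨⟨ha, hi⟩, hT⟩
      exact ⟨_, hi ▸ hs.state_ne n ω, ⟨ha, hi⟩, hT, rfl⟩
    · rintro ⟨j, -, h, hT, -⟩
      exact ⟨h, hT⟩
  rw [h1, measure_biUnion_finset]
  · have h3 : ∀ j ∈ Finset.univ.erase i, P (A ∩ {ω | ε (τ n ω) ω = i} ∩
          {ω | τ n ω + t < τ (n + 1) ω ∧ ε (τ (n + 1) ω) ω = j}) = P (A ∩ {ω | ε (τ n ω) ω = i}) *
          ∫⁻ u in Set.Ioi (t : ℝ), ENNReal.ofReal (γ i j u * survival γ i u) :=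
      fun j hj => hsm n i j (Finset.ne_of_mem_erase hj).symm A hA t
    rw [Finset.sum_congr rfl h3, ← Finset.mul_sum, ← lintegral_finsetSum']
    · congr 1
      refine Eq.trans ?_ ((hz i).hazardLaw_Ioi t.2).symm
      rw [← (hz i).lintegral_Ioi_density t.2]
      refine setLIntegral_congr_fun measurableSet_Ioi fun u hu => ?_
      have hu0 : 0 < u := lt_of_le_of_lt t.2 hu
      change ∑ j ∈ Finset.univ.erase i, ENNReal.ofReal (γ i j u * survival γ i u) = _
      rw [← ENNReal.ofReal_sum_of_nonneg, ← Finset.sum_mul]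
      · rfl
      · exact fun j hj => mul_nonneg (hγ_nonneg i j (Finset.ne_of_mem_erase hj).symm u hu0)
          (Real.exp_pos _).le
    · exact fun j hj => ((hγ_meas i j (Finset.ne_of_mem_erase hj).symm).mul
        (hz i).measurable_survival).ennreal_ofReal.aemeasurable
  · intro j _ k _ hjk
    refine Set.disjoint_left.2 fun ω h1 h2 => hjk ?_
    exact h1.2.2.symm.trans h2.2.2
  · intro j _
    exact hAi.inter ((measurableSet_lt ((hs.measurable_time n).add_const t)
      (hs.measurable_time (n + 1))).inter
        (hs.measurable_state hε (n + 1) (measurableSet_singleton j)))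

/-- On the event that the current state is i, the sojourn time is independent of the history. On
each history event the tails found in `measure_sojourn_gt` determine the law of the sojourn time,
half-lines being a generating π-system; this verifies the product formula on rectangles. -/
theorem map_history_sojourn [IsFiniteMeasure P] (hs : IsSwitchingProcess ε τ)
    (hε : ∀ t, Measurable (ε t))
    (hγ_meas : ∀ i j, i ≠ j → Measurable (γ i j))
    (hγ_nonneg : ∀ i j, i ≠ j → ∀ t : ℝ, 0 < t → 0 ≤ γ i j t)
    (hz : ∀ i, IsHazard (totalHazard γ i)) (hsm : IsSemiMarkov P γ ε τ) (n : ℕ) (i : Fin d) :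
    (P.restrict {ω | ε (τ n ω) ω = i}).map (fun ω => (history ε τ n ω, sojourn τ n ω)) =
      ((P.restrict {ω | ε (τ n ω) ω = i}).map (history ε τ n)).prod
        (hazardLaw (totalHazard γ i)) := by
  have := (hz i).isProbabilityMeasure
  have hH := hs.measurable_history hε n
  have hT := hs.measurable_sojourn n
  symm
  refine Measure.prod_eq fun s t hs' ht => ?_
  rw [Measure.map_apply (hH.prodMk hT) (hs'.prod ht), Measure.map_apply hH hs']
  have hA : MeasurableSet[switchHistory ε τ n] (history ε τ n ⁻¹' s) := ⟨s, hs', rfl⟩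
  have hAi : MeasurableSet (history ε τ n ⁻¹' s ∩ {ω | ε (τ n ω) ω = i}) :=
    (hH hs').inter (hs.measurable_state hε n (measurableSet_singleton i))
  have key : (P.restrict (history ε τ n ⁻¹' s ∩ {ω | ε (τ n ω) ω = i})).map (sojourn τ n) =
      P (history ε τ n ⁻¹' s ∩ {ω | ε (τ n ω) ω = i}) • hazardLaw (totalHazard γ i) := by
    have hpos : ∀ x : ℝ, x < 0 → Set.Ioi x = Set.Ioc x 0 ∪ Set.Ioi 0 := fun x hx =>
      (Set.Ioc_union_Ioi_eq_Ioi hx.le).symm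
    have hge : ∀ x : ℝ, 0 ≤ x →
        (P.restrict (history ε τ n ⁻¹' s ∩ {ω | ε (τ n ω) ω = i})).map (sojourn τ n) (Set.Ioi x) =
          (P (history ε τ n ⁻¹' s ∩ {ω | ε (τ n ω) ω = i}) • hazardLaw (totalHazard γ i))
            (Set.Ioi x) := by
      intro x hx
      rw [Measure.map_apply hT measurableSet_Ioi, Measure.restrict_apply (hT measurableSet_Ioi),
        Measure.smul_apply, smul_eq_mul, Set.inter_comm]
      exact hs.measure_sojourn_gt hε hγ_meas hγ_nonneg hz hsm n i hA ⟨x, hx⟩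
    have hall : ∀ x : ℝ,
        (P.restrict (history ε τ n ⁻¹' s ∩ {ω | ε (τ n ω) ω = i})).map (sojourn τ n) (Set.Ioi x) =
          (P (history ε τ n ⁻¹' s ∩ {ω | ε (τ n ω) ω = i}) • hazardLaw (totalHazard γ i))
            (Set.Ioi x) := by
      intro x
      rcases le_or_gt 0 x with hx | hx
      · exact hge x hx
      -- Neither measure charges (x, 0], so negative thresholds reduce to the threshold 0.
      · have hdisj : Disjoint (Set.Ioc x 0) (Set.Ioi 0) :=
          Set.disjoint_left.2 fun y hy hy' => absurd hy.2 (not_le.2 hy')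
        rw [hpos x hx, measure_union hdisj measurableSet_Ioi, measure_union hdisj measurableSet_Ioi,
          hge 0 le_rfl]
        congr 1
        have h1 : hazardLaw (totalHazard γ i) (Set.Ioc x 0) = 0 :=
          measure_mono_null (fun y hy => hy.2) (IsHazard.hazardLaw_Iic _ le_rfl)
        rw [Measure.smul_apply, h1, smul_zero, Measure.map_apply hT measurableSet_Ioc]
        have h2 : sojourn τ n ⁻¹' Set.Ioc x 0 = ∅ :=
          Set.eq_empty_of_forall_notMem fun ω hω => absurd hω.2 (not_le.2 (hs.sojourn_pos n ω))
        rw [h2, measure_empty]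
    have : IsFiniteMeasure (P (history ε τ n ⁻¹' s ∩ {ω | ε (τ n ω) ω = i}) •
        hazardLaw (totalHazard γ i)) :=
      Measure.smul_finite _ (measure_ne_top _ _)
    refine ext_of_generate_finite _ (borel_eq_generateFrom_Ioi ℝ ▸ BorelSpace.measurable_eq)
      isPiSystem_Ioi ?_ ?_
    · rintro _ ⟨x, rfl⟩
      exact hall x
    · have h1 : ∀ μ : Measure ℝ, Tendsto (fun k : ℕ => μ (Set.Ioi (-(k : ℝ)))) atTop
          (𝓝 (μ Set.univ)) := by
        intro μ
        have h2 : (⋃ k : ℕ, Set.Ioi (-(k : ℝ))) = Set.univ := by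
          refine Set.eq_univ_of_forall fun x => Set.mem_iUnion.2 ?_
          obtain ⟨k, hk⟩ := exists_nat_gt (-x)
          exact ⟨k, by simp only [Set.mem_Ioi]; linarith⟩
        rw [← h2]
        exact tendsto_measure_iUnion_atTop fun k l hkl => Set.Ioi_subset_Ioi
          (neg_le_neg (Nat.cast_le.2 hkl))
      refine tendsto_nhds_unique (h1 _) ?_
      simp_rw [hall]
      exact h1 _
  have h3 := congrArg (fun μ => μ t) key
  simp only [Measure.map_apply hT ht, Measure.smul_apply, smul_eq_mul] at h3
  rw [Measure.restrict_apply (hH hs'), ← h3, Measure.restrict_apply (hT ht),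
    Measure.restrict_apply ((hH.prodMk hT) (hs'.prod ht))]
  congr 1
  ext ω
  simp only [Set.mem_inter_iff, Set.mem_preimage, Set.mem_prod, Set.mem_ofPred_eq]
  tauto

/-- Given the history up to the `n`-th switching, the next sojourn time has the hazard rate of
the current state. -/
theorem lintegral_history_sojourn [IsFiniteMeasure P] (hs : IsSwitchingProcess ε τ)
    (hε : ∀ t, Measurable (ε t))
    (hγ_meas : ∀ i j, i ≠ j → Measurable (γ i j))
    (hγ_nonneg : ∀ i j, i ≠ j → ∀ t : ℝ, 0 < t → 0 ≤ γ i j t)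
    (hz : ∀ i, IsHazard (totalHazard γ i)) (hsm : IsSemiMarkov P γ ε τ) (n : ℕ)
    {Φ : (Fin (n + 1) → ℝ≥0 × Fin d) × ℝ → ℝ≥0∞} (hΦ : Measurable Φ) :
    ∫⁻ ω, Φ (history ε τ n ω, sojourn τ n ω) ∂P =
      ∫⁻ ω, ∫⁻ u, Φ (history ε τ n ω, u) ∂hazardLaw (totalHazard γ (ε (τ n ω) ω)) ∂P := by
  -- The sojourn law depends on the current state, so Ω is cut along its finitely many values.
  have hsplit : ∀ f : Ω → ℝ≥0∞, ∫⁻ ω, f ω ∂P = ∑' i, ∫⁻ ω in {ω | ε (τ n ω) ω = i}, f ω ∂P := by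
    intro f
    have hmi : ∀ i, MeasurableSet {ω | ε (τ n ω) ω = i} :=
      fun i => hs.measurable_state hε n (measurableSet_singleton i)
    rw [← lintegral_iUnion hmi]
    · have : (⋃ i, {ω | ε (τ n ω) ω = i}) = Set.univ :=
        Set.eq_univ_of_forall fun ω => Set.mem_iUnion.2 ⟨_, rfl⟩
      rw [this, Measure.restrict_univ]
    · intro i j hij
      exact Set.disjoint_left.2 fun ω h1 h2 => hij (h1.symm.trans h2)
  rw [hsplit, hsplit]
  refine tsum_congr fun i => ?_
  have := (hz i).isProbabilityMeasure
  have hH := hs.measurable_history hε n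
  have hT := hs.measurable_sojourn n
  have h1 : ∫⁻ ω in {ω | ε (τ n ω) ω = i},
      ∫⁻ u, Φ (history ε τ n ω, u) ∂hazardLaw (totalHazard γ (ε (τ n ω) ω)) ∂P =
      ∫⁻ ω in {ω | ε (τ n ω) ω = i},
      ∫⁻ u, Φ (history ε τ n ω, u) ∂hazardLaw (totalHazard γ i) ∂P := by
    refine setLIntegral_congr_fun (hs.measurable_state hε n (measurableSet_singleton i)) ?_
    intro ω hω
    simp only [Set.mem_ofPred_eq] at hω
    simp only [hω]
  rw [h1, ← lintegral_map hΦ (hH.prodMk hT),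
    hs.map_history_sojourn hε hγ_meas hγ_nonneg hz hsm n i, lintegral_prod _ hΦ.aemeasurable,
    lintegral_map hΦ.lintegral_prod_right' hH]

end IsSwitchingProcess

/-! ### Path functionals of the switching process -/

namespace IsSwitchingProcess

variable {Ω : Type*} {mΩ : MeasurableSpace Ω} {d : ℕ} {ε : ℝ≥0 → Ω → Fin d} {τ : ℕ → Ω → ℝ≥0}

theorem index_unique (hs : IsSwitchingProcess ε τ) {ω : Ω} {u : ℝ} {n m : ℕ}
    (hn : (τ n ω : ℝ) ≤ u ∧ u < τ (n + 1) ω) (hm : (τ m ω : ℝ) ≤ u ∧ u < τ (m + 1) ω) : n = m := by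
  have h1 : τ n ω < τ (m + 1) ω := NNReal.coe_lt_coe.1 (hn.1.trans_lt hm.2)
  have h2 : τ m ω < τ (n + 1) ω := NNReal.coe_lt_coe.1 (hm.1.trans_lt hn.2)
  have h3 := (hs.strictMono ω).lt_iff_lt.1 h1
  have h4 := (hs.strictMono ω).lt_iff_lt.1 h2
  omega

theorem exists_interval_real (hs : IsSwitchingProcess ε τ) (ω : Ω) {u : ℝ} (hu : 0 ≤ u) :
    ∃ n, (τ n ω : ℝ) ≤ u ∧ u < τ (n + 1) ω := by
  obtain ⟨n, h1, h2⟩ := hs.exists_interval ω ⟨u, hu⟩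
  exact ⟨n, h1, h2⟩

theorem dagger_eq (hs : IsSwitchingProcess ε τ) (z : Fin d → ℝ → ℝ) {ω : Ω} {u : ℝ} {n : ℕ}
    (hn : (τ n ω : ℝ) ≤ u ∧ u < τ (n + 1) ω) :
    dagger ε τ z u ω = z (ε (τ n ω) ω) (u - τ n ω) := by
  rw [dagger, tsum_eq_single n]
  · exact Set.indicator_of_mem (Set.mem_Ico.2 hn) _
  · intro m hm
    exact Set.indicator_of_notMem (fun h => hm (hs.index_unique (Set.mem_Ico.1 h) hn)) _

/-- At most one summand is nonzero, so the series converges for every u, negative ones included.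
Joint measurability then follows from that of the partial sums. -/
theorem tendsto_dagger (hs : IsSwitchingProcess ε τ) (z : Fin d → ℝ → ℝ) (u : ℝ) (ω : Ω) :
    Tendsto (fun k => ∑ n ∈ Finset.range k, (Set.Ico (τ n ω : ℝ) (τ (n + 1) ω : ℝ)).indicator
      (fun v => z (ε (τ n ω) ω) (v - τ n ω)) u) atTop (𝓝 (dagger ε τ z u ω)) := by
  refine Summable.tendsto_sum_tsum_nat ?_
  by_cases h : ∃ n, (τ n ω : ℝ) ≤ u ∧ u < τ (n + 1) ω
  · obtain ⟨n, hn⟩ := h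
    refine summable_of_ne_finset_zero (s := {n}) fun m hm => ?_
    exact Set.indicator_of_notMem
      (fun h => hm (Finset.mem_singleton.2 (hs.index_unique (Set.mem_Ico.1 h) hn))) _
  · push Not at h
    convert! summable_zero with n
    exact Set.indicator_of_notMem (fun h' => absurd (Set.mem_Ico.1 h').2 (not_lt.2 (h n (Set.mem_Ico.1 h').1))) _

theorem measurable_regime (hs : IsSwitchingProcess ε τ) (hε : ∀ t, Measurable (ε t))
    {β : Type*} [MeasurableSpace β] {z : Fin d → ℝ → β} (hz : ∀ i, Measurable (z i)) (n : ℕ) :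
    Measurable fun p : Ω × ℝ => z (ε (τ n p.1) p.1) p.2 := by
  have h1 : Measurable fun q : Fin d × ℝ => z q.1 q.2 := measurable_from_prod_countable_right hz
  exact h1.comp (((hs.measurable_state hε n).comp measurable_fst).prodMk measurable_snd)

theorem measurable_dagger (hs : IsSwitchingProcess ε τ) (hε : ∀ t, Measurable (ε t))
    {z : Fin d → ℝ → ℝ} (hz : ∀ i, Measurable (z i)) :
    Measurable fun p : Ω × ℝ => dagger ε τ z p.2 p.1 := by
  refine measurable_of_tendsto_metrizable (f := fun k (p : Ω × ℝ) => ∑ n ∈ Finset.range k,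
    (Set.Ico (τ n p.1 : ℝ) (τ (n + 1) p.1 : ℝ)).indicator
      (fun v => z (ε (τ n p.1) p.1) (v - τ n p.1)) p.2) (fun k => ?_) ?_
  · refine Finset.measurable_fun_sum _ fun n _ => ?_
    have hτ : ∀ n, Measurable fun p : Ω × ℝ => (τ n p.1 : ℝ) := fun n =>
      ((hs.measurable_time n).comp measurable_fst).coe_nnreal_real
    have h1 : Measurable fun p : Ω × ℝ => z (ε (τ n p.1) p.1) (p.2 - τ n p.1) :=
      (hs.measurable_regime hε hz n).comp
        (measurable_fst.prodMk (measurable_snd.sub (hτ n)))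
    have h2 : MeasurableSet {p : Ω × ℝ | (τ n p.1 : ℝ) ≤ p.2 ∧ p.2 < τ (n + 1) p.1} :=
      (measurableSet_le (hτ n) measurable_snd).inter (measurableSet_lt measurable_snd (hτ (n + 1)))
    exact h1.indicator h2
  · exact tendsto_pi_nhds.2 fun p => hs.tendsto_dagger z p.2 p.1

theorem dagger_add (hs : IsSwitchingProcess ε τ) (y z : Fin d → ℝ → ℝ) {u : ℝ} (hu : 0 ≤ u)
    (ω : Ω) : dagger ε τ (fun i v => y i v + z i v) u ω = dagger ε τ y u ω + dagger ε τ z u ω := by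
  obtain ⟨n, hn⟩ := hs.exists_interval_real ω hu
  simp only [hs.dagger_eq _ hn]

theorem switchCount_eq (hs : IsSwitchingProcess ε τ) {ω : Ω} {t : ℝ≥0} {n : ℕ}
    (hn : τ n ω ≤ t ∧ t < τ (n + 1) ω) : switchCount τ t ω = n := by
  have : {m : ℕ | τ m ω ≤ t} = Set.Iic n := by
    ext m
    simp only [Set.mem_ofPred_eq, Set.mem_Iic]
    constructor
    · intro h
      have := (hs.strictMono ω).lt_iff_lt.1 (h.trans_lt hn.2)
      omega
    · intro h
      exact ((hs.strictMono ω).monotone h).trans hn.1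
  rw [switchCount, this, csSup_Iic]

/-- The index shift is that of the jump part: its summand n, counted from 0, is the jump at τ_{n+1}.
-/
theorem lt_switchCount_iff (hs : IsSwitchingProcess ε τ) {ω : Ω} {t : ℝ≥0} {n : ℕ} :
    n < switchCount τ t ω ↔ τ (n + 1) ω ≤ t := by
  obtain ⟨m, hm⟩ := hs.exists_interval ω t
  rw [hs.switchCount_eq hm]
  constructor
  · intro h
    exact ((hs.strictMono ω).monotone (by omega : n + 1 ≤ m)).trans hm.1
  · intro h
    have := (hs.strictMono ω).lt_iff_lt.1 (h.trans_lt hm.2)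
    omega

theorem switchCount_eq_zero_iff (hs : IsSwitchingProcess ε τ) {ω : Ω} {s : ℝ≥0} :
    switchCount τ s ω = 0 ↔ s < τ 1 ω := by
  rw [← Nat.le_zero, ← not_lt, hs.lt_switchCount_iff, not_le]

end IsSwitchingProcess

/-- The contribution of the `n`-th sojourn interval to a path functional. -/
noncomputable def sojournPiece {Ω : Type*} {d : ℕ} (ε : ℝ≥0 → Ω → Fin d) (τ : ℕ → Ω → ℝ≥0)
    (w : Fin d → ℝ → ℝ≥0∞) (n : ℕ) (u : ℝ) (ω : Ω) : ℝ≥0∞ :=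
  (Set.Ico (τ n ω : ℝ) (τ (n + 1) ω : ℝ)).indicator (fun v => w (ε (τ n ω) ω) (v - τ n ω)) u

/-- The sum of the nonnegative jumps up to time `t`. -/
noncomputable def jumpSum {Ω : Type*} {d : ℕ} (ε : ℝ≥0 → Ω → Fin d) (τ : ℕ → Ω → ℝ≥0)
    (w : Fin d → ℝ → ℝ≥0∞) (t : ℝ≥0) (ω : Ω) : ℝ≥0∞ :=
  ∑ n ∈ Finset.range (switchCount τ t ω), w (ε (τ n ω) ω) (sojourn τ n ω)

namespace IsSwitchingProcess

variable {Ω : Type*} {mΩ : MeasurableSpace Ω} {d : ℕ} {ε : ℝ≥0 → Ω → Fin d} {τ : ℕ → Ω → ℝ≥0}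

theorem tsum_sojournPiece (hs : IsSwitchingProcess ε τ) (w : Fin d → ℝ → ℝ≥0∞) {ω : Ω} {u : ℝ}
    {n : ℕ} (hn : (τ n ω : ℝ) ≤ u ∧ u < τ (n + 1) ω) :
    ∑' m, sojournPiece ε τ w m u ω = w (ε (τ n ω) ω) (u - τ n ω) := by
  rw [tsum_eq_single n]
  · exact Set.indicator_of_mem (Set.mem_Ico.2 hn) _
  · intro m hm
    exact Set.indicator_of_notMem (fun h => hm (hs.index_unique (Set.mem_Ico.1 h) hn)) _

/-- Exactly one interval contains a given u ≥ 0, which is why φ need not vanish at 0. -/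
theorem apply_dagger (hs : IsSwitchingProcess ε τ) (z : Fin d → ℝ → ℝ) (φ : ℝ → ℝ≥0∞) {u : ℝ}
    (hu : 0 ≤ u) (ω : Ω) :
    φ (dagger ε τ z u ω) = ∑' n, sojournPiece ε τ (fun i v => φ (z i v)) n u ω := by
  obtain ⟨n, hn⟩ := hs.exists_interval_real ω hu
  rw [hs.tsum_sojournPiece _ hn, hs.dagger_eq _ hn]

theorem measurable_sojournPiece (hs : IsSwitchingProcess ε τ) (hε : ∀ t, Measurable (ε t))
    {w : Fin d → ℝ → ℝ≥0∞} (hw : ∀ i, Measurable (w i)) (n : ℕ) :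
    Measurable fun p : Ω × ℝ => sojournPiece ε τ w n p.2 p.1 := by
  have hτ : ∀ n, Measurable fun p : Ω × ℝ => (τ n p.1 : ℝ) := fun n =>
    ((hs.measurable_time n).comp measurable_fst).coe_nnreal_real
  have h1 : Measurable fun p : Ω × ℝ => w (ε (τ n p.1) p.1) (p.2 - τ n p.1) :=
    (hs.measurable_regime hε hw n).comp (measurable_fst.prodMk (measurable_snd.sub (hτ n)))
  have h2 : MeasurableSet {p : Ω × ℝ | (τ n p.1 : ℝ) ≤ p.2 ∧ p.2 < τ (n + 1) p.1} :=
    (measurableSet_le (hτ n) measurable_snd).inter (measurableSet_lt measurable_snd (hτ (n + 1)))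
  exact h1.indicator h2

theorem measurable_jump (hs : IsSwitchingProcess ε τ) (hε : ∀ t, Measurable (ε t))
    {β : Type*} [MeasurableSpace β] {z : Fin d → ℝ → β} (hz : ∀ i, Measurable (z i)) (n : ℕ) :
    Measurable fun ω => z (ε (τ n ω) ω) (sojourn τ n ω) :=
  (hs.measurable_regime hε hz n).comp (measurable_id.prodMk (hs.measurable_sojourn n))

theorem sum_range_switchCount (hs : IsSwitchingProcess ε τ) {M : Type*} [AddCommMonoid M]
    (a : ℕ → M) (t : ℝ≥0) (ω : Ω) {k : ℕ} (hk : switchCount τ t ω ≤ k) :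
    ∑ n ∈ Finset.range k, {ω | τ (n + 1) ω ≤ t}.indicator (fun _ => a n) ω =
      ∑ n ∈ Finset.range (switchCount τ t ω), a n := by
  symm
  rw [← Finset.sum_subset (Finset.range_mono hk)]
  · refine Finset.sum_congr rfl fun n hn => ?_
    rw [Set.indicator_of_mem]
    exact hs.lt_switchCount_iff.1 (Finset.mem_range.1 hn)
  · intro n _ hn
    rw [Set.indicator_of_notMem]
    exact fun h => hn (Finset.mem_range.2 (hs.lt_switchCount_iff.2 h))

/-- Trading the random number of summands for indicators allows expectations to be taken term by
term. -/
theorem jumpSum_eq_tsum (hs : IsSwitchingProcess ε τ) (w : Fin d → ℝ → ℝ≥0∞) (t : ℝ≥0) (ω : Ω) :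
    jumpSum ε τ w t ω =
      ∑' n, {ω | τ (n + 1) ω ≤ t}.indicator (fun ω => w (ε (τ n ω) ω) (sojourn τ n ω)) ω := by
  rw [tsum_eq_sum (s := Finset.range (switchCount τ t ω))]
  · exact (hs.sum_range_switchCount (fun n => w (ε (τ n ω) ω) (sojourn τ n ω)) t ω le_rfl).symm
  · intro n hn
    rw [Set.indicator_of_notMem]
    exact fun h => hn (Finset.mem_range.2 (hs.lt_switchCount_iff.2 h))

theorem measurable_jumpSum (hs : IsSwitchingProcess ε τ) (hε : ∀ t, Measurable (ε t))
    {w : Fin d → ℝ → ℝ≥0∞} (hw : ∀ i, Measurable (w i)) (t : ℝ≥0) :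
    Measurable (jumpSum ε τ w t) := by
  have : jumpSum ε τ w t = fun ω => ∑' n, {ω | τ (n + 1) ω ≤ t}.indicator
      (fun ω => w (ε (τ n ω) ω) (sojourn τ n ω)) ω := funext fun ω => hs.jumpSum_eq_tsum w t ω
  rw [this]
  exact Measurable.tsum fun n => (hs.measurable_jump hε hw n).indicator
      (measurableSet_le (hs.measurable_time (n + 1)) measurable_const)

end IsSwitchingProcess

/-- On each path both sums are finite, so `toReal` loses nothing and integrability becomes a
question about two nonnegative expectations. -/
theorem jumpPart_eq_jumpSum_sub {Ω : Type*} {d : ℕ} (ε : ℝ≥0 → Ω → Fin d) (τ : ℕ → Ω → ℝ≥0)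
    (h : Fin d → ℝ → ℝ) (t : ℝ≥0) (ω : Ω) :
    jumpPart ε τ h t ω = (jumpSum ε τ (fun i v => ENNReal.ofReal (h i v)) t ω).toReal -
      (jumpSum ε τ (fun i v => ENNReal.ofReal (-h i v)) t ω).toReal := by
  rw [jumpSum, jumpSum, ENNReal.toReal_sum (by simp), ENNReal.toReal_sum (by simp),
    ← Finset.sum_sub_distrib, jumpPart]
  refine Finset.sum_congr rfl fun n _ => ?_
  rw [ENNReal.toReal_ofReal', ENNReal.toReal_ofReal', sojourn]
  set x := h (ε (τ n ω) ω) ((τ (n + 1) ω : ℝ) - τ n ω)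
  rcases le_total 0 x with hx | hx
  · rw [max_eq_left hx, max_eq_right (by linarith), sub_zero]
  · rw [max_eq_right hx, max_eq_left (by linarith), zero_sub, neg_neg]

/-! ### Renewal structure and the compensator of the jumps -/

/-- A switching process whose sojourn time in state `i`, given the past, has hazard rate `g i`. -/
structure IsRenewalSwitching {Ω : Type*} {mΩ : MeasurableSpace Ω} {d : ℕ} (P : Measure Ω)
    (g : Fin d → ℝ → ℝ) (ε : ℝ≥0 → Ω → Fin d) (τ : ℕ → Ω → ℝ≥0) : Prop where
  switching : IsSwitchingProcess ε τ
  measurable : ∀ t, Measurable (ε t)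
  hazard : ∀ i, IsHazard (g i)
  lintegral_eq : ∀ (n : ℕ) (Φ : (Fin (n + 1) → ℝ≥0 × Fin d) × ℝ → ℝ≥0∞), Measurable Φ →
    ∫⁻ ω, Φ (history ε τ n ω, sojourn τ n ω) ∂P =
      ∫⁻ ω, ∫⁻ u, Φ (history ε τ n ω, u) ∂hazardLaw (g (ε (τ n ω) ω)) ∂P

/-- The event that the process starts in `i` and does not switch up to time `s`. -/
def stayEvent {Ω : Type*} {d : ℕ} (ε : ℝ≥0 → Ω → Fin d) (τ : ℕ → Ω → ℝ≥0) (i : Fin d) (s : ℝ≥0) :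
    Set Ω :=
  {ω | ε 0 ω = i ∧ s < τ 1 ω}

namespace IsRenewalSwitching

variable {Ω : Type*} {mΩ : MeasurableSpace Ω} {P : Measure Ω} {d : ℕ} {g : Fin d → ℝ → ℝ}
  {ε : ℝ≥0 → Ω → Fin d} {τ : ℕ → Ω → ℝ≥0}

theorem measurableSet_stayEvent (hR : IsRenewalSwitching P g ε τ) (i : Fin d) (s : ℝ≥0) :
    MeasurableSet (stayEvent ε τ i s) :=
  (hR.measurable 0 (measurableSet_singleton i)).inter
    (measurableSet_lt (f := fun _ => s) measurable_const (hR.switching.measurable_time 1))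

/-- A uniform bound for the Laplace transforms of the sojourn times. -/
theorem exists_laplace_bound (hR : IsRenewalSwitching P g ε τ) :
    ∃ q : ℝ≥0∞, q < 1 ∧ ∀ i, ∫⁻ u, ENNReal.ofReal (Real.exp (-u)) ∂hazardLaw (g i) ≤ q := by
  refine ⟨Finset.univ.sup fun i => ∫⁻ u, ENNReal.ofReal (Real.exp (-u)) ∂hazardLaw (g i), ?_,
    fun i => Finset.le_sup (f := fun i => ∫⁻ u, ENNReal.ofReal (Real.exp (-u)) ∂hazardLaw (g i))
      (Finset.mem_univ i)⟩
  rw [Finset.sup_lt_iff (by simp)]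
  exact fun i _ => (hR.hazard i).lintegral_exp_neg_lt_one

theorem lintegral_exp_neg_time_le [IsProbabilityMeasure P] (hR : IsRenewalSwitching P g ε τ)
    {q : ℝ≥0∞} (hq : ∀ i, ∫⁻ u, ENNReal.ofReal (Real.exp (-u)) ∂hazardLaw (g i) ≤ q) (n : ℕ) :
    ∫⁻ ω, ENNReal.ofReal (Real.exp (-(τ n ω : ℝ))) ∂P ≤ q ^ n := by
  induction n with
  | zero => simp [hR.switching.time_zero]
  | succ n ih =>
    -- exp(-τ_{n+1}) splits into exp(-τ_n), known from the history, and a sojourn factor whose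
    -- conditional mean is at most q.
    have h1 : Measurable fun p : (Fin (n + 1) → ℝ≥0 × Fin d) × ℝ =>
        ENNReal.ofReal (Real.exp (-((p.1 (Fin.last n)).1 : ℝ))) *
          ENNReal.ofReal (Real.exp (-p.2)) := by fun_prop
    have h2 := hR.lintegral_eq n _ h1
    have h3 : ∀ ω, ENNReal.ofReal (Real.exp (-(τ (n + 1) ω : ℝ))) =
        ENNReal.ofReal (Real.exp (-((history ε τ n ω (Fin.last n)).1 : ℝ))) *
          ENNReal.ofReal (Real.exp (-sojourn τ n ω)) := by
      intro ω
      rw [← ENNReal.ofReal_mul (Real.exp_pos _).le, ← Real.exp_add]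
      simp only [history, sojourn, Fin.val_last]
      ring_nf
    simp_rw [h3]
    rw [h2, pow_succ]
    calc _ ≤ ∫⁻ ω, ENNReal.ofReal (Real.exp (-(τ n ω : ℝ))) * q ∂P := by
          refine lintegral_mono fun ω => ?_
          beta_reduce
          simp only [history, Fin.val_last]
          rw [lintegral_const_mul _ (by fun_prop)]
          gcongr
          exact hq _
      _ = (∫⁻ ω, ENNReal.ofReal (Real.exp (-(τ n ω : ℝ))) ∂P) * q := by
          refine lintegral_mul_const _ ?_
          have := hR.switching.measurable_time n
          fun_prop
      _ ≤ q ^ n * q := by gcongr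

/-- The expected number of switchings in bounded time is finite. -/
theorem tsum_measure_time_le_ne_top [IsProbabilityMeasure P] (hR : IsRenewalSwitching P g ε τ)
    (t : ℝ≥0) : ∑' n, P {ω | τ n ω ≤ t} ≠ ∞ := by
  obtain ⟨q, hq1, hq⟩ := hR.exists_laplace_bound
  -- Markov's inequality for exp(-τ_n): on {τ_n ≤ t} one has 1 ≤ exp(t) exp(-τ_n). The resulting
  -- bounds form a geometric series.
  have h1 : ∀ n, P {ω | τ n ω ≤ t} ≤ ENNReal.ofReal (Real.exp t) * q ^ n := by
    intro n
    have hm : MeasurableSet {ω | τ n ω ≤ t} :=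
      measurableSet_le (hR.switching.measurable_time n) measurable_const
    rw [← lintegral_indicator_one hm]
    calc _ ≤ ∫⁻ ω, ENNReal.ofReal (Real.exp t) * ENNReal.ofReal (Real.exp (-(τ n ω : ℝ))) ∂P := by
          refine lintegral_mono fun ω => ?_
          by_cases hω : τ n ω ≤ t
          swap
          · rw [Set.indicator_of_notMem (by exact hω)]
            exact zero_le
          rw [Set.indicator_of_mem (by exact hω)]
          rw [← ENNReal.ofReal_mul (Real.exp_pos _).le, ← Real.exp_add, Pi.one_apply,
            ENNReal.one_le_ofReal, Real.one_le_exp_iff]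
          have : (τ n ω : ℝ) ≤ t := NNReal.coe_le_coe.2 hω
          linarith
      _ = ENNReal.ofReal (Real.exp t) * ∫⁻ ω, ENNReal.ofReal (Real.exp (-(τ n ω : ℝ))) ∂P := by
          refine lintegral_const_mul _ ?_
          have := hR.switching.measurable_time n
          fun_prop
      _ ≤ _ := by
          gcongr
          exact hR.lintegral_exp_neg_time_le hq n
  refine ((ENNReal.tsum_le_tsum h1).trans_lt ?_).ne
  rw [ENNReal.tsum_mul_left, ENNReal.tsum_geometric]
  exact ENNReal.mul_lt_top ENNReal.ofReal_lt_top
    (ENNReal.inv_lt_top.2 (tsub_pos_of_lt hq1))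

/-- Expected path functionals of locally integrable regimes are finite. -/
theorem lintegral_enorm_dagger_ne_top [IsProbabilityMeasure P] (hR : IsRenewalSwitching P g ε τ)
    {z : Fin d → ℝ → ℝ} (hz : ∀ i, Measurable (z i))
    (hint : ∀ i, ∀ t : ℝ, 0 ≤ t → IntervalIntegrable (z i) volume 0 t) (t : ℝ≥0) :
    ∫⁻ ω, (∫⁻ u in Set.Ioc (0 : ℝ) t, ‖dagger ε τ z u ω‖ₑ) ∂P ≠ ∞ := by
  have hs := hR.switching
  set w : Fin d → ℝ → ℝ≥0∞ := fun i v => ‖z i v‖ₑ with hw_def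
  have hw : ∀ i, Measurable (w i) := fun i => (hz i).enorm
  -- Within [0, t] the age of a sojourn stays in [0, t], so L bounds the contribution of any single
  -- sojourn, whatever its state; the number of sojourns has finite mean.
  set L : ℝ≥0∞ := ∑ i, ∫⁻ v in Set.Icc (0 : ℝ) t, w i v with hL
  have hL_top : L ≠ ∞ := by
    refine (ENNReal.sum_lt_top.2 fun i _ => ?_).ne
    have := (intervalIntegrable_iff_integrableOn_Icc_of_le (f := z i) (μ := volume) t.2
      (by simp)).1 (hint i t t.2)
    exact this.hasFiniteIntegral
  have h1 : ∀ n ω, ∫⁻ u in Set.Ioc (0 : ℝ) t, sojournPiece ε τ w n u ω ≤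
      {ω | τ n ω ≤ t}.indicator (fun _ => L) ω := by
    intro n ω
    by_cases hω : τ n ω ≤ t
    · rw [Set.indicator_of_mem (by exact hω)]
      calc ∫⁻ u in Set.Ioc (0 : ℝ) t, sojournPiece ε τ w n u ω
          ≤ ∫⁻ u, (Set.Icc (0 : ℝ) t).indicator (w (ε (τ n ω) ω)) (u - τ n ω) := by
            rw [← lintegral_indicator measurableSet_Ioc]
            refine lintegral_mono fun u => ?_
            by_cases hu : u ∈ Set.Ioc (0 : ℝ) t
            swap
            · rw [Set.indicator_of_notMem hu]
              exact zero_le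
            rw [Set.indicator_of_mem hu, sojournPiece]
            by_cases hv : u ∈ Set.Ico (τ n ω : ℝ) (τ (n + 1) ω : ℝ)
            swap
            · rw [Set.indicator_of_notMem hv]
              exact zero_le
            rw [Set.indicator_of_mem hv, Set.indicator_of_mem]
            have := (τ n ω).2
            exact ⟨sub_nonneg.2 hv.1, by linarith [hu.2, show (0 : ℝ) ≤ τ n ω from this]⟩
        _ = ∫⁻ u in Set.Icc (0 : ℝ) t, w (ε (τ n ω) ω) u := by
            rw [lintegral_sub_right_eq_self
              (fun u => (Set.Icc (0 : ℝ) t).indicator (w (ε (τ n ω) ω)) u),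
              lintegral_indicator measurableSet_Icc]
        _ ≤ L := Finset.single_le_sum (f := fun i => ∫⁻ v in Set.Icc (0 : ℝ) t, w i v)
            (fun _ _ => zero_le) (Finset.mem_univ _)
    · have h0 : ∀ u ∈ Set.Ioc (0 : ℝ) t, sojournPiece ε τ w n u ω = 0 := by
        intro u hu
        refine Set.indicator_of_notMem (fun h => hω ?_) _
        exact NNReal.coe_le_coe.1 ((Set.mem_Ico.1 h).1.trans hu.2)
      rw [setLIntegral_congr_fun measurableSet_Ioc h0]
      simp
  have hmp : ∀ n ω, Measurable fun u => sojournPiece ε τ w n u ω := fun n ω =>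
    (hs.measurable_sojournPiece hR.measurable hw n).comp measurable_prodMk_left
  refine ((lintegral_mono (g := fun ω => ∑' n, {ω | τ n ω ≤ t}.indicator (fun _ => L) ω)
    fun ω => ?_).trans_lt ?_).ne
  · have h2 : ∫⁻ u in Set.Ioc (0 : ℝ) t, ‖dagger ε τ z u ω‖ₑ =
        ∫⁻ u in Set.Ioc (0 : ℝ) t, ∑' n, sojournPiece ε τ w n u ω :=
      setLIntegral_congr_fun measurableSet_Ioc fun u hu =>
        hs.apply_dagger z (fun x => ‖x‖ₑ) hu.1.le ω
    beta_reduce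
    rw [h2, lintegral_tsum fun n => (hmp n ω).aemeasurable]
    exact ENNReal.tsum_le_tsum fun n => h1 n ω
  · have hm : ∀ n, MeasurableSet {ω | τ n ω ≤ t} := fun n =>
      measurableSet_le (hs.measurable_time n) measurable_const
    rw [lintegral_tsum (f := fun n ω => {ω | τ n ω ≤ t}.indicator (fun _ => L) ω)
      fun n => (measurable_const.indicator (hm n)).aemeasurable]
    simp_rw [lintegral_indicator_const (hm _)]
    rw [ENNReal.tsum_mul_left]
    exact ENNReal.mul_lt_top hL_top.lt_top (hR.tsum_measure_time_le_ne_top t).lt_top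

theorem integrable_dagger [IsProbabilityMeasure P] (hR : IsRenewalSwitching P g ε τ)
    {z : Fin d → ℝ → ℝ} (hz : ∀ i, Measurable (z i))
    (hint : ∀ i, ∀ t : ℝ, 0 ≤ t → IntervalIntegrable (z i) volume 0 t) (t : ℝ≥0) :
    Integrable (fun p : Ω × ℝ => dagger ε τ z p.2 p.1)
      (P.prod (volume.restrict (Set.Ioc (0 : ℝ) t))) := by
  have hm := hR.switching.measurable_dagger hR.measurable hz
  refine ⟨hm.aestronglyMeasurable, ?_⟩
  rw [hasFiniteIntegral_iff_enorm, lintegral_prod _ hm.enorm.aemeasurable]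
  exact (hR.lintegral_enorm_dagger_ne_top hz hint t).lt_top

/-- The compensator of one jump, for a sojourn begun at r. By Fubini, a point u ≥ r is still covered
by the sojourn with probability equal to the survival function at u - r, and f(u - r) times that is
the density of the sojourn law. -/
theorem lintegral_hazardLaw_shift {f : ℝ → ℝ} (hf : IsHazard f) {h : ℝ → ℝ} (hh : Measurable h)
    (r s t : ℝ) :
    ∫⁻ v, {v | s < r + v ∧ r + v ≤ t}.indicator (fun v => ENNReal.ofReal (h v)) v ∂hazardLaw f =
      ∫⁻ v, (∫⁻ u in Set.Ioc s t, (Set.Ico r (r + v)).indicator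
        (fun u => ENNReal.ofReal (f (u - r) * h (u - r))) u) ∂hazardLaw f := by
  have := hf.isProbabilityMeasure
  have hmset : MeasurableSet {v : ℝ | s < r + v ∧ r + v ≤ t} :=
    (measurableSet_lt (f := fun _ => s) (g := fun v => r + v) (by fun_prop) (by fun_prop)).inter
      (measurableSet_le (f := fun v => r + v) (g := fun _ => t) (by fun_prop) (by fun_prop))
  have hfh : Measurable fun u => ENNReal.ofReal (f (u - r) * h (u - r)) :=
    ((hf.measurable.mul hh).comp (measurable_id.sub_const r)).ennreal_ofReal
  rw [hf.lintegral_hazardLaw (hh.ennreal_ofReal.indicator hmset), lintegral_lintegral_swap]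
  swap
  · refine Measurable.aemeasurable ?_
    have h2 : MeasurableSet {p : ℝ × ℝ | r ≤ p.2 ∧ p.2 < r + p.1} :=
      (measurableSet_le measurable_const measurable_snd).inter
        (measurableSet_lt measurable_snd (by fun_prop))
    exact (hfh.comp measurable_snd).indicator h2
  have h1 : ∀ u : ℝ, ∫⁻ v, (Set.Ico r (r + v)).indicator
      (fun u => ENNReal.ofReal (f (u - r) * h (u - r))) u ∂hazardLaw f =
      (Set.Ici 0).indicator (fun w => ENNReal.ofReal (f w * h w) *
        ENNReal.ofReal (Real.exp (-∫ x in (0 : ℝ)..w, f x))) (u - r) := by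
    intro u
    by_cases hu : r ≤ u
    · have hu' : 0 ≤ u - r := sub_nonneg.2 hu
      rw [Set.indicator_of_mem (by exact hu'), ← hf.hazardLaw_Ioi hu',
        ← lintegral_indicator_const measurableSet_Ioi]
      refine lintegral_congr fun v => ?_
      by_cases hv : u < r + v
      · rw [Set.indicator_of_mem (Set.mem_Ico.2 ⟨hu, hv⟩),
          Set.indicator_of_mem (by rw [Set.mem_Ioi]; linarith)]
      · rw [Set.indicator_of_notMem (fun h => hv (Set.mem_Ico.1 h).2),
          Set.indicator_of_notMem (by rw [Set.mem_Ioi]; intro h; exact hv (by linarith))]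
    · rw [Set.indicator_of_notMem (by rw [Set.mem_Ici]; intro h; exact hu (by linarith))]
      simp_rw [Set.indicator_of_notMem (fun h => hu (Set.mem_Ico.1 h).1)]
      simp
  simp_rw [h1]
  rw [← lintegral_indicator measurableSet_Ioc, ← lintegral_indicator measurableSet_Ioi]
  have h3 := lintegral_sub_right_eq_self (μ := (volume : Measure ℝ))
    (fun w => {v | s < r + v ∧ r + v ≤ t}.indicator ((Set.Ici 0).indicator
      (fun w => ENNReal.ofReal (f w * h w) *
        ENNReal.ofReal (Real.exp (-∫ x in (0 : ℝ)..w, f x)))) w) r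
  refine Eq.trans ?_ (h3.symm.trans (lintegral_congr fun u => ?_))
  · refine lintegral_congr_ae ?_
    -- The point 0 is discarded: nonnegativity of the hazard is only known on (0, ∞), and the two
    -- indicator sets differ there.
    have h0 : ∀ᵐ w : ℝ, w ≠ 0 := by simp [ae_iff]
    filter_upwards [h0] with w hw
    by_cases hw0 : 0 < w
    · rw [Set.indicator_of_mem (by exact hw0)]
      by_cases hws : s < r + w ∧ r + w ≤ t
      · rw [Set.indicator_of_mem (by exact hws), Set.indicator_of_mem (by exact hws),
          Set.indicator_of_mem (by exact hw0.le),
          ENNReal.ofReal_mul (hf.nonneg w hw0), ENNReal.ofReal_mul (hf.nonneg w hw0)]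
        ring
      · rw [Set.indicator_of_notMem (by exact hws), Set.indicator_of_notMem (by exact hws),
          mul_zero]
    · rw [Set.indicator_of_notMem (by exact hw0)]
      have : w ∉ Set.Ici (0 : ℝ) := fun h => hw0 (lt_of_le_of_ne h hw.symm)
      symm
      by_cases hws : s < r + w ∧ r + w ≤ t
      · rw [Set.indicator_of_mem (by exact hws), Set.indicator_of_notMem this]
      · rw [Set.indicator_of_notMem (by exact hws)]
  · have hmem : u - r ∈ {v | s < r + v ∧ r + v ≤ t} ↔ u ∈ Set.Ioc s t := by
      rw [Set.mem_ofPred_eq, add_sub_cancel, Set.mem_Ioc]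
    by_cases hu : u ∈ Set.Ioc s t
    · rw [Set.indicator_of_mem (hmem.2 hu), Set.indicator_of_mem hu]
    · rw [Set.indicator_of_notMem (fun h => hu (hmem.1 h)), Set.indicator_of_notMem hu]

end IsRenewalSwitching

namespace IsRenewalSwitching

variable {Ω : Type*} {mΩ : MeasurableSpace Ω} {P : Measure Ω} {d : ℕ} {g : Fin d → ℝ → ℝ}
  {ε : ℝ≥0 → Ω → Fin d} {τ : ℕ → Ω → ℝ≥0}

/-- With the history frozen, the next sojourn time is integrated out on both sides against the same
law, and `lintegral_hazardLaw_shift` compares the results. The weight V is there to carry the event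
of no early switching. -/
theorem lintegral_jump_eq (hR : IsRenewalSwitching P g ε τ) {h : Fin d → ℝ → ℝ}
    (hh : ∀ i, Measurable (h i)) (n : ℕ) {V : (Fin (n + 1) → ℝ≥0 × Fin d) → ℝ≥0∞}
    (hV : Measurable V) (s t : ℝ≥0) :
    ∫⁻ ω, V (history ε τ n ω) * {ω | s < τ (n + 1) ω ∧ τ (n + 1) ω ≤ t}.indicator
        (fun ω => ENNReal.ofReal (h (ε (τ n ω) ω) (sojourn τ n ω))) ω ∂P =
      ∫⁻ ω, V (history ε τ n ω) * (∫⁻ u in Set.Ioc (s : ℝ) t,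
        sojournPiece ε τ (fun i v => ENNReal.ofReal (g i v * h i v)) n u ω) ∂P := by
  set r : (Fin (n + 1) → ℝ≥0 × Fin d) → ℝ := fun y => (y (Fin.last n)).1 with hr
  set st : (Fin (n + 1) → ℝ≥0 × Fin d) → Fin d := fun y => (y (Fin.last n)).2 with hst
  have hrm : Measurable r := by fun_prop
  have hstm : Measurable st := by fun_prop
  have hreg : ∀ {w : Fin d → ℝ → ℝ≥0∞}, (∀ i, Measurable (w i)) →
      Measurable fun q : Fin d × ℝ => w q.1 q.2 := fun hw => measurable_from_prod_countable_right hw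
  have hh' : Measurable fun q : Fin d × ℝ => ENNReal.ofReal (h q.1 q.2) :=
    hreg (w := fun i v => ENNReal.ofReal (h i v)) fun i => (hh i).ennreal_ofReal
  have hgh' : Measurable fun q : Fin d × ℝ => ENNReal.ofReal (g q.1 q.2 * h q.1 q.2) :=
    hreg (w := fun i v => ENNReal.ofReal (g i v * h i v))
      fun i => ((hR.hazard i).measurable.mul (hh i)).ennreal_ofReal
  have hm1 : Measurable fun p : (Fin (n + 1) → ℝ≥0 × Fin d) × ℝ => V p.1 *
      {v | (s : ℝ) < r p.1 + v ∧ r p.1 + v ≤ t}.indicator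
        (fun v => ENNReal.ofReal (h (st p.1) v)) p.2 := by
    refine (hV.comp measurable_fst).mul ?_
    have h1 : Measurable fun p : (Fin (n + 1) → ℝ≥0 × Fin d) × ℝ =>
        ENNReal.ofReal (h (st p.1) p.2) :=
      hh'.comp ((hstm.comp measurable_fst).prodMk measurable_snd)
    have h2 : MeasurableSet {p : (Fin (n + 1) → ℝ≥0 × Fin d) × ℝ |
        (s : ℝ) < r p.1 + p.2 ∧ r p.1 + p.2 ≤ t} :=
      (measurableSet_lt (f := fun _ => (s : ℝ))
        (g := fun p : (Fin (n + 1) → ℝ≥0 × Fin d) × ℝ => r p.1 + p.2)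
        (by fun_prop) (by fun_prop)).inter
        (measurableSet_le (f := fun p : (Fin (n + 1) → ℝ≥0 × Fin d) × ℝ => r p.1 + p.2) (g := fun _ => (t : ℝ))
          (by fun_prop) (by fun_prop))
    exact h1.indicator h2
  have hm2 : Measurable fun p : (Fin (n + 1) → ℝ≥0 × Fin d) × ℝ =>
      ∫⁻ u in Set.Ioc (s : ℝ) t, (Set.Ico (r p.1) (r p.1 + p.2)).indicator
        (fun u => ENNReal.ofReal (g (st p.1) (u - r p.1) * h (st p.1) (u - r p.1))) u := by
    refine Measurable.lintegral_prod_right' (f := fun q : ((Fin (n + 1) → ℝ≥0 × Fin d) × ℝ) × ℝ =>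
      (Set.Ico (r q.1.1) (r q.1.1 + q.1.2)).indicator (fun u => ENNReal.ofReal
        (g (st q.1.1) (u - r q.1.1) * h (st q.1.1) (u - r q.1.1))) q.2) ?_
    have h1 : Measurable fun q : ((Fin (n + 1) → ℝ≥0 × Fin d) × ℝ) × ℝ => ENNReal.ofReal
        (g (st q.1.1) (q.2 - r q.1.1) * h (st q.1.1) (q.2 - r q.1.1)) :=
      hgh'.comp ((hstm.comp (measurable_fst.comp measurable_fst)).prodMk
        (measurable_snd.sub (hrm.comp (measurable_fst.comp measurable_fst))))
    have h2 : MeasurableSet {q : ((Fin (n + 1) → ℝ≥0 × Fin d) × ℝ) × ℝ |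
        r q.1.1 ≤ q.2 ∧ q.2 < r q.1.1 + q.1.2} :=
      (measurableSet_le (f := fun q : ((Fin (n + 1) → ℝ≥0 × Fin d) × ℝ) × ℝ => r q.1.1)
        (g := fun q => q.2) (by fun_prop) (by fun_prop)).inter
        (measurableSet_lt (f := fun q : ((Fin (n + 1) → ℝ≥0 × Fin d) × ℝ) × ℝ => q.2)
          (g := fun q => r q.1.1 + q.1.2) (by fun_prop) (by fun_prop))
    exact h1.indicator h2
  have hadd : ∀ ω, r (history ε τ n ω) + sojourn τ n ω = τ (n + 1) ω := by
    intro ω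
    simp [hr, history, sojourn]
  have hrh : ∀ ω, r (history ε τ n ω) = τ n ω := by
    intro ω
    simp [hr, history]
  have hsth : ∀ ω, st (history ε τ n ω) = ε (τ n ω) ω := by
    intro ω
    simp [hst, history]
  have e1 := hR.lintegral_eq n _ hm1
  have e2 := hR.lintegral_eq n _ ((hV.comp measurable_fst).mul hm2)
  have l1 : ∀ ω, {ω | s < τ (n + 1) ω ∧ τ (n + 1) ω ≤ t}.indicator
        (fun ω => ENNReal.ofReal (h (ε (τ n ω) ω) (sojourn τ n ω))) ω =
      {v | (s : ℝ) < r (history ε τ n ω) + v ∧ r (history ε τ n ω) + v ≤ t}.indicator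
        (fun v => ENNReal.ofReal (h (st (history ε τ n ω)) v)) (sojourn τ n ω) := by
    intro ω
    have hiff : sojourn τ n ω ∈
        {v | (s : ℝ) < r (history ε τ n ω) + v ∧ r (history ε τ n ω) + v ≤ t} ↔
        ω ∈ {ω | s < τ (n + 1) ω ∧ τ (n + 1) ω ≤ t} := by
      rw [Set.mem_ofPred_eq, Set.mem_ofPred_eq, hadd, NNReal.coe_lt_coe, NNReal.coe_le_coe]
    by_cases hω : ω ∈ {ω | s < τ (n + 1) ω ∧ τ (n + 1) ω ≤ t}
    · rw [Set.indicator_of_mem hω, Set.indicator_of_mem (hiff.2 hω), hsth]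
    · rw [Set.indicator_of_notMem hω, Set.indicator_of_notMem (fun h => hω (hiff.1 h))]
  have l2 : ∀ ω u, sojournPiece ε τ (fun i v => ENNReal.ofReal (g i v * h i v)) n u ω =
      (Set.Ico (r (history ε τ n ω)) (r (history ε τ n ω) + sojourn τ n ω)).indicator
        (fun u => ENNReal.ofReal (g (st (history ε τ n ω)) (u - r (history ε τ n ω)) *
          h (st (history ε τ n ω)) (u - r (history ε τ n ω)))) u := by
    intro ω u
    rw [hadd, hrh, hsth]
    rfl
  simp_rw [l1, l2]
  refine e1.trans (Eq.trans ?_ e2.symm)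
  refine lintegral_congr fun ω => ?_
  have hz := hR.hazard (ε (τ n ω) ω)
  simp only [Pi.mul_apply, Function.comp_apply]
  rw [lintegral_const_mul, lintegral_const_mul, hsth]
  · congr 1
    exact lintegral_hazardLaw_shift hz (hh _) _ _ _
  · exact hm2.comp (measurable_prodMk_left (x := history ε τ n ω))
  · have h1 : MeasurableSet {v : ℝ | (s : ℝ) < r (history ε τ n ω) + v ∧
        r (history ε τ n ω) + v ≤ t} :=
      (measurableSet_lt (f := fun _ => (s : ℝ)) (g := fun v => r (history ε τ n ω) + v)
        (by fun_prop) (by fun_prop)).inter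
        (measurableSet_le (f := fun v => r (history ε τ n ω) + v) (g := fun _ => (t : ℝ))
          (by fun_prop) (by fun_prop))
    exact ((hh _).ennreal_ofReal).indicator h1

/-- The compensator formula for nonnegative jumps, on the event of no switching up to time `s`. -/
theorem setLIntegral_jumpSum (hR : IsRenewalSwitching P g ε τ) {h : Fin d → ℝ → ℝ}
    (hh : ∀ i, Measurable (h i)) (i : Fin d) (s t : ℝ≥0) :
    ∫⁻ ω in stayEvent ε τ i s, jumpSum ε τ (fun i v => ENNReal.ofReal (h i v)) t ω ∂P =
      ∫⁻ ω in stayEvent ε τ i s, (∫⁻ u in Set.Ioc (s : ℝ) t,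
        ENNReal.ofReal (dagger ε τ (fun i v => g i v * h i v) u ω)) ∂P := by
  have hs := hR.switching
  have hA := hR.measurableSet_stayEvent i s
  have hw : ∀ i, Measurable (fun v => ENNReal.ofReal (h i v)) := fun i => (hh i).ennreal_ofReal
  have hgw : ∀ i, Measurable (fun v => ENNReal.ofReal (g i v * h i v)) := fun i =>
    ((hR.hazard i).measurable.mul (hh i)).ennreal_ofReal
  have e1 : ∀ ω, ∫⁻ u in Set.Ioc (s : ℝ) t,
      ENNReal.ofReal (dagger ε τ (fun i v => g i v * h i v) u ω) =
      ∑' n, ∫⁻ u in Set.Ioc (s : ℝ) t,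
        sojournPiece ε τ (fun i v => ENNReal.ofReal (g i v * h i v)) n u ω := by
    intro ω
    have hmp : ∀ n, Measurable fun u =>
        sojournPiece ε τ (fun i v => ENNReal.ofReal (g i v * h i v)) n u ω := fun n =>
      (hs.measurable_sojournPiece hR.measurable hgw n).comp measurable_prodMk_left
    rw [← lintegral_tsum fun n => (hmp n).aemeasurable]
    exact setLIntegral_congr_fun measurableSet_Ioc fun u hu =>
      hs.apply_dagger _ ENNReal.ofReal (s.2.trans hu.1.le) ω
  simp_rw [e1, hs.jumpSum_eq_tsum]
  rw [lintegral_tsum fun n => ((hs.measurable_jump hR.measurable hw n).indicator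
      (measurableSet_le (hs.measurable_time (n + 1)) measurable_const)).aemeasurable,
    lintegral_tsum fun n => (Measurable.lintegral_prod_right' (f := fun p : Ω × ℝ =>
      sojournPiece ε τ (fun i v => ENNReal.ofReal (g i v * h i v)) n p.2 p.1)
        (hs.measurable_sojournPiece hR.measurable hgw n)).aemeasurable]
  refine tsum_congr fun n => ?_
  -- The event of no switching up to s has to be expressed through the history at τ_n. For n ≥ 1
  -- that history contains τ_1. For n = 0 it does not, and the missing condition s < τ_1 comes from
  -- the window s < τ_{n+1} on the jump side, and from s < u < τ_1 on the compensator side.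
  set C : Set (Fin (n + 1) → ℝ≥0 × Fin d) :=
    {y | (y 0).2 = i ∧ ∀ k : Fin (n + 1), (k : ℕ) = 1 → s < (y k).1} with hC
  have hCm : MeasurableSet C := by
    refine (measurableSet_eq_fun (f := fun y : Fin (n + 1) → ℝ≥0 × Fin d => (y 0).2)
      (g := fun _ => i) (by fun_prop) (by fun_prop)).inter ?_
    have : {y : Fin (n + 1) → ℝ≥0 × Fin d | ∀ k : Fin (n + 1), (k : ℕ) = 1 → s < (y k).1} =
        ⋂ k : Fin (n + 1), {y | (k : ℕ) = 1 → s < (y k).1} := by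
      ext; simp
    change MeasurableSet {y : Fin (n + 1) → ℝ≥0 × Fin d |
      ∀ k : Fin (n + 1), (k : ℕ) = 1 → s < (y k).1}
    rw [this]
    refine MeasurableSet.iInter fun k => ?_
    by_cases hk : (k : ℕ) = 1
    · simp only [hk, true_imp_iff]
      exact measurableSet_lt (f := fun _ => s) (by fun_prop) (by fun_prop)
    · simp only [hk, false_imp_iff]
      exact MeasurableSet.univ
  have hCiff : ∀ ω, history ε τ n ω ∈ C ↔ ε 0 ω = i ∧ (1 ≤ n → s < τ 1 ω) := by
    intro ω
    simp only [hC, Set.mem_ofPred_eq, history, Fin.val_zero, hs.time_zero]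
    refine and_congr Iff.rfl ⟨fun h h1 => ?_, fun h k hk => ?_⟩
    · exact h ⟨1, by omega⟩ rfl
    · rw [hk]
      exact h (by have := k.2; omega)
  have key := hR.lintegral_jump_eq hh n
    (V := C.indicator (fun _ => 1)) (measurable_const.indicator hCm) s t
  rw [← lintegral_indicator hA, ← lintegral_indicator hA]
  refine Eq.trans (lintegral_congr fun ω => ?_) (key.trans (lintegral_congr fun ω => ?_))
  · by_cases hω : ω ∈ stayEvent ε τ i s
    · have h1 : history ε τ n ω ∈ C := (hCiff ω).2 ⟨hω.1, fun _ => hω.2⟩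
      have h2 : s < τ (n + 1) ω :=
        hω.2.trans_le ((hs.strictMono ω).monotone (by omega : 1 ≤ n + 1))
      rw [Set.indicator_of_mem hω, Set.indicator_of_mem h1, one_mul]
      by_cases h3 : τ (n + 1) ω ≤ t
      · rw [Set.indicator_of_mem (by exact h3), Set.indicator_of_mem (by exact ⟨h2, h3⟩)]
      · rw [Set.indicator_of_notMem (by exact h3),
          Set.indicator_of_notMem (by exact fun h => h3 h.2)]
    · rw [Set.indicator_of_notMem hω]
      symm
      by_cases h1 : history ε τ n ω ∈ C
      · rw [Set.indicator_of_notMem (a := ω), mul_zero]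
        intro h2
        obtain ⟨h3, h4⟩ := (hCiff ω).1 h1
        refine hω ⟨h3, ?_⟩
        rcases Nat.eq_zero_or_pos n with rfl | hn
        · exact h2.1
        · exact h4 hn
      · rw [Set.indicator_of_notMem h1, zero_mul]
  · by_cases hω : ω ∈ stayEvent ε τ i s
    · have h1 : history ε τ n ω ∈ C := (hCiff ω).2 ⟨hω.1, fun _ => hω.2⟩
      rw [Set.indicator_of_mem hω, Set.indicator_of_mem h1, one_mul]
    · rw [Set.indicator_of_notMem hω]
      by_cases h1 : history ε τ n ω ∈ C
      · obtain ⟨h3, h4⟩ := (hCiff ω).1 h1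
        rcases Nat.eq_zero_or_pos n with rfl | hn
        · have h5 : ∀ u ∈ Set.Ioc (s : ℝ) t,
              sojournPiece ε τ (fun i v => ENNReal.ofReal (g i v * h i v)) 0 u ω = 0 := by
            intro u hu
            refine Set.indicator_of_notMem (fun h => hω ⟨h3, ?_⟩) _
            exact NNReal.coe_lt_coe.1 (hu.1.trans (Set.mem_Ico.1 h).2)
          rw [setLIntegral_congr_fun measurableSet_Ioc h5]
          simp
        · exact absurd ⟨h3, h4 hn⟩ hω
      · rw [Set.indicator_of_notMem h1, zero_mul]

/-- The probability of not switching up to time `s`. -/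
theorem measure_stayEvent [IsProbabilityMeasure P] (hR : IsRenewalSwitching P g ε τ)
    (i : Fin d) (s : ℝ≥0) :
    P (stayEvent ε τ i s) =
      P {ω | ε 0 ω = i} * ENNReal.ofReal (Real.exp (-∫ v in (0 : ℝ)..s, g i v)) := by
  have hs := hR.switching
  have h0 : MeasurableSet {ω | ε 0 ω = i} := hR.measurable 0 (measurableSet_singleton i)
  have hm : Measurable fun p : (Fin (0 + 1) → ℝ≥0 × Fin d) × ℝ =>
      {y : Fin (0 + 1) → ℝ≥0 × Fin d | (y 0).2 = i}.indicator (fun _ => (1 : ℝ≥0∞)) p.1 *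
        (Set.Ioi (s : ℝ)).indicator (fun _ => (1 : ℝ≥0∞)) p.2 := by
    refine Measurable.mul ?_ ?_
    · refine Measurable.comp (measurable_const.indicator ?_) measurable_fst
      exact measurableSet_eq_fun (f := fun y : Fin (0 + 1) → ℝ≥0 × Fin d => (y 0).2)
        (g := fun _ => i) (by fun_prop) (by fun_prop)
    · exact (measurable_const.indicator measurableSet_Ioi).comp measurable_snd
  have e := hR.lintegral_eq 0 _ hm
  have l1 : ∀ ω, {y : Fin (0 + 1) → ℝ≥0 × Fin d | (y 0).2 = i}.indicator (fun _ => (1 : ℝ≥0∞))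
      (history ε τ 0 ω) = {ω | ε 0 ω = i}.indicator (fun _ => 1) ω := by
    intro ω
    have : history ε τ 0 ω ∈ {y : Fin (0 + 1) → ℝ≥0 × Fin d | (y 0).2 = i} ↔
        ω ∈ {ω | ε 0 ω = i} := by
      simp [history, hs.time_zero]
    by_cases h : ω ∈ {ω | ε 0 ω = i}
    · rw [Set.indicator_of_mem h, Set.indicator_of_mem (this.2 h)]
    · rw [Set.indicator_of_notMem h, Set.indicator_of_notMem (fun h' => h (this.1 h'))]
  calc P (stayEvent ε τ i s)
      = ∫⁻ ω, {y : Fin (0 + 1) → ℝ≥0 × Fin d | (y 0).2 = i}.indicator (fun _ => (1 : ℝ≥0∞))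
          (history ε τ 0 ω) * (Set.Ioi (s : ℝ)).indicator (fun _ => (1 : ℝ≥0∞))
            (sojourn τ 0 ω) ∂P := by
        rw [← lintegral_indicator_one (hR.measurableSet_stayEvent i s)]
        refine lintegral_congr fun ω => ?_
        have h2 : sojourn τ 0 ω ∈ Set.Ioi (s : ℝ) ↔ s < τ 1 ω := by
          simp [sojourn, hs.time_zero]
        rw [l1]
        by_cases h : ε 0 ω = i
        · rw [Set.indicator_of_mem (a := ω) (s := {ω | ε 0 ω = i}) (by exact h), one_mul]
          by_cases h3 : s < τ 1 ω
          · rw [Set.indicator_of_mem (h2.2 h3), Set.indicator_of_mem (by exact ⟨h, h3⟩)]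
            rfl
          · rw [Set.indicator_of_notMem (fun h' => h3 (h2.1 h')),
              Set.indicator_of_notMem (by exact fun h' => h3 h'.2)]
        · rw [Set.indicator_of_notMem (a := ω) (s := {ω | ε 0 ω = i}) (by exact h), zero_mul,
            Set.indicator_of_notMem (by exact fun h' => h h'.1)]
    _ = ∫⁻ ω, {ω | ε 0 ω = i}.indicator (fun _ =>
          ENNReal.ofReal (Real.exp (-∫ v in (0 : ℝ)..s, g i v))) ω ∂P := by
        refine e.trans (lintegral_congr fun ω => ?_)
        dsimp only
        rw [lintegral_const_mul _ (measurable_const.indicator measurableSet_Ioi),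
          lintegral_indicator_const measurableSet_Ioi, one_mul, l1, hs.time_zero]
        by_cases h : ε 0 ω = i
        · rw [Set.indicator_of_mem (by exact h), Set.indicator_of_mem (by exact h), one_mul, h,
            (hR.hazard i).hazardLaw_Ioi s.coe_nonneg]
        · rw [Set.indicator_of_notMem (by exact h), Set.indicator_of_notMem (by exact h), zero_mul]
    _ = _ := by rw [lintegral_indicator_const h0, mul_comm]

end IsRenewalSwitching

/-! ### Means of the drift and the jumps on the event of no switching -/

theorem IsSwitchingProcess.dagger_neg {Ω : Type*} {mΩ : MeasurableSpace Ω} {d : ℕ}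
    {ε : ℝ≥0 → Ω → Fin d} {τ : ℕ → Ω → ℝ≥0} (hs : IsSwitchingProcess ε τ) (z : Fin d → ℝ → ℝ)
    {u : ℝ} (hu : 0 ≤ u) (ω : Ω) :
    dagger ε τ (fun i v => -z i v) u ω = -dagger ε τ z u ω := by
  obtain ⟨n, hn⟩ := hs.exists_interval_real ω hu
  simp only [hs.dagger_eq _ hn]

namespace IsRenewalSwitching

variable {Ω : Type*} {mΩ : MeasurableSpace Ω} {P : Measure Ω} {d : ℕ} {g : Fin d → ℝ → ℝ}
  {ε : ℝ≥0 → Ω → Fin d} {τ : ℕ → Ω → ℝ≥0}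

theorem integrable_dagger_restrict [IsProbabilityMeasure P] (hR : IsRenewalSwitching P g ε τ)
    {z : Fin d → ℝ → ℝ} (hz : ∀ i, Measurable (z i))
    (hint : ∀ i, ∀ t : ℝ, 0 ≤ t → IntervalIntegrable (z i) volume 0 t) (A : Set Ω) (s t : ℝ≥0) :
    Integrable (fun p : Ω × ℝ => dagger ε τ z p.2 p.1)
      ((P.restrict A).prod (volume.restrict (Set.Ioc (s : ℝ) t))) := by
  have h := hR.integrable_dagger hz hint t
  rw [← Measure.restrict_univ (μ := P), Measure.prod_restrict] at h
  rw [Measure.prod_restrict]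
  exact IntegrableOn.mono_set h
    (Set.prod_mono (Set.subset_univ A) (Set.Ioc_subset_Ioc_left s.coe_nonneg))

/-- Local integrability of the γ_i h_i makes the compensators of the positive and of the negative
jumps both finite in mean, so the two nonnegative formulas may be subtracted. -/
theorem setIntegral_jumpPart [IsProbabilityMeasure P] (hR : IsRenewalSwitching P g ε τ)
    {h : Fin d → ℝ → ℝ} (hh : ∀ i, Measurable (h i))
    (hint : ∀ i, ∀ t : ℝ, 0 ≤ t → IntervalIntegrable (fun v => g i v * h i v) volume 0 t)
    (i : Fin d) (s t : ℝ≥0) :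
    IntegrableOn (jumpPart ε τ h t) (stayEvent ε τ i s) P ∧
      ∫ ω in stayEvent ε τ i s, jumpPart ε τ h t ω ∂P =
        ∫ p, dagger ε τ (fun i v => g i v * h i v) p.2 p.1
          ∂((P.restrict (stayEvent ε τ i s)).prod (volume.restrict (Set.Ioc (s : ℝ) t))) := by
  have hs := hR.switching
  have hghm : ∀ i, Measurable fun v => g i v * h i v := fun i =>
    (hR.hazard i).measurable.mul (hh i)
  have hm := hs.measurable_dagger hR.measurable hghm
  have hI := hR.integrable_dagger_restrict hghm hint (stayEvent ε τ i s) s t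
  have e1 := hR.setLIntegral_jumpSum hh i s t
  have e2 := hR.setLIntegral_jumpSum (h := fun i v => -h i v) (fun i => (hh i).neg) i s t
  have e3 : ∫⁻ ω in stayEvent ε τ i s, (∫⁻ u in Set.Ioc (s : ℝ) t,
        ENNReal.ofReal (dagger ε τ (fun i v => g i v * -h i v) u ω)) ∂P =
      ∫⁻ ω in stayEvent ε τ i s, (∫⁻ u in Set.Ioc (s : ℝ) t,
        ENNReal.ofReal (-dagger ε τ (fun i v => g i v * h i v) u ω)) ∂P := by
    refine lintegral_congr fun ω => setLIntegral_congr_fun measurableSet_Ioc fun u hu => ?_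
    rw [← hs.dagger_neg _ (s.coe_nonneg.trans hu.1.le)]
    simp only [mul_neg]
  rw [e3, ← lintegral_prod (fun p : Ω × ℝ => ENNReal.ofReal
    (-dagger ε τ (fun i v => g i v * h i v) p.2 p.1)) hm.neg.ennreal_ofReal.aemeasurable] at e2
  rw [← lintegral_prod (fun p : Ω × ℝ => ENNReal.ofReal
    (dagger ε τ (fun i v => g i v * h i v) p.2 p.1)) hm.ennreal_ofReal.aemeasurable] at e1
  have f1 := hI.lintegral_lt_top.ne
  have f2 := hI.neg.lintegral_lt_top.ne
  simp only [Pi.neg_apply] at f2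
  have m1 := hs.measurable_jumpSum hR.measurable (fun i => (hh i).ennreal_ofReal) t
  have m2 := hs.measurable_jumpSum hR.measurable (fun i => (hh i).neg.ennreal_ofReal) t
  simp only [Pi.neg_apply] at m2
  have i1 := integrable_toReal_of_lintegral_ne_top
    (μ := P.restrict (stayEvent ε τ i s)) m1.aemeasurable (e1 ▸ f1)
  have i2 := integrable_toReal_of_lintegral_ne_top
    (μ := P.restrict (stayEvent ε τ i s)) m2.aemeasurable (e2 ▸ f2)
  have hj : jumpPart ε τ h t = fun ω =>
      (jumpSum ε τ (fun i v => ENNReal.ofReal (h i v)) t ω).toReal -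
      (jumpSum ε τ (fun i v => ENNReal.ofReal (-h i v)) t ω).toReal :=
    funext fun ω => jumpPart_eq_jumpSum_sub ε τ h t ω
  have hlt : ∀ (w : Fin d → ℝ → ℝ), ∀ᵐ ω ∂P.restrict (stayEvent ε τ i s),
      jumpSum ε τ (fun i v => ENNReal.ofReal (w i v)) t ω < ∞ := fun w =>
    Eventually.of_forall fun ω => ENNReal.sum_lt_top.2 fun n _ => ENNReal.ofReal_lt_top
  rw [hj]
  refine ⟨i1.sub i2, ?_⟩
  rw [integral_sub i1 i2, integral_toReal m1.aemeasurable (hlt h),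
    integral_toReal m2.aemeasurable (hlt fun i v => -h i v), e1, e2,
    integral_eq_lintegral_pos_part_sub_lintegral_neg_part hI]

theorem setIntegral_telegraphPart [IsProbabilityMeasure P] (hR : IsRenewalSwitching P g ε τ)
    {c : Fin d → ℝ → ℝ} (hc : ∀ i, Measurable (c i))
    (hint : ∀ i, ∀ t : ℝ, 0 ≤ t → IntervalIntegrable (c i) volume 0 t)
    (i : Fin d) {s t : ℝ≥0} (hst : s ≤ t) :
    Integrable (telegraphPart ε τ c t) P ∧
      ∫ ω in stayEvent ε τ i s, telegraphPart ε τ c t ω ∂P =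
        P.real (stayEvent ε τ i s) * (∫ u in (0 : ℝ)..s, c i u) + ∫ p, dagger ε τ c p.2 p.1
          ∂((P.restrict (stayEvent ε τ i s)).prod (volume.restrict (Set.Ioc (s : ℝ) t))) := by
  have hs := hR.switching
  have hst' : (s : ℝ) ≤ t := hst
  have hI := hR.integrable_dagger hc hint t
  have hA := hR.measurableSet_stayEvent i s
  have ht : telegraphPart ε τ c t = fun ω => ∫ u in Set.Ioc (0 : ℝ) t, dagger ε τ c u ω :=
    funext fun ω => intervalIntegral.integral_of_le t.coe_nonneg
  have hT : Integrable (telegraphPart ε τ c t) P := ht ▸ hI.integral_prod_left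
  refine ⟨hT, ?_⟩
  have hI2 := hR.integrable_dagger_restrict hc hint (stayEvent ε τ i s) s t
  rw [integral_prod _ hI2]
  have e1 : P.real (stayEvent ε τ i s) * (∫ u in (0 : ℝ)..s, c i u) =
      ∫ _ in stayEvent ε τ i s, (∫ u in (0 : ℝ)..s, c i u) ∂P := by
    rw [setIntegral_const, smul_eq_mul]
  rw [e1, ← integral_add (integrable_const _) hI2.integral_prod_left]
  refine integral_congr_ae ?_
  filter_upwards [ae_restrict_mem hA, ae_restrict_of_ae hI.prod_right_ae] with ω hω hωI
  have i1 : IntervalIntegrable (fun u => dagger ε τ c u ω) volume 0 t :=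
    (intervalIntegrable_iff_integrableOn_Ioc_of_le t.coe_nonneg).2 hωI
  have i2 : IntervalIntegrable (fun u => dagger ε τ c u ω) volume 0 s :=
    i1.mono_set (by rw [Set.uIcc_of_le s.coe_nonneg, Set.uIcc_of_le t.coe_nonneg]; exact Set.Icc_subset_Icc_right hst')
  have i3 : IntervalIntegrable (fun u => dagger ε τ c u ω) volume s t := i2.symm.trans i1
  rw [telegraphPart, ← intervalIntegral.integral_add_adjacent_intervals i2 i3,
    intervalIntegral.integral_of_le hst']
  congr 1
  refine intervalIntegral.integral_congr_ae (Eventually.of_forall fun u hu => ?_)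
  rw [Set.uIoc_of_le s.coe_nonneg] at hu
  rw [hs.dagger_eq (n := 0) c, hs.time_zero, hω.1]
  · simp
  · rw [hs.time_zero]
    exact ⟨hu.1.le, hu.2.trans_lt (NNReal.coe_lt_coe.2 hω.2)⟩

/-- The mean of the telegraph process with jumps, on the event of no switching up to time `s`. -/
theorem setIntegral_telegraph_add_jump [IsProbabilityMeasure P] (hR : IsRenewalSwitching P g ε τ)
    {c h : Fin d → ℝ → ℝ} (hc : ∀ i, Measurable (c i)) (hh : ∀ i, Measurable (h i))
    (hcint : ∀ i, ∀ t : ℝ, 0 ≤ t → IntervalIntegrable (c i) volume 0 t)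
    (hhint : ∀ i, ∀ t : ℝ, 0 ≤ t → IntervalIntegrable (fun v => g i v * h i v) volume 0 t)
    (i : Fin d) {s t : ℝ≥0} (hst : s ≤ t) :
    IntegrableOn (fun ω => telegraphPart ε τ c t ω + jumpPart ε τ h t ω) (stayEvent ε τ i s) P ∧
      ∫ ω in stayEvent ε τ i s, (telegraphPart ε τ c t ω + jumpPart ε τ h t ω) ∂P =
        P.real (stayEvent ε τ i s) * (∫ u in (0 : ℝ)..s, c i u) +
        ∫ p, dagger ε τ (fun i v => g i v * h i v + c i v) p.2 p.1
          ∂((P.restrict (stayEvent ε τ i s)).prod (volume.restrict (Set.Ioc (s : ℝ) t))) := by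
  obtain ⟨i1, e1⟩ := hR.setIntegral_telegraphPart hc hcint i hst
  obtain ⟨i2, e2⟩ := hR.setIntegral_jumpPart hh hhint i s t
  have hghm : ∀ i, Measurable fun v => g i v * h i v := fun i =>
    (hR.hazard i).measurable.mul (hh i)
  refine ⟨i1.integrableOn.add i2, ?_⟩
  rw [integral_add i1.integrableOn i2, e1, e2, add_assoc, ← integral_add
    (hR.integrable_dagger_restrict hc hcint _ s t)
    (hR.integrable_dagger_restrict hghm hhint _ s t)]
  congr 1
  have hmem : ∀ᵐ p : Ω × ℝ ∂((P.restrict (stayEvent ε τ i s)).prod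
      (volume.restrict (Set.Ioc (s : ℝ) t))), p ∈ stayEvent ε τ i s ×ˢ Set.Ioc (s : ℝ) t := by
    rw [Measure.prod_restrict]
    exact ae_restrict_mem ((hR.measurableSet_stayEvent i s).prod measurableSet_Ioc)
  refine integral_congr_ae ?_
  filter_upwards [hmem] with p hp
  rw [hR.switching.dagger_add _ _ (s.coe_nonneg.trans hp.2.1.le), add_comm]

end IsRenewalSwitching

/-! ### From vanishing means to a vanishing drift, and back -/

/-- Lebesgue differentiation: the primitive has derivative f almost everywhere, yet is locally
constant in the interior. -/
theorem ae_eq_zero_of_forall_setIntegral_Ioc_eq_zero {f : ℝ → ℝ} {a b : ℝ} (hab : a ≤ b)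
    (hf : IntegrableOn f (Set.Ioc a b)) (h : ∀ t ∈ Set.Icc a b, ∫ u in Set.Ioc a t, f u = 0) :
    ∀ᵐ u, u ∈ Set.Ioc a b → f u = 0 := by
  have hi := (intervalIntegrable_iff_integrableOn_Ioc_of_le hab).2 hf
  have hb : ∀ᵐ u : ℝ, u ≠ b := by simp [ae_iff]
  filter_upwards [hi.ae_hasDerivAt_integral, hb] with u hu hub hmem
  have hlt : u < b := lt_of_le_of_ne hmem.2 hub
  rw [Set.uIcc_of_le hab] at hu
  have h1 := hu ⟨hmem.1.le, hmem.2⟩ a (Set.left_mem_Icc.2 hab)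
  have h2 : HasDerivAt (fun x => ∫ v in a..x, f v) 0 u := by
    refine (hasDerivAt_const u (0 : ℝ)).congr_of_eventuallyEq ?_
    filter_upwards [Ioo_mem_nhds hmem.1 hlt] with x hx
    rw [intervalIntegral.integral_of_le hx.1.le, h x ⟨hx.1.le, hx.2.le⟩]
  exact h1.unique h2

namespace IsRenewalSwitching

variable {Ω : Type*} {mΩ : MeasurableSpace Ω} {P : Measure Ω} {d : ℕ} {g : Fin d → ℝ → ℝ}
  {ε : ℝ≥0 → Ω → Fin d} {τ : ℕ → Ω → ℝ≥0}

/-- If the jump part is integrable, then the compensator density is locally integrable. -/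
theorem intervalIntegrable_of_integrableOn_jumpPart [IsProbabilityMeasure P]
    (hR : IsRenewalSwitching P g ε τ) {h : Fin d → ℝ → ℝ} (hh : ∀ i, Measurable (h i)) (i : Fin d)
    (hi : P {ω | ε 0 ω = i} ≠ 0) (t : ℝ≥0)
    (hint : IntegrableOn (jumpPart ε τ h t) {ω | ε 0 ω = i} P) :
    IntervalIntegrable (fun v => g i v * h i v) volume 0 t := by
  have hs := hR.switching
  have hz := hR.hazard
  have h0 : MeasurableSet {ω | ε 0 ω = i} := hR.measurable 0 (measurableSet_singleton i)
  -- S j is the probability that a sojourn in state j outlasts t; its minimum m over the finitely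
  -- many states is positive.
  set S : Fin d → ℝ≥0∞ := fun j => ENNReal.ofReal (Real.exp (-∫ v in (0 : ℝ)..t, g j v)) with hS
  set m : ℝ≥0∞ := Finset.univ.inf S with hm
  have hm0 : 0 < m := by
    rw [hm, Finset.lt_inf_iff (by simp)]
    exact fun j _ => ENNReal.ofReal_pos.2 (Real.exp_pos _)
  -- the second sojourn time exceeds `t` with probability bounded below
  set C : Set (Fin (1 + 1) → ℝ≥0 × Fin d) := {y | (y 0).2 = i ∧ (y 1).1 ≤ t} with hC
  have hCm : MeasurableSet C :=
    (measurableSet_eq_fun (f := fun y : Fin (1 + 1) → ℝ≥0 × Fin d => (y 0).2)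
      (g := fun _ => i) (by fun_prop) (by fun_prop)).inter
      (measurableSet_le (f := fun y : Fin (1 + 1) → ℝ≥0 × Fin d => (y 1).1) (g := fun _ => t)
        (by fun_prop) (by fun_prop))
  set W : (Fin (1 + 1) → ℝ≥0 × Fin d) → ℝ≥0∞ :=
    C.indicator (fun y => ‖h i (y 1).1‖ₑ) with hW
  have hWm : Measurable W := by
    refine Measurable.indicator ?_ hCm
    exact ((hh i).comp (by fun_prop)).enorm
  have e1 := hR.lintegral_eq 1 (fun p => W p.1 * (Set.Ioi (t : ℝ)).indicator (fun _ => 1) p.2)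
    ((hWm.comp measurable_fst).mul ((measurable_const.indicator measurableSet_Ioi).comp
      measurable_snd))
  have hWhist : ∀ ω, W (history ε τ 1 ω) =
      {ω | ε 0 ω = i ∧ τ 1 ω ≤ t}.indicator (fun ω => ‖h i (τ 1 ω)‖ₑ) ω := by
    intro ω
    have hiff : history ε τ 1 ω ∈ C ↔ ω ∈ {ω | ε 0 ω = i ∧ τ 1 ω ≤ t} := by
      simp [hC, history, hs.time_zero]
    by_cases hω : ω ∈ {ω | ε 0 ω = i ∧ τ 1 ω ≤ t}
    · rw [Set.indicator_of_mem hω, hW, Set.indicator_of_mem (hiff.2 hω)]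
      rfl
    · rw [Set.indicator_of_notMem hω, hW, Set.indicator_of_notMem (fun h => hω (hiff.1 h))]
  have b1 : ∫⁻ ω, W (history ε τ 1 ω) *
      (Set.Ioi (t : ℝ)).indicator (fun _ => 1) (sojourn τ 1 ω) ∂P ≠ ∞ := by
    refine (lt_of_le_of_lt ?_ hint.hasFiniteIntegral).ne
    rw [← lintegral_indicator h0]
    refine lintegral_mono fun ω => ?_
    rw [hWhist]
    by_cases hω : ω ∈ {ω | ε 0 ω = i ∧ τ 1 ω ≤ t}
    swap
    · rw [Set.indicator_of_notMem hω, zero_mul]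
      exact zero_le
    by_cases hT : sojourn τ 1 ω ∈ Set.Ioi (t : ℝ)
    swap
    · rw [Set.indicator_of_notMem hT, mul_zero]
      exact zero_le
    -- With τ_1 ≤ t and the next sojourn longer than t there is exactly one switch up to t. The jump
    -- part is then the single term h_i(τ_1), and no cancellation can hide its size.
    have h2 : t < τ 2 ω := by
      have h3 : (t : ℝ) < (τ 2 ω : ℝ) - τ 1 ω := hT
      rw [← NNReal.coe_lt_coe]
      linarith [(τ 1 ω).coe_nonneg]
    have hN : switchCount τ t ω = 1 := hs.switchCount_eq ⟨hω.2, h2⟩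
    rw [Set.indicator_of_mem hω, Set.indicator_of_mem hT, mul_one,
      Set.indicator_of_mem (by exact hω.1), jumpPart, hN, Finset.sum_range_one, hs.time_zero, hω.1,
      NNReal.coe_zero, sub_zero]
  have b2 : (∫⁻ ω, W (history ε τ 1 ω) ∂P) * m ≠ ∞ := by
    refine (lt_of_le_of_lt ?_ (lt_top_iff_ne_top.2 b1)).ne
    have hWh : Measurable fun ω => W (history ε τ 1 ω) :=
      hWm.comp (hs.measurable_history hR.measurable 1)
    rw [← lintegral_mul_const _ hWh]
    refine le_of_le_of_eq (lintegral_mono fun ω => ?_) e1.symm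
    dsimp only
    rw [lintegral_const_mul _ (measurable_const.indicator measurableSet_Ioi),
      lintegral_indicator_const measurableSet_Ioi, one_mul, (hz _).hazardLaw_Ioi t.coe_nonneg]
    gcongr
    exact Finset.inf_le (f := S) (Finset.mem_univ (ε (τ 1 ω) ω))
  have b3 : ∫⁻ ω, W (history ε τ 1 ω) ∂P ≠ ∞ := fun h => b2 (by
    rw [h, ENNReal.top_mul hm0.ne'])
  -- the law of the first sojourn time
  have hDm : MeasurableSet {y : Fin (0 + 1) → ℝ≥0 × Fin d | (y 0).2 = i} :=
    measurableSet_eq_fun (f := fun y : Fin (0 + 1) → ℝ≥0 × Fin d => (y 0).2)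
      (g := fun _ => i) (by fun_prop) (by fun_prop)
  have hHm : Measurable ((Set.Iic (t : ℝ)).indicator fun v => ‖h i v‖ₑ) :=
    (hh i).enorm.indicator measurableSet_Iic
  have e2 := hR.lintegral_eq 0 (fun p => {y : Fin (0 + 1) → ℝ≥0 × Fin d | (y 0).2 = i}.indicator
      (fun _ => 1) p.1 * (Set.Iic (t : ℝ)).indicator (fun v => ‖h i v‖ₑ) p.2)
    (((measurable_const.indicator hDm).comp measurable_fst).mul (hHm.comp measurable_snd))
  have hD : ∀ ω, {y : Fin (0 + 1) → ℝ≥0 × Fin d | (y 0).2 = i}.indicator (fun _ => (1 : ℝ≥0∞))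
      (history ε τ 0 ω) = {ω | ε 0 ω = i}.indicator (fun _ => 1) ω := by
    intro ω
    have : history ε τ 0 ω ∈ {y : Fin (0 + 1) → ℝ≥0 × Fin d | (y 0).2 = i} ↔
        ω ∈ {ω | ε 0 ω = i} := by
      simp [history, hs.time_zero]
    by_cases h : ω ∈ {ω | ε 0 ω = i}
    · rw [Set.indicator_of_mem h, Set.indicator_of_mem (this.2 h)]
    · rw [Set.indicator_of_notMem h, Set.indicator_of_notMem (fun h' => h (this.1 h'))]
  have e3 : ∫⁻ ω, W (history ε τ 1 ω) ∂P =
      P {ω | ε 0 ω = i} * ∫⁻ v, (Set.Iic (t : ℝ)).indicator (fun v => ‖h i v‖ₑ) v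
        ∂hazardLaw (g i) := by
    rw [mul_comm, ← lintegral_indicator_const h0]
    refine Eq.trans (lintegral_congr fun ω => ?_) (e2.trans (lintegral_congr fun ω => ?_))
    · have hT : sojourn τ 0 ω = τ 1 ω := by simp [sojourn, hs.time_zero]
      dsimp only
      rw [hWhist, hD, hT]
      by_cases h1 : ε 0 ω = i
      · rw [Set.indicator_of_mem (a := ω) (s := {ω | ε 0 ω = i}) (by exact h1), one_mul]
        by_cases h2 : τ 1 ω ≤ t
        · rw [Set.indicator_of_mem (by exact ⟨h1, h2⟩),
            Set.indicator_of_mem (by exact NNReal.coe_le_coe.2 h2)]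
        · rw [Set.indicator_of_notMem (by exact fun h => h2 h.2),
            Set.indicator_of_notMem (by exact fun h => h2 (NNReal.coe_le_coe.1 h))]
      · rw [Set.indicator_of_notMem (a := ω) (s := {ω | ε 0 ω = i}) (by exact h1), zero_mul,
          Set.indicator_of_notMem (by exact fun h => h1 h.1)]
    · dsimp only
      rw [lintegral_const_mul _ hHm, hD, hs.time_zero]
      by_cases h1 : ε 0 ω = i
      · rw [Set.indicator_of_mem (by exact h1), Set.indicator_of_mem (by exact h1), one_mul, h1]
      · rw [Set.indicator_of_notMem (by exact h1), Set.indicator_of_notMem (by exact h1), zero_mul]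
  have b4 : ∫⁻ v, (Set.Iic (t : ℝ)).indicator (fun v => ‖h i v‖ₑ) v ∂hazardLaw (g i) ≠ ∞ :=
    fun h => b3 (by rw [e3, h, ENNReal.mul_top hi])
  rw [(hz i).lintegral_hazardLaw hHm] at b4
  rw [intervalIntegrable_iff_integrableOn_Ioc_of_le t.coe_nonneg]
  refine ⟨((hz i).measurable.mul (hh i)).aestronglyMeasurable, ?_⟩
  have hSpos : S i ≠ 0 := (ENNReal.ofReal_pos.2 (Real.exp_pos _)).ne'
  -- On (0, t] the survival function is at least its value at t, so the weight can be divided out.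
  have b5 : S i * ∫⁻ v in Set.Ioc (0 : ℝ) t, ‖g i v * h i v‖ₑ ≠ ∞ := by
    refine (lt_of_le_of_lt ?_ (lt_top_iff_ne_top.2 b4)).ne
    have hghm : Measurable fun v => ‖g i v * h i v‖ₑ := ((hz i).measurable.mul (hh i)).enorm
    rw [← lintegral_const_mul _ hghm,
      ← lintegral_indicator measurableSet_Ioc, ← lintegral_indicator measurableSet_Ioi]
    refine lintegral_mono fun v => ?_
    by_cases hv : v ∈ Set.Ioc (0 : ℝ) t
    swap
    · rw [Set.indicator_of_notMem hv]
      exact zero_le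
    rw [Set.indicator_of_mem hv, Set.indicator_of_mem (by exact hv.1),
      Set.indicator_of_mem (by exact hv.2), enorm_mul, Real.enorm_of_nonneg ((hz i).nonneg v hv.1),
      ENNReal.ofReal_mul ((hz i).nonneg v hv.1), ← mul_assoc, mul_comm (S i)]
    gcongr
    exact ENNReal.ofReal_le_ofReal ((hz i).survival_anti hv.1.le hv.2)
  rw [hasFiniteIntegral_iff_enorm, lt_top_iff_ne_top]
  exact fun h => b5 (by rw [h, ENNReal.mul_top hSpos])

theorem measure_stayEvent_ne_zero [IsProbabilityMeasure P] (hR : IsRenewalSwitching P g ε τ)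
    {i : Fin d} (hi : P {ω | ε 0 ω = i} ≠ 0) (s : ℝ≥0) : P (stayEvent ε τ i s) ≠ 0 := by
  rw [hR.measure_stayEvent]
  exact mul_ne_zero hi (ENNReal.ofReal_pos.2 (Real.exp_pos _)).ne'

/-- A regime whose path integral after time `s` has mean zero on each event of no switching up
to time `s` vanishes. -/
theorem ae_eq_zero_of_integral_dagger_eq_zero [IsProbabilityMeasure P]
    (hR : IsRenewalSwitching P g ε τ) {f : Fin d → ℝ → ℝ} (hf : ∀ i, Measurable (f i))
    (hint : ∀ i, ∀ t : ℝ, 0 ≤ t → IntervalIntegrable (f i) volume 0 t) (i : Fin d)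
    (hi : P {ω | ε 0 ω = i} ≠ 0)
    (h : ∀ s t : ℝ≥0, s ≤ t → ∫ p, dagger ε τ f p.2 p.1
      ∂((P.restrict (stayEvent ε τ i s)).prod (volume.restrict (Set.Ioc (s : ℝ) t))) = 0) :
    ∀ᵐ u ∂(volume.restrict (Set.Ici (0 : ℝ))), f i u = 0 := by
  have hs := hR.switching
  have h1 : ∀ s t : ℝ≥0, s ≤ t → ∀ᵐ u, u ∈ Set.Ioc (s : ℝ) t →
      ∫ ω in stayEvent ε τ i s, dagger ε τ f u ω ∂P = 0 := by
    intro s t hst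
    have hI := hR.integrable_dagger_restrict hf hint (stayEvent ε τ i s) s t
    refine ae_eq_zero_of_forall_setIntegral_Ioc_eq_zero (NNReal.coe_le_coe.2 hst)
      hI.integral_prod_right fun t' ht' => ?_
    have hI' := hR.integrable_dagger_restrict hf hint (stayEvent ε τ i s) s
      ⟨t', s.coe_nonneg.trans ht'.1⟩
    rw [← h s ⟨t', s.coe_nonneg.trans ht'.1⟩ ht'.1, integral_prod_symm _ hI']
    rfl
  -- The null set in `h1` depends on s and t; rational s and integer t leave a single one.
  have h2 : ∀ᵐ u : ℝ, ∀ (q : ℚ) (k : ℕ), u ∈ Set.Ioc ((Real.toNNReal q : ℝ≥0) : ℝ) (k : ℝ≥0) →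
      ∫ ω in stayEvent ε τ i (Real.toNNReal q), dagger ε τ f u ω ∂P = 0 := by
    rw [ae_all_iff]
    intro q
    rw [ae_all_iff]
    intro k
    by_cases hqk : Real.toNNReal q ≤ (k : ℝ≥0)
    · exact h1 _ _ hqk
    · refine Eventually.of_forall fun u hu => absurd (hu.1.trans_le hu.2) ?_
      rw [NNReal.coe_lt_coe]
      exact fun h => hqk h.le
  have h3 : ∀ᵐ u : ℝ, ∀ k : ℕ, u ∈ Set.Ioc (0 : ℝ) (k : ℝ≥0) →
      Integrable (fun ω => dagger ε τ f u ω) P := by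
    rw [ae_all_iff]
    intro k
    rw [← ae_restrict_iff' measurableSet_Ioc]
    exact (hR.integrable_dagger hf hint k).prod_left_ae
  -- The events of no switching up to q_n ↑ u decrease to {τ_1 ≥ u}, not {τ_1 > u}. The two differ
  -- by a null set unless u is one of the countably many atoms of τ_1.
  have h4 : ∀ᵐ u : ℝ, P {ω | (τ 1 ω : ℝ) = u} = 0 := by
    have hc := Measure.countable_meas_level_set_pos (μ := P)
      ((hs.measurable_time 1).coe_nnreal_real)
    filter_upwards [hc.ae_notMem volume] with u hu
    by_contra hne
    exact hu (pos_iff_ne_zero.2 hne)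
  have h5 : ∀ᵐ u : ℝ, u ≠ 0 := by simp [ae_iff]
  rw [ae_restrict_iff' measurableSet_Ici]
  filter_upwards [h2, h3, h4, h5] with u g2 g3 g4 g5 hu
  have hu0 : 0 < u := lt_of_le_of_ne hu (Ne.symm g5)
  obtain ⟨w, hw⟩ : ∃ w : ℝ≥0, (w : ℝ) = u := ⟨Real.toNNReal u, Real.coe_toNNReal u hu0.le⟩
  obtain ⟨k, hk⟩ := exists_nat_ge u
  obtain ⟨q, hqm, hq, hqt⟩ := Real.exists_seq_rat_strictMono_tendsto u
  set A : ℕ → Set Ω := fun n => stayEvent ε τ i (Real.toNNReal (q n)) with hA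
  have hAanti : Antitone A := by
    intro n m hnm ω hω
    refine ⟨hω.1, lt_of_le_of_lt (Real.toNNReal_le_toNNReal ?_) hω.2⟩
    exact Rat.cast_le.2 (hqm.monotone hnm)
  have hI := g3 k ⟨hu0, by simpa using hk⟩
  have htend := tendsto_setIntegral_of_antitone (μ := P) (f := fun ω => dagger ε τ f u ω)
    (s := A) (fun n => hR.measurableSet_stayEvent i _) hAanti ⟨0, hI.integrableOn⟩
  have hzero : ∀ n, ∫ ω in A n, dagger ε τ f u ω ∂P = 0 := by
    intro n
    refine g2 (q n) k ⟨?_, by simpa using hk⟩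
    rw [Real.coe_toNNReal', max_lt_iff]
    exact ⟨hq n, hu0⟩
  have hlim : ∫ ω in ⋂ n, A n, dagger ε τ f u ω ∂P = 0 := by
    simp_rw [hzero] at htend
    exact tendsto_nhds_unique htend tendsto_const_nhds
  have hAe : (⋂ n, A n) =ᵐ[P] stayEvent ε τ i w := by
    have hnull : ∀ᵐ ω ∂P, (τ 1 ω : ℝ) ≠ u := by
      rw [ae_iff]
      simpa using g4
    filter_upwards [hnull] with ω hω
    refine propext ?_
    change ω ∈ ⋂ n, A n ↔ ω ∈ stayEvent ε τ i w
    rw [Set.mem_iInter]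
    constructor
    · intro hall
      refine ⟨(hall 0).1, ?_⟩
      rw [← NNReal.coe_lt_coe, hw]
      refine lt_of_le_of_ne (le_of_tendsto hqt (Eventually.of_forall fun n => ?_)) hω.symm
      exact (Real.le_coe_toNNReal _).trans (NNReal.coe_le_coe.2 (hall n).2.le)
    · intro hω' n
      refine ⟨hω'.1, lt_of_le_of_lt ?_ hω'.2⟩
      exact Real.toNNReal_le_iff_le_coe.2 ((hq n).le.trans_eq hw.symm)
  rw [setIntegral_congr_set hAe] at hlim
  have hval : ∫ ω in stayEvent ε τ i w, dagger ε τ f u ω ∂P =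
      ∫ _ in stayEvent ε τ i w, f i u ∂P := by
    refine setIntegral_congr_fun (hR.measurableSet_stayEvent i _) fun ω hω => ?_
    have hu1 : u < τ 1 ω := hw ▸ NNReal.coe_lt_coe.2 hω.2
    rw [hs.dagger_eq (n := 0) f, hs.time_zero, hω.1]
    · simp
    · rw [hs.time_zero]
      exact ⟨hu0.le, hu1⟩
  rw [hval, setIntegral_const, smul_eq_mul] at hlim
  refine (mul_eq_zero.1 hlim).resolve_left ?_
  rw [measureReal_def, ← ne_eq, ENNReal.toReal_ne_zero]
  exact ⟨hR.measure_stayEvent_ne_zero hi _, measure_ne_top _ _⟩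

/-- Along a path f† is assembled from countably many translates of the f_i, and translation
preserves Lebesgue null sets. -/
theorem integral_dagger_eq_zero [IsProbabilityMeasure P]
    (hR : IsRenewalSwitching P g ε τ) {f : Fin d → ℝ → ℝ} (hf : ∀ i, Measurable (f i))
    (hint : ∀ i, ∀ t : ℝ, 0 ≤ t → IntervalIntegrable (f i) volume 0 t)
    (h : ∀ i, ∀ᵐ u ∂(volume.restrict (Set.Ici (0 : ℝ))), f i u = 0) (A : Set Ω) (s t : ℝ≥0) :
    ∫ p, dagger ε τ f p.2 p.1 ∂((P.restrict A).prod (volume.restrict (Set.Ioc (s : ℝ) t))) = 0 := by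
  rw [integral_prod _ (hR.integrable_dagger_restrict hf hint A s t)]
  refine integral_eq_zero_of_ae (Eventually.of_forall fun ω => ?_)
  refine integral_eq_zero_of_ae ?_
  have h1 : ∀ᵐ u : ℝ, ∀ n, u - τ n ω ∈ Set.Ici (0 : ℝ) → f (ε (τ n ω) ω) (u - τ n ω) = 0 := by
    rw [ae_all_iff]
    intro n
    have h2 := h (ε (τ n ω) ω)
    rw [ae_restrict_iff' measurableSet_Ici] at h2
    exact (measurePreserving_sub_right volume (τ n ω : ℝ)).quasiMeasurePreserving.ae h2
  filter_upwards [ae_restrict_of_ae h1, ae_restrict_mem measurableSet_Ioc] with u hu hmem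
  obtain ⟨n, hn⟩ := hR.switching.exists_interval_real ω (s.coe_nonneg.trans hmem.1.le)
  rw [hR.switching.dagger_eq f hn]
  exact hu n (sub_nonneg.2 hn.1)

end IsRenewalSwitching

/-! ### Elementary stochastic integrals -/

namespace IsBrownianRelTo

variable {Ω : Type*} {mΩ : MeasurableSpace Ω} {P : Measure Ω} {F : Filtration ℝ≥0 mΩ}
  {B : ℝ≥0 → Ω → ℝ}

theorem measurable_increment (hB : IsBrownianRelTo P F B) {a b c : ℝ≥0} (hac : a ≤ c) (hbc : b ≤ c) :
    Measurable[F c] fun ω => B b ω - B a ω :=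
  Measurable.sub (m := F c) ((hB.adapted b).mono (F.mono hbc) le_rfl)
    ((hB.adapted a).mono (F.mono hac) le_rfl)

theorem memLp_increment (hB : IsBrownianRelTo P F B) (a b : ℝ≥0) :
    MemLp (fun ω => B b ω - B a ω) 2 P := by
  have h := hB.isBrownian.toIsPreBrownianReal.hasLaw_sub b a
  have h2 : MemLp id 2 (P.map (B b - B a)) := by
    rw [h.map_eq]
    exact memLp_id_gaussianReal 2
  exact (memLp_map_measure_iff h2.aestronglyMeasurable h.aemeasurable).1 h2

theorem integral_increment (hB : IsBrownianRelTo P F B) (a b : ℝ≥0) :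
    ∫ ω, (B b ω - B a ω) ∂P = 0 := by
  have h := hB.isBrownian.toIsPreBrownianReal.hasLaw_sub b a
  have := h.integral_eq
  rw [integral_id_gaussianReal] at this
  exact this

theorem integral_increment_sq [IsProbabilityMeasure P] (hB : IsBrownianRelTo P F B) {a b : ℝ≥0}
    (hab : a ≤ b) : ∫ ω, (B b ω - B a ω) ^ 2 ∂P = b - a := by
  have h := hB.isBrownian.toIsPreBrownianReal.hasLaw_sub b a
  have h1 := h.variance_eq
  have h0 : ((nndist b.1 a.1 : ℝ≥0) : ℝ) = b - a := by
    rw [coe_nndist]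
    exact abs_of_nonneg (sub_nonneg.2 (NNReal.coe_le_coe.2 hab))
  have h4 : Var[fun ω => B b ω - B a ω; P] = b - a := by
    rw [← h0, ← variance_id_gaussianReal (μ := 0), ← h1]
    rfl
  rw [variance_eq_sub (hB.memLp_increment a b), hB.integral_increment] at h4
  simpa using h4

theorem indepFun_increment (hB : IsBrownianRelTo P F B) {a b : ℝ≥0} (hab : a ≤ b) {ζ : Ω → ℝ}
    (hζ : Measurable[F a] ζ) : IndepFun ζ (fun ω => B b ω - B a ω) P := by
  rw [IndepFun_iff_Indep]
  exact indep_of_indep_of_le_left (hB.indep_increment a b hab).symm hζ.comap_le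

theorem integral_mul_increment (hB : IsBrownianRelTo P F B) {a b : ℝ≥0} (hab : a ≤ b) {ζ : Ω → ℝ}
    (hζ : Measurable[F a] ζ) : ∫ ω, ζ ω * (B b ω - B a ω) ∂P = 0 := by
  have h := (hB.indepFun_increment hab hζ).integral_fun_mul_eq_mul_integral
    (hζ.mono (F.le a) le_rfl).aestronglyMeasurable
    (hB.memLp_increment a b).aestronglyMeasurable
  rw [h, hB.integral_increment, mul_zero]

theorem integral_mul_increment_sq [IsProbabilityMeasure P] (hB : IsBrownianRelTo P F B)
    {a b : ℝ≥0} (hab : a ≤ b) {ζ : Ω → ℝ} (hζ : Measurable[F a] ζ) :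
    ∫ ω, ζ ω * (B b ω - B a ω) ^ 2 ∂P = (∫ ω, ζ ω ∂P) * (b - a) := by
  have h1 : IndepFun ζ (fun ω => (B b ω - B a ω) ^ 2) P :=
    (hB.indepFun_increment hab hζ).comp measurable_id (measurable_id.pow_const 2)
  have h := h1.integral_fun_mul_eq_mul_integral
    (hζ.mono (F.le a) le_rfl).aestronglyMeasurable
    ((hB.memLp_increment a b).aestronglyMeasurable.pow 2)
  rw [h, hB.integral_increment_sq hab]

theorem memLp_mul_increment (hB : IsBrownianRelTo P F B) (a b : ℝ≥0) {ξ : Ω → ℝ}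
    (hξ : Measurable ξ) {C : ℝ} (hC : ∀ ω, |ξ ω| ≤ C) :
    MemLp (fun ω => ξ ω * (B b ω - B a ω)) 2 P :=
  (hB.memLp_increment a b).of_le_mul (c := C)
    (hξ.aestronglyMeasurable.mul (hB.memLp_increment a b).aestronglyMeasurable)
    (Eventually.of_forall fun ω => by
      rw [norm_mul]
      exact mul_le_mul_of_nonneg_right (hC ω) (norm_nonneg _))

/-- Only the squared increment over the overlap of the two intervals survives; every other product
ends in an increment independent of the factors before it. -/
theorem integral_mul_increment_mul_increment_of_le [IsProbabilityMeasure P]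
    (hB : IsBrownianRelTo P F B)
    {a b c e : ℝ≥0} (hce : c ≤ e) (hac : a ≤ c) {ξ η : Ω → ℝ}
    (hξ : Measurable[F a] ξ) (hη : Measurable[F c] η) {C C' : ℝ} (hC : ∀ ω, |ξ ω| ≤ C)
    (hC' : ∀ ω, |η ω| ≤ C') :
    ∫ ω, (ξ ω * (B b ω - B a ω)) * (η ω * (B e ω - B c ω)) ∂P =
      (∫ ω, ξ ω * η ω ∂P) * volume.real (Set.Ioc (a : ℝ) b ∩ Set.Ioc (c : ℝ) e) := by
  have hξc : Measurable[F c] ξ := hξ.mono (F.mono hac) le_rfl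
  have hac' : (a : ℝ) ≤ c := hac
  have hce' : (c : ℝ) ≤ e := hce
  rw [Set.Ioc_inter_Ioc, Real.volume_real_Ioc, sup_eq_right.2 hac']
  -- If b ≤ c there is no overlap, and all factors but the last increment are known at time c.
  rcases le_total b c with hbc | hcb
  · have hbc' : (b : ℝ) ≤ c := hbc
    have h1 : max (min (b : ℝ) e - c) 0 = 0 := max_eq_right (by
      linarith [min_le_left (b : ℝ) e])
    rw [h1, mul_zero, ← hB.integral_mul_increment hce
      (ζ := fun ω => ξ ω * (B b ω - B a ω) * η ω)]
    · exact integral_congr_ae (Eventually.of_forall fun ω => by ring)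
    · exact Measurable.mul (m := F c) (Measurable.mul (m := F c) hξc
        (hB.measurable_increment hac hbc)) hη
  · set m := min b e with hm
    set M := max b e with hM
    have hcm : c ≤ m := le_min hcb hce
    have hmM : m ≤ M := min_le_max
    have hcm' : (c : ℝ) ≤ m := hcm
    have h1 : max (min (b : ℝ) e - c) 0 = m - c := by
      rw [hm, NNReal.coe_min, max_eq_left]
      rw [← NNReal.coe_min]
      linarith
    rw [h1]
    have hprod : ∀ ω, (B b ω - B c ω) * (B e ω - B c ω) =
        (B m ω - B c ω) ^ 2 + (B m ω - B c ω) * (B M ω - B m ω) := by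
      intro ω
      rcases le_total b e with h | h
      · rw [hm, hM, min_eq_left h, max_eq_right h]; ring
      · rw [hm, hM, min_eq_right h, max_eq_left h]; ring
    -- The bracketed factors are known at times c, c and m respectively, so the first and third
    -- terms have mean zero and the second produces the length m - c of the overlap.
    have hsplit : ∀ ω, (ξ ω * (B b ω - B a ω)) * (η ω * (B e ω - B c ω)) =
        (ξ ω * (B c ω - B a ω) * η ω) * (B e ω - B c ω) +
          ((ξ ω * η ω) * (B m ω - B c ω) ^ 2 +
            (ξ ω * η ω * (B m ω - B c ω)) * (B M ω - B m ω)) := by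
      intro ω
      linear_combination (ξ ω * η ω) * hprod ω
    have hξ' : Measurable ξ := hξ.mono (F.le a) le_rfl
    have hη' : Measurable η := hη.mono (F.le c) le_rfl
    have hbd : ∀ ω, |ξ ω * η ω| ≤ C * C' := fun ω => by
      rw [abs_mul]
      exact mul_le_mul (hC ω) (hC' ω) (abs_nonneg _) ((abs_nonneg _).trans (hC ω))
    have i1 : Integrable (fun ω => (ξ ω * (B c ω - B a ω) * η ω) * (B e ω - B c ω)) P := by
      refine ((hB.memLp_mul_increment a c hξ' hC).integrable_mul
        (hB.memLp_mul_increment c e hη' hC')).congr (Eventually.of_forall fun ω => ?_)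
      simp only [Pi.mul_apply]
      ring
    have i2 : Integrable (fun ω => (ξ ω * η ω) * (B m ω - B c ω) ^ 2) P := by
      refine ((hB.memLp_mul_increment c m (hξ'.mul hη') hbd).integrable_mul
        (hB.memLp_increment c m)).congr (Eventually.of_forall fun ω => ?_)
      simp only [Pi.mul_apply]
      ring
    have i3 : Integrable (fun ω => (ξ ω * η ω * (B m ω - B c ω)) * (B M ω - B m ω)) P :=
      (hB.memLp_mul_increment c m (hξ'.mul hη') hbd).integrable_mul (hB.memLp_increment m M)
    simp_rw [hsplit]
    have i23 : Integrable (fun ω => (ξ ω * η ω) * (B m ω - B c ω) ^ 2 +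
        (ξ ω * η ω * (B m ω - B c ω)) * (B M ω - B m ω)) P := i2.add i3
    rw [integral_add i1 i23, integral_add i2 i3, hB.integral_mul_increment hce,
      hB.integral_mul_increment_sq hcm, hB.integral_mul_increment hmM, add_zero, zero_add]
    · exact Measurable.mul (m := F m) (Measurable.mul (m := F m)
        (hξc.mono (F.mono hcm) le_rfl) (hη.mono (F.mono hcm) le_rfl))
        (hB.measurable_increment hcm le_rfl)
    · exact Measurable.mul (m := F c) hξc hη
    · exact Measurable.mul (m := F c) (Measurable.mul (m := F c) hξc
        (hB.measurable_increment hac le_rfl)) hη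

theorem integral_mul_increment_mul_increment [IsProbabilityMeasure P] (hB : IsBrownianRelTo P F B)
    {a b c e : ℝ≥0} (hab : a ≤ b) (hce : c ≤ e) {ξ η : Ω → ℝ}
    (hξ : Measurable[F a] ξ) (hη : Measurable[F c] η) {C C' : ℝ} (hC : ∀ ω, |ξ ω| ≤ C)
    (hC' : ∀ ω, |η ω| ≤ C') :
    ∫ ω, (ξ ω * (B b ω - B a ω)) * (η ω * (B e ω - B c ω)) ∂P =
      (∫ ω, ξ ω * η ω ∂P) * volume.real (Set.Ioc (a : ℝ) b ∩ Set.Ioc (c : ℝ) e) := by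
  rcases le_total a c with h | h
  · exact hB.integral_mul_increment_mul_increment_of_le hce h hξ hη hC hC'
  · rw [Set.inter_comm]
    simp_rw [mul_comm (ξ _ * _), mul_comm (ξ _)]
    simpa only [mul_comm (ξ _)] using
      hB.integral_mul_increment_mul_increment_of_le hab h hη hξ hC' hC

end IsBrownianRelTo

/-- `Z` is the elementary stochastic integral of the finite sum `H` of bounded adapted
rectangles. -/
inductive IsElementaryIntegral {Ω : Type*} {mΩ : MeasurableSpace Ω} (F : Filtration ℝ≥0 mΩ)
    (B : ℝ≥0 → Ω → ℝ) : (Ω → ℝ) → (Ω × ℝ → ℝ) → Prop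
  | zero : IsElementaryIntegral F B (fun _ => 0) (fun _ => 0)
  | rectangle (a b : ℝ≥0) (ξ : Ω → ℝ) (C : ℝ) (hab : a ≤ b) (hξ : Measurable[F a] ξ)
      (hC : ∀ ω, |ξ ω| ≤ C) :
      IsElementaryIntegral F B (fun ω => ξ ω * (B b ω - B a ω))
        (fun p => ξ p.1 * (Set.Ioc (a : ℝ) b).indicator (fun _ => 1) p.2)
  | add {Z Z' : Ω → ℝ} {H H' : Ω × ℝ → ℝ} (h : IsElementaryIntegral F B Z H)
      (h' : IsElementaryIntegral F B Z' H') :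
      IsElementaryIntegral F B (fun ω => Z ω + Z' ω) (fun p => H p + H' p)

namespace IsElementaryIntegral

variable {Ω : Type*} {mΩ : MeasurableSpace Ω} {P : Measure Ω} {F : Filtration ℝ≥0 mΩ}
  {B : ℝ≥0 → Ω → ℝ} {Z Z' : Ω → ℝ} {H H' : Ω × ℝ → ℝ}

theorem congr (h : IsElementaryIntegral F B Z H) (hZ : ∀ ω, Z' ω = Z ω) (hH : ∀ p, H' p = H p) :
    IsElementaryIntegral F B Z' H' := by
  rw [funext hZ, funext hH]
  exact h

theorem neg (h : IsElementaryIntegral F B Z H) :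
    IsElementaryIntegral F B (fun ω => -Z ω) (fun p => -H p) := by
  induction h with
  | zero => exact zero.congr (by simp) (by simp)
  | rectangle a b ξ C hab hξ hC =>
    exact (rectangle a b (fun ω => -ξ ω) C hab hξ.neg (by simpa using hC)).congr
      (fun ω => by ring) (fun p => by ring)
  | add h h' ih ih' => exact (ih.add ih').congr (fun ω => by ring) (fun p => by ring)

theorem sub (h : IsElementaryIntegral F B Z H) (h' : IsElementaryIntegral F B Z' H') :
    IsElementaryIntegral F B (fun ω => Z ω - Z' ω) (fun p => H p - H' p) :=
  (h.add h'.neg).congr (fun ω => by ring) (fun p => by ring)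

theorem sum {ι : Type*} (s : Finset ι) {Z : ι → Ω → ℝ} {H : ι → Ω × ℝ → ℝ}
    (h : ∀ k ∈ s, IsElementaryIntegral F B (Z k) (H k)) :
    IsElementaryIntegral F B (fun ω => ∑ k ∈ s, Z k ω) (fun p => ∑ k ∈ s, H k p) := by
  classical
  induction s using Finset.induction_on with
  | empty => exact zero.congr (by simp) (by simp)
  | insert k s hk ih =>
    exact ((h k (Finset.mem_insert_self k s)).add
      (ih fun j hj => h j (Finset.mem_insert_of_mem hj))).congr
      (fun ω => Finset.sum_insert hk) (fun p => Finset.sum_insert hk)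

theorem _root_.MeasureTheory.MemLp.integral_add_mul {α : Type*} {m : MeasurableSpace α}
    {μ : Measure α} {f g k : α → ℝ} (hf : MemLp f 2 μ) (hg : MemLp g 2 μ) (hk : MemLp k 2 μ) :
    ∫ x, (f x + g x) * k x ∂μ = ∫ x, f x * k x ∂μ + ∫ x, g x * k x ∂μ := by
  simp_rw [add_mul]
  exact integral_add (hf.integrable_mul hk) (hg.integrable_mul hk)

theorem memLp [IsProbabilityMeasure P] (hB : IsBrownianRelTo P F B)
    (h : IsElementaryIntegral F B Z H) : MemLp Z 2 P := by
  induction h with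
  | zero => exact MemLp.zero'
  | rectangle a b ξ C hab hξ hC =>
    exact hB.memLp_mul_increment a b (hξ.mono (F.le a) le_rfl) hC
  | add h h' ih ih' => exact ih.add ih'

theorem memLp_integrand [IsProbabilityMeasure P] (h : IsElementaryIntegral F B Z H) :
    MemLp H 2 (P.prod volume) := by
  induction h with
  | zero => exact MemLp.zero'
  | rectangle a b ξ C hab hξ hC =>
    have hξ' : Measurable ξ := hξ.mono (F.le a) le_rfl
    have h1 : MemLp ((Set.univ ×ˢ Set.Ioc (a : ℝ) b).indicator fun _ : Ω × ℝ => (1 : ℝ)) 2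
        (P.prod volume) := by
      refine memLp_indicator_const 2 (MeasurableSet.univ.prod measurableSet_Ioc) 1 (Or.inr ?_)
      simp [Measure.prod_prod]
    refine h1.of_le_mul (c := C) ((hξ'.comp measurable_fst).mul ((measurable_const.indicator
        measurableSet_Ioc).comp measurable_snd)).aestronglyMeasurable
      (Eventually.of_forall fun p => ?_)
    have h2 : (Set.univ ×ˢ Set.Ioc (a : ℝ) b).indicator (fun _ : Ω × ℝ => (1 : ℝ)) p =
        (Set.Ioc (a : ℝ) b).indicator (fun _ => 1) p.2 := by
      simp [Set.indicator]
    rw [h2, norm_mul]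
    exact mul_le_mul_of_nonneg_right (hC p.1) (norm_nonneg _)
  | add h h' ih ih' => exact ih.add ih'

theorem integral_eq_zero [IsProbabilityMeasure P] (hB : IsBrownianRelTo P F B)
    (h : IsElementaryIntegral F B Z H) : ∫ ω, Z ω ∂P = 0 := by
  induction h with
  | zero => simp
  | rectangle a b ξ C hab hξ hC => exact hB.integral_mul_increment hab hξ
  | add h h' ih ih' =>
    rw [integral_add ((h.memLp hB).integrable one_le_two) ((h'.memLp hB).integrable one_le_two),
      ih, ih', add_zero]

/-- The Itô isometry, in bilinear form. -/
theorem integral_mul_eq [IsProbabilityMeasure P] (hB : IsBrownianRelTo P F B)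
    (h : IsElementaryIntegral F B Z H) (h' : IsElementaryIntegral F B Z' H') :
    ∫ ω, Z ω * Z' ω ∂P = ∫ p, H p * H' p ∂(P.prod volume) := by
  -- Both sides are bilinear, so induction on each argument reduces the identity to two rectangles.
  induction h with
  | zero => simp
  | @add Z₁ Z₂ H₁ H₂ h₁ h₂ ih₁ ih₂ =>
    rw [(h₁.memLp hB).integral_add_mul (h₂.memLp hB) (h'.memLp hB),
      h₁.memLp_integrand.integral_add_mul h₂.memLp_integrand h'.memLp_integrand, ih₁, ih₂]
  | rectangle a b ξ C hab hξ hC =>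
    induction h' with
    | zero => simp
    | @add Z₁ Z₂ H₁ H₂ h₁ h₂ ih₁ ih₂ =>
      have h := rectangle (F := F) (B := B) a b ξ C hab hξ hC
      simp_rw [mul_comm (ξ _ * _)] at ih₁ ih₂ ⊢
      rw [(h₁.memLp hB).integral_add_mul (h₂.memLp hB) (h.memLp hB),
        h₁.memLp_integrand.integral_add_mul h₂.memLp_integrand h.memLp_integrand, ih₁, ih₂]
    | rectangle c e η C' hce hη hC' =>
      rw [hB.integral_mul_increment_mul_increment hab hce hξ hη hC hC']
      have h1 : ∀ p : Ω × ℝ, ξ p.1 * (Set.Ioc (a : ℝ) b).indicator (fun _ => (1 : ℝ)) p.2 *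
          (η p.1 * (Set.Ioc (c : ℝ) e).indicator (fun _ => 1) p.2) =
          (ξ p.1 * η p.1) * (Set.Ioc (a : ℝ) b ∩ Set.Ioc (c : ℝ) e).indicator
            (fun _ => (1 : ℝ)) p.2 := by
        intro p
        have h2 := Set.inter_indicator_mul (s := Set.Ioc (a : ℝ) b) (t := Set.Ioc (c : ℝ) e)
          (fun _ => (1 : ℝ)) (fun _ => 1) p.2
        simp only [mul_one] at h2
        rw [h2]
        ring
      simp_rw [h1]
      rw [integral_prod_mul (fun ω => ξ ω * η ω) (Set.indicator _ fun _ => (1 : ℝ)),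
        integral_indicator_const _ (measurableSet_Ioc.inter measurableSet_Ioc), smul_eq_mul,
        mul_one]

end IsElementaryIntegral

/-! ### Simple processes: clipping and freezing -/

namespace SimpleItoProcess

variable {Ω : Type*} {mΩ : MeasurableSpace Ω} {P : Measure Ω} {F : Filtration ℝ≥0 mΩ}
  {B : ℝ≥0 → Ω → ℝ}

/-- Both sides are the increment of x over (p, q] ∩ (r, r']; the outer `max` turns an empty
intersection into a zero increment rather than a reversed one. -/
theorem clip_increment (x : ℝ≥0 → ℝ) {p q r r' : ℝ≥0} (hpq : p ≤ q) (hr : r ≤ r') :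
    (x (min q r') - x (min p r')) - (x (min q r) - x (min p r)) =
      x (max (max p r) (min q r')) - x (max p r) := by
  rcases le_total r' p with h1 | h1
  · have h2 : r ≤ p := hr.trans h1
    rw [min_eq_right (h1.trans hpq), min_eq_right h1, min_eq_right (h2.trans hpq),
      min_eq_right h2, max_eq_left h2, max_eq_left h1]
    ring
  · rcases le_total q r with h2 | h2
    · rw [min_eq_left (h2.trans hr), min_eq_left h1, min_eq_left h2,
        min_eq_left (hpq.trans h2), max_eq_right (hpq.trans h2), max_eq_left h2]
      ring
    · have h3 : max p r ≤ min q r' := max_le (le_min hpq h1) (le_min h2 hr)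
      rw [max_eq_right h3, min_eq_left h1, min_eq_right h2]
      rcases le_total p r with h4 | h4
      · rw [min_eq_left h4, max_eq_right h4]
        ring
      · rw [min_eq_right h4, max_eq_left h4]
        ring

/-- The increment over `(r, r']` of the elementary integral of a simple process, multiplied by a
random variable known at time `r`, is again an elementary integral. -/
theorem isElementaryIntegral (S : SimpleItoProcess F) (B : ℝ≥0 → Ω → ℝ) {r r' : ℝ≥0} (hr : r ≤ r')
    {J : Ω → ℝ} (hJ : Measurable[F r] J) {C : ℝ} (hC : ∀ ω, |J ω| ≤ C) :
    IsElementaryIntegral F B (fun ω => J ω * (S.integral B r' ω - S.integral B r ω))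
      (fun p => J p.1 * (Set.Ioc (r : ℝ) r').indicator (fun u => S.value u p.1) p.2) := by
  obtain ⟨D, hD⟩ := S.bounded_coef
  -- The left endpoint of each clipped interval is the maximum of r and the partition time, so both
  -- J and the coefficient are known there.
  have h := IsElementaryIntegral.sum (F := F) (B := B) (Finset.range S.size)
    (Z := fun k ω => (J ω * S.coef k ω) * (B (max (max (S.time k) r) (min (S.time (k + 1)) r')) ω -
      B (max (S.time k) r) ω))
    (H := fun k p => (J p.1 * S.coef k p.1) * (Set.Ioc ((max (S.time k) r : ℝ≥0) : ℝ)
      (max (max (S.time k) r) (min (S.time (k + 1)) r') : ℝ≥0)).indicator (fun _ => 1) p.2)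
    (fun k _ => IsElementaryIntegral.rectangle _ _ _ (C * D) (le_max_left _ _)
      (Measurable.mul (m := F _) (hJ.mono (F.mono (le_max_right _ _)) le_rfl)
        ((S.measurable_coef k).mono (F.mono (le_max_left _ _)) le_rfl))
      (fun ω => by
        rw [abs_mul]
        exact mul_le_mul (hC ω) (hD k ω) (abs_nonneg _) ((abs_nonneg _).trans (hC ω))))
  refine h.congr (fun ω => ?_) (fun p => ?_)
  · rw [SimpleItoProcess.integral, SimpleItoProcess.integral, ← Finset.sum_sub_distrib,
      Finset.mul_sum]
    refine Finset.sum_congr rfl fun k _ => ?_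
    have := clip_increment (fun v => B v ω) (S.monotone_time (Nat.le_succ k)) hr
    simp only [Nat.succ_eq_add_one] at this
    rw [← this]
    ring
  · have hiff : ∀ k, p.2 ∈ Set.Ioc ((max (S.time k) r : ℝ≥0) : ℝ)
        (max (max (S.time k) r) (min (S.time (k + 1)) r') : ℝ≥0) ↔
        p.2 ∈ Set.Ioc (r : ℝ) r' ∧ p.2 ∈ Set.Ioc (S.time k : ℝ) (S.time (k + 1)) := by
      intro k
      simp only [Set.mem_Ioc, NNReal.coe_max, NNReal.coe_min, max_lt_iff, le_max_iff, le_min_iff]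
      constructor
      · rintro ⟨⟨h1, h2⟩, (h3 | h3) | h3⟩
        · exact absurd h1 (not_lt.2 h3)
        · exact absurd h2 (not_lt.2 h3)
        · exact ⟨⟨h2, h3.2⟩, h1, h3.1⟩
      · rintro ⟨⟨h1, h2⟩, h3, h4⟩
        exact ⟨⟨h3, h1⟩, Or.inr ⟨h4, h2⟩⟩
    by_cases hp : p.2 ∈ Set.Ioc (r : ℝ) r'
    · rw [Set.indicator_of_mem hp, SimpleItoProcess.value, Finset.mul_sum]
      refine Finset.sum_congr rfl fun k _ => ?_
      by_cases hk : p.2 ∈ Set.Ioc (S.time k : ℝ) (S.time (k + 1))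
      · rw [Set.indicator_of_mem hk, Set.indicator_of_mem ((hiff k).2 ⟨hp, hk⟩)]
        ring
      · rw [Set.indicator_of_notMem hk,
          Set.indicator_of_notMem (fun h => hk ((hiff k).1 h).2)]
        ring
    · rw [Set.indicator_of_notMem hp, mul_zero]
      symm
      refine Finset.sum_eq_zero fun k _ => ?_
      rw [Set.indicator_of_notMem (fun h => hp ((hiff k).1 h).1), mul_zero]

theorem integral_zero (S : SimpleItoProcess F) (B : ℝ≥0 → Ω → ℝ) (ω : Ω) :
    S.integral B 0 ω = 0 :=
  Finset.sum_eq_zero fun k _ => by simp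

theorem memLp_integral [IsProbabilityMeasure P] (hB : IsBrownianRelTo P F B)
    (S : SimpleItoProcess F) (t : ℝ≥0) : MemLp (S.integral B t) 2 P := by
  have h := (S.isElementaryIntegral B (zero_le (a := t)) (J := fun _ => 1)
    measurable_const (C := 1) (by simp)).memLp hB
  simpa [S.integral_zero] using h

theorem measurable_value (S : SimpleItoProcess F) :
    Measurable fun p : Ω × ℝ => S.value p.2 p.1 := by
  refine Finset.measurable_fun_sum _ fun k _ => ?_
  have h1 : Measurable fun p : Ω × ℝ => S.coef k p.1 :=
    ((S.measurable_coef k).mono (F.le _) le_rfl).comp measurable_fst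
  exact h1.indicator (measurable_snd measurableSet_Ioc)

theorem exists_bound_value (S : SimpleItoProcess F) : ∃ C : ℝ, ∀ u ω, |S.value u ω| ≤ C := by
  obtain ⟨D, hD⟩ := S.bounded_coef
  refine ⟨∑ _k ∈ Finset.range S.size, D, fun u ω => (Finset.abs_sum_le_sum_abs _ _).trans
    (Finset.sum_le_sum fun k _ => ?_)⟩
  by_cases hu : u ∈ Set.Ioc (S.time k : ℝ) (S.time (k + 1))
  · rw [Set.indicator_of_mem hu]
    exact hD k ω
  · rw [Set.indicator_of_notMem hu, abs_zero]
    exact (abs_nonneg _).trans (hD k ω)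

/-- The deterministic simple process obtained by fixing a path. -/
def freeze (S : SimpleItoProcess F) (ω₀ : Ω) : SimpleItoProcess F where
  size := S.size
  time := S.time
  coef k _ := S.coef k ω₀
  monotone_time := S.monotone_time
  measurable_coef _ := measurable_const
  bounded_coef := S.bounded_coef.imp fun _ h k _ => h k ω₀

theorem freeze_value (S : SimpleItoProcess F) (ω₀ ω : Ω) (u : ℝ) :
    (S.freeze ω₀).value u ω = S.value u ω₀ :=
  rfl

/-- The elementary integral of a deterministic process has mean zero on events which are
independent of the Brownian motion. -/
theorem setIntegral_freeze [IsProbabilityMeasure P] (hB : IsBrownianRelTo P F B)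
    (S : SimpleItoProcess F) (ω₀ : Ω) (t : ℝ≥0) {A : Set Ω} (hA : MeasurableSet A)
    (hind : ∀ a b : ℝ≥0, IndepFun (A.indicator fun _ => (1 : ℝ)) (fun ω => B b ω - B a ω) P) :
    ∫ ω in A, (S.freeze ω₀).integral B t ω ∂P = 0 := by
  have h0 : ∀ a b : ℝ≥0, ∫ ω in A, (B b ω - B a ω) ∂P = 0 := by
    intro a b
    have h := (hind a b).integral_fun_mul_eq_mul_integral
      (measurable_const.indicator hA).aestronglyMeasurable
      (hB.memLp_increment a b).aestronglyMeasurable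
    rw [hB.integral_increment, mul_zero] at h
    rw [← integral_indicator hA, ← h]
    refine integral_congr_ae (Eventually.of_forall fun ω => ?_)
    by_cases hω : ω ∈ A
    · simp [hω]
    · simp [hω]
  change ∫ ω in A, (∑ k ∈ Finset.range S.size, S.coef k ω₀ *
    (B (min (S.time (k + 1)) t) ω - B (min (S.time k) t) ω)) ∂P = 0
  rw [integral_finsetSum]
  · refine Finset.sum_eq_zero fun k _ => ?_
    rw [integral_const_mul, h0, mul_zero]
  · intro k _
    exact (((hB.memLp_increment _ _).integrable one_le_two).const_mul _).integrableOn

end SimpleItoProcess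

/-! ### The event of no switching as an event of the state process -/

namespace IsSwitchingProcess

variable {Ω : Type*} {mΩ : MeasurableSpace Ω} {P : Measure Ω} {d : ℕ} {ε : ℝ≥0 → Ω → Fin d}
  {τ : ℕ → Ω → ℝ≥0}

/-- The event of no switching up to time `s` is determined by the states up to time `s`. -/
theorem stayEvent_eq_iInter (hs : IsSwitchingProcess ε τ) (i : Fin d) (s : ℝ≥0) :
    stayEvent ε τ i s =
      {ω | ε 0 ω = i} ∩ ⋂ q : ℚ, {ω | ε (min (Real.toNNReal q) s) ω = i} := by
  ext ω
  simp only [stayEvent, Set.mem_inter_iff, Set.mem_ofPred_eq, Set.mem_iInter]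
  refine and_congr_right fun h0 => ⟨fun h q => ?_, fun h => ?_⟩
  · rw [hs.const_between 0 ω _ (by rw [hs.time_zero]; exact zero_le)
      ((min_le_right _ _).trans_lt h), hs.time_zero, h0]
  · by_contra hle
    rw [not_lt] at hle
    -- If τ_1 ≤ s, a rational between τ_1 and τ_2, cut off at s, is a time in [τ_1, τ_2), where the
    -- state is no longer i.
    obtain ⟨q, hq1, hq2⟩ := exists_rat_btwn (NNReal.coe_lt_coe.2 (hs.time_lt 1 ω))
    have h1 : τ 1 ω ≤ Real.toNNReal q := NNReal.le_toNNReal_of_coe_le hq1.le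
    have h2 : Real.toNNReal q < τ 2 ω := by
      rwa [Real.toNNReal_lt_iff_lt_coe ((NNReal.coe_nonneg _).trans hq1.le)]
    have h3 := hs.const_between 1 ω _ (le_min h1 hle) ((min_le_left _ _).trans_lt h2)
    rw [h q] at h3
    have h4 := hs.state_ne 0 ω
    rw [hs.time_zero, h0] at h4
    exact h4 h3.symm

/-- The σ-algebra is left free because two are needed: that of the filtration, for the martingale
property, and that generated by the paths of ε, for independence of B. -/
theorem measurableSet_stayEvent_of_le (hs : IsSwitchingProcess ε τ) {m : MeasurableSpace Ω}
    {s : ℝ≥0} (hε : ∀ t ≤ s, Measurable[m] (ε t)) (i : Fin d) :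
    MeasurableSet[m] (stayEvent ε τ i s) := by
  rw [hs.stayEvent_eq_iInter]
  exact MeasurableSet.inter (hε 0 zero_le (measurableSet_singleton i))
    (MeasurableSet.iInter fun q => hε _ (min_le_right _ _) (measurableSet_singleton i))

theorem indepFun_indicator_stayEvent (hs : IsSwitchingProcess ε τ) {B : ℝ≥0 → Ω → ℝ}
    (hBε : IndepFun (fun ω t => B t ω) (fun ω t => ε t ω) P) (i : Fin d) (s a b : ℝ≥0) :
    IndepFun ((stayEvent ε τ i s).indicator fun _ => (1 : ℝ)) (fun ω => B b ω - B a ω) P := by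
  have hA : MeasurableSet[MeasurableSpace.comap (fun ω t => ε t ω) inferInstance]
      (stayEvent ε τ i s) := by
    refine hs.measurableSet_stayEvent_of_le (m := MeasurableSpace.comap (fun ω t => ε t ω)
      inferInstance) (fun t _ => ?_) i
    exact (measurable_pi_apply t).comp (comap_measurable (fun ω t => ε t ω))
  rw [IndepFun_iff_Indep] at hBε ⊢
  refine indep_of_indep_of_le_left (indep_of_indep_of_le_right hBε.symm ?_) ?_
  · have h1 : Measurable[MeasurableSpace.comap (fun ω t => B t ω) inferInstance]
        (fun ω => B b ω - B a ω) := by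
      have h2 : Measurable fun x : ℝ≥0 → ℝ => x b - x a := by fun_prop
      exact h2.comp (comap_measurable (fun ω t => B t ω))
    exact h1.comap_le
  · have h1 : Measurable[MeasurableSpace.comap (fun ω t => ε t ω) inferInstance]
        ((stayEvent ε τ i s).indicator fun _ => (1 : ℝ)) :=
      Measurable.indicator measurable_const hA
    exact h1.comap_le

end IsSwitchingProcess

/-! ### Itô isometry stopped at the first switch -/

section Localisation

variable {Ω : Type*} {mΩ : MeasurableSpace Ω} {P : Measure Ω} {F : Filtration ℝ≥0 mΩ} {d : ℕ}
  {ε : ℝ≥0 → Ω → Fin d} {τ : ℕ → Ω → ℝ≥0} {B : ℝ≥0 → Ω → ℝ} {σ : Fin d → ℝ → ℝ}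

/-- Nonnegativity of the variance of Z restricted to A, followed by the isometry. -/
theorem IsElementaryIntegral.ofReal_sq_setIntegral_le [IsProbabilityMeasure P]
    (hB : IsBrownianRelTo P F B) {Z : Ω → ℝ} {H : Ω × ℝ → ℝ} (h : IsElementaryIntegral F B Z H)
    {A : Set Ω} (hA : MeasurableSet A) :
    ENNReal.ofReal ((∫ ω in A, Z ω ∂P) ^ 2) ≤
      ∫⁻ p, ENNReal.ofReal (H p ^ 2) ∂(P.prod volume) := by
  have hZ := h.memLp hB
  have hZA : MemLp (A.indicator Z) 2 P := hZ.indicator hA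
  have h1 : (∫ ω in A, Z ω ∂P) ^ 2 ≤ ∫ ω, Z ω ^ 2 ∂P := by
    have h2 := variance_nonneg (A.indicator Z) P
    rw [variance_eq_sub hZA, integral_indicator hA] at h2
    have h3 : ∫ ω, (A.indicator Z ^ 2) ω ∂P ≤ ∫ ω, Z ω ^ 2 ∂P := by
      refine integral_mono hZA.integrable_sq hZ.integrable_sq fun ω => ?_
      by_cases hω : ω ∈ A
      · simp [hω]
      · simpa [hω] using sq_nonneg (Z ω)
    linarith
  have h4 := h.integral_mul_eq hB h
  have h5 : ∫ ω, Z ω ^ 2 ∂P = ∫ p, H p ^ 2 ∂(P.prod volume) := by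
    simpa only [sq] using h4
  rw [← ofReal_integral_eq_lintegral_ofReal h.memLp_integrand.integrable_sq
    (Eventually.of_forall fun p => sq_nonneg (H p)), ← h5]
  exact ENNReal.ofReal_le_ofReal h1

/-- S is compared with σ† and G with σ_i, so S - G is controlled by these two errors only before
τ_1. Weighting the increment over each cell of a grid of mesh s/(K+1) by the indicator of no
switching up to the left endpoint changes nothing on the event, but cuts the integrand off at most
one mesh after τ_1. The isometry then costs twice each error before τ_1, by (x - y)² ≤ 2x² + 2y²,
and C² times the mesh after it. -/
theorem SimpleItoProcess.ofReal_sq_setIntegral_sub_le_of_grid [IsProbabilityMeasure P]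
    (hB : IsBrownianRelTo P F B) (hs : IsSwitchingProcess ε τ) (hε : ∀ t, Measurable[F t] (ε t))
    (hσ : ∀ i, Measurable (σ i)) (S G : SimpleItoProcess F) {C : ℝ}
    (hC : ∀ u ω, |S.value u ω - G.value u ω| ≤ C) (i : Fin d) (s : ℝ≥0) (K : ℕ) :
    ENNReal.ofReal ((∫ ω in stayEvent ε τ i s, (S.integral B s ω - G.integral B s ω) ∂P) ^ 2) ≤
      (2 * ∫⁻ ω, (∫⁻ u in Set.Ioc (0 : ℝ) s,
        ENNReal.ofReal ((S.value u ω - dagger ε τ σ u ω) ^ 2)) ∂P) +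
      (2 * ∫⁻ ω, (∫⁻ u in Set.Ioc (0 : ℝ) s,
        ENNReal.ofReal ((G.value u ω - σ i u) ^ 2)) ∂P) +
      ENNReal.ofReal (C ^ 2) * ENNReal.ofReal (s / (K + 1)) := by
  set r : ℕ → ℝ≥0 := fun j => s * j / (K + 1) with hr
  have hrm : Monotone r := fun j k hjk => by
    simp only [hr]
    gcongr
  have hr0 : r 0 = 0 := by simp [hr]
  have hrK : r (K + 1) = s := by
    have : ((K + 1 : ℕ) : ℝ≥0) = K + 1 := by push_cast; rfl
    simp only [hr, this]
    exact mul_div_cancel_right₀ s (by positivity)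
  have hrs : ∀ j, (r (j + 1) : ℝ) = r j + s / (K + 1) := by
    intro j
    simp only [hr]
    push_cast
    ring
  have hεm : ∀ t, Measurable (ε t) := fun t => (hε t).mono (F.le t) le_rfl
  have hA : MeasurableSet (stayEvent ε τ i s) :=
    hs.measurableSet_stayEvent_of_le (fun t _ => hεm t) i
  -- J j is known at time r j, so the weighted increments remain elementary integrals; on the event
  -- of no switching up to s every weight is 1.
  set J : ℕ → Ω → ℝ := fun j => (stayEvent ε τ i (r j)).indicator fun _ => 1 with hJ
  have hJm : ∀ j, Measurable[F (r j)] (J j) := fun j =>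
    Measurable.indicator measurable_const
      (hs.measurableSet_stayEvent_of_le (fun t ht => (hε t).mono (F.mono ht) le_rfl) i)
  have hJb : ∀ j ω, |J j ω| ≤ 1 := by
    intro j ω
    by_cases hω : ω ∈ stayEvent ε τ i (r j) <;> simp [hJ, hω]
  have hel := IsElementaryIntegral.sum (F := F) (B := B) (Finset.range (K + 1)) fun j _ =>
    (S.isElementaryIntegral B (hrm (Nat.le_succ j)) (hJm j) (hJb j)).sub
      (G.isElementaryIntegral B (hrm (Nat.le_succ j)) (hJm j) (hJb j))
  simp only [Nat.succ_eq_add_one] at hel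
  have hZ : ∫ ω in stayEvent ε τ i s, (S.integral B s ω - G.integral B s ω) ∂P =
      ∫ ω in stayEvent ε τ i s, (∑ j ∈ Finset.range (K + 1),
        (J j ω * (S.integral B (r (j + 1)) ω - S.integral B (r j) ω) -
          J j ω * (G.integral B (r (j + 1)) ω - G.integral B (r j) ω))) ∂P := by
    refine setIntegral_congr_fun hA fun ω hω => ?_
    have hJ1 : ∀ j ∈ Finset.range (K + 1), J j ω = 1 := by
      intro j hj
      have : r j ≤ s := hrK ▸ hrm (Finset.mem_range.1 hj).le
      exact Set.indicator_of_mem (show ω ∈ stayEvent ε τ i (r j) from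
        ⟨hω.1, this.trans_lt hω.2⟩) _
    have h1 : ∑ j ∈ Finset.range (K + 1),
        (J j ω * (S.integral B (r (j + 1)) ω - S.integral B (r j) ω) -
          J j ω * (G.integral B (r (j + 1)) ω - G.integral B (r j) ω)) =
        ∑ j ∈ Finset.range (K + 1),
          ((S.integral B (r (j + 1)) ω - G.integral B (r (j + 1)) ω) -
            (S.integral B (r j) ω - G.integral B (r j) ω)) := by
      refine Finset.sum_congr rfl fun j hj => ?_
      rw [hJ1 j hj]
      ring
    rw [h1, Finset.sum_range_sub (fun j => S.integral B (r j) ω - G.integral B (r j) ω), hrK, hr0,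
      S.integral_zero, G.integral_zero]
    ring
  rw [hZ]
  refine (hel.ofReal_sq_setIntegral_le hB hA).trans ?_
  set E1 : Ω × ℝ → ℝ≥0∞ := fun p => ENNReal.ofReal ((S.value p.2 p.1 - dagger ε τ σ p.2 p.1) ^ 2)
    with hE1
  set E2 : Ω × ℝ → ℝ≥0∞ := fun p => ENNReal.ofReal ((G.value p.2 p.1 - σ i p.2) ^ 2) with hE2
  have hE1m : Measurable E1 :=
    ((S.measurable_value.sub (hs.measurable_dagger hεm hσ)).pow_const 2).ennreal_ofReal
  have hE2m : Measurable E2 :=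
    ((G.measurable_value.sub ((hσ i).comp measurable_snd)).pow_const 2).ennreal_ofReal
  have hpt : ∀ p : Ω × ℝ, ENNReal.ofReal ((∑ j ∈ Finset.range (K + 1),
      (J j p.1 * (Set.Ioc (r j : ℝ) (r (j + 1))).indicator (fun u => S.value u p.1) p.2 -
        J j p.1 * (Set.Ioc (r j : ℝ) (r (j + 1))).indicator (fun u => G.value u p.1) p.2)) ^ 2) ≤
      (Set.Ioc (0 : ℝ) s).indicator (fun u => 2 * E1 (p.1, u) + 2 * E2 (p.1, u)) p.2 +
        (Set.Icc (τ 1 p.1 : ℝ) (τ 1 p.1 + s / (K + 1))).indicator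
          (fun _ => ENNReal.ofReal (C ^ 2)) p.2 := by
    rintro ⟨ω, u⟩
    dsimp only
    have hcell : ∀ j, u ∉ Set.Ioc (r j : ℝ) (r (j + 1)) →
        J j ω * (Set.Ioc (r j : ℝ) (r (j + 1))).indicator (fun u => S.value u ω) u -
        J j ω * (Set.Ioc (r j : ℝ) (r (j + 1))).indicator (fun u => G.value u ω) u = 0 := by
      intro j hj
      rw [Set.indicator_of_notMem hj, Set.indicator_of_notMem hj, sub_self]
    have hrm' : Monotone fun j => (r j : ℝ) := fun j k hjk => NNReal.coe_le_coe.2 (hrm hjk)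
    have hun := hrm'.biUnion_Ico_Ioc_map_succ 0 (K + 1)
    simp only [hr0, hrK, Nat.succ_eq_succ, Nat.succ_eq_add_one, NNReal.coe_zero] at hun
    by_cases hu : u ∈ Set.Ioc (0 : ℝ) s
    · rw [Set.indicator_of_mem hu]
      have hu' := hu
      rw [← hun] at hu'
      simp only [Set.mem_iUnion, exists_prop] at hu'
      obtain ⟨j, hj, huj⟩ := hu'
      rw [Finset.sum_eq_single_of_mem j (Finset.mem_range.2 hj.2)]
      swap
      · intro k _ hkj
        refine hcell k fun hk => ?_
        exact Set.disjoint_left.1 (hrm'.pairwise_disjoint_on_Ioc_succ hkj) hk huj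
      rw [Set.indicator_of_mem huj, Set.indicator_of_mem huj, ← mul_sub]
      by_cases hω : ω ∈ stayEvent ε τ i (r j)
      swap
      · have : J j ω = 0 := Set.indicator_of_notMem hω _
        rw [this]
        simp
      have hJ1 : J j ω = 1 := Set.indicator_of_mem hω _
      rw [hJ1, one_mul]
      rcases lt_or_ge u (τ 1 ω : ℝ) with hlt | hge
      · refine le_trans ?_ le_self_add
        have hd : dagger ε τ σ u ω = σ i u := by
          rw [hs.dagger_eq (n := 0) σ, hs.time_zero, hω.1]
          · simp
          · rw [hs.time_zero]
            exact ⟨hu.1.le, hlt⟩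
        simp only [hE1, hE2]
        rw [hd, ← ENNReal.ofReal_ofNat 2, ← ENNReal.ofReal_mul (by norm_num),
          ← ENNReal.ofReal_mul (by norm_num), ← ENNReal.ofReal_add (by positivity) (by positivity)]
        refine ENNReal.ofReal_le_ofReal ?_
        nlinarith [sq_nonneg ((S.value u ω - σ i u) + (G.value u ω - σ i u))]
      -- The switch has occurred inside the current cell, so u exceeds τ_1 by at most the mesh and
      -- only the crude bound C is available.
      · refine le_trans ?_ le_add_self
        rw [Set.indicator_of_mem]
        · exact ENNReal.ofReal_le_ofReal (sq_le_sq' (neg_le_of_abs_le (hC u ω))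
            (le_of_abs_le (hC u ω)))
        · refine ⟨hge, ?_⟩
          have h1 : (r j : ℝ) < τ 1 ω := NNReal.coe_lt_coe.2 hω.2
          have h2 := huj.2
          rw [hrs] at h2
          linarith
    · rw [Finset.sum_eq_zero]
      · simp
      · intro j hj
        refine hcell j fun h => hu ?_
        rw [← hun]
        simp only [Set.mem_iUnion, exists_prop]
        exact ⟨j, ⟨Nat.zero_le j, Finset.mem_range.1 hj⟩, h⟩
  refine (lintegral_mono hpt).trans ?_
  have hm1 : Measurable fun p : Ω × ℝ => (Set.Ioc (0 : ℝ) s).indicator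
      (fun u => 2 * E1 (p.1, u) + 2 * E2 (p.1, u)) p.2 :=
    ((hE1m.const_mul 2).add (hE2m.const_mul 2)).indicator (measurable_snd measurableSet_Ioc)
  have hτm : Measurable fun p : Ω × ℝ => (τ 1 p.1 : ℝ) :=
    ((hs.measurable_time 1).comp measurable_fst).coe_nnreal_real
  have hm2 : Measurable fun p : Ω × ℝ => (Set.Icc (τ 1 p.1 : ℝ)
      (τ 1 p.1 + s / (K + 1))).indicator (fun _ => ENNReal.ofReal (C ^ 2)) p.2 := by
    have : MeasurableSet {p : Ω × ℝ | (τ 1 p.1 : ℝ) ≤ p.2 ∧ p.2 ≤ τ 1 p.1 + s / (K + 1)} :=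
      (measurableSet_le hτm measurable_snd).inter (measurableSet_le measurable_snd
        (hτm.add_const _))
    exact (measurable_const (a := ENNReal.ofReal (C ^ 2))).indicator this
  rw [lintegral_add_left hm1, lintegral_prod _ hm1.aemeasurable, lintegral_prod _ hm2.aemeasurable]
  refine add_le_add (le_of_eq ?_) (le_of_eq ?_)
  · simp_rw [lintegral_indicator measurableSet_Ioc]
    have hE1u : ∀ ω, Measurable fun u => E1 (ω, u) := fun ω => hE1m.comp measurable_prodMk_left
    have hE2u : ∀ ω, Measurable fun u => E2 (ω, u) := fun ω => hE2m.comp measurable_prodMk_left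
    simp_rw [fun ω => lintegral_add_left (μ := volume.restrict (Set.Ioc (0 : ℝ) s))
      ((hE1u ω).const_mul 2) (fun u => 2 * E2 (ω, u)),
      fun ω => lintegral_const_mul (μ := volume.restrict (Set.Ioc (0 : ℝ) s)) 2 (hE1u ω),
      fun ω => lintegral_const_mul (μ := volume.restrict (Set.Ioc (0 : ℝ) s)) 2 (hE2u ω)]
    rw [lintegral_add_left (hE1m.lintegral_prod_right'.const_mul 2),
      lintegral_const_mul 2 hE1m.lintegral_prod_right',
      lintegral_const_mul 2 hE2m.lintegral_prod_right']
  · simp_rw [lintegral_indicator_const measurableSet_Icc, Real.volume_Icc, add_sub_cancel_left]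
    simp

end Localisation

/-! ### Mean of the Itô integral on the event of no switching -/

section ItoMean

variable {Ω : Type*} {mΩ : MeasurableSpace Ω} {P : Measure Ω} {F : Filtration ℝ≥0 mΩ} {d : ℕ}
  {ε : ℝ≥0 → Ω → Fin d} {τ : ℕ → Ω → ℝ≥0} {B : ℝ≥0 → Ω → ℝ} {σ : Fin d → ℝ → ℝ}

/-- Simple processes are bounded, so the error due to the mesh vanishes as the grid is refined. -/
theorem SimpleItoProcess.ofReal_sq_setIntegral_sub_le [IsProbabilityMeasure P]
    (hB : IsBrownianRelTo P F B) (hs : IsSwitchingProcess ε τ) (hε : ∀ t, Measurable[F t] (ε t))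
    (hσ : ∀ i, Measurable (σ i)) (S G : SimpleItoProcess F) (i : Fin d) (s : ℝ≥0) :
    ENNReal.ofReal ((∫ ω in stayEvent ε τ i s, (S.integral B s ω - G.integral B s ω) ∂P) ^ 2) ≤
      (2 * ∫⁻ ω, (∫⁻ u in Set.Ioc (0 : ℝ) s,
        ENNReal.ofReal ((S.value u ω - dagger ε τ σ u ω) ^ 2)) ∂P) +
      (2 * ∫⁻ ω, (∫⁻ u in Set.Ioc (0 : ℝ) s,
        ENNReal.ofReal ((G.value u ω - σ i u) ^ 2)) ∂P) := by
  obtain ⟨C, hC⟩ := S.exists_bound_value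
  obtain ⟨C', hC'⟩ := G.exists_bound_value
  have hCC : ∀ u ω, |S.value u ω - G.value u ω| ≤ C + C' := fun u ω =>
    (abs_sub _ _).trans (add_le_add (hC u ω) (hC' u ω))
  refine ge_of_tendsto' (x := atTop) ?_
    fun K : ℕ => S.ofReal_sq_setIntegral_sub_le_of_grid hB hs hε hσ G hCC i s K
  have h1 : Tendsto (fun K : ℕ => (s : ℝ) / (K + 1)) atTop (𝓝 0) :=
    tendsto_const_nhds.div_atTop (tendsto_natCast_atTop_atTop.atTop_add tendsto_const_nhds)
  have h2 : Tendsto (fun K : ℕ => ENNReal.ofReal ((C + C') ^ 2) * ENNReal.ofReal (s / (K + 1)))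
      atTop (𝓝 0) := by
    have h3 := ENNReal.Tendsto.const_mul (a := ENNReal.ofReal ((C + C') ^ 2))
      (ENNReal.tendsto_ofReal h1) (Or.inr ENNReal.ofReal_ne_top)
    simpa using h3
  simpa using h2.const_add ((2 * ∫⁻ ω, (∫⁻ u in Set.Ioc (0 : ℝ) s,
        ENNReal.ofReal ((S.value u ω - dagger ε τ σ u ω) ^ 2)) ∂P) +
      (2 * ∫⁻ ω, (∫⁻ u in Set.Ioc (0 : ℝ) s,
        ENNReal.ofReal ((G.value u ω - σ i u) ^ 2)) ∂P))

/-- On the event of no switching, the mean of the elementary integral is controlled by the distance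
of the integrand to the regime switching integrand. -/
theorem SimpleItoProcess.ofReal_sq_setIntegral_le [IsProbabilityMeasure P]
    (hB : IsBrownianRelTo P F B) (hs : IsSwitchingProcess ε τ) (hε : ∀ t, Measurable[F t] (ε t))
    (hBε : IndepFun (fun ω t => B t ω) (fun ω t => ε t ω) P)
    (hσ : ∀ i, Measurable (σ i)) (S : SimpleItoProcess F) (i : Fin d) (s : ℝ≥0)
    (hA0 : P (stayEvent ε τ i s) ≠ 0) :
    ENNReal.ofReal ((∫ ω in stayEvent ε τ i s, S.integral B s ω ∂P) ^ 2) ≤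
      (2 + 2 / P (stayEvent ε τ i s)) * ∫⁻ ω, (∫⁻ u in Set.Ioc (0 : ℝ) s,
        ENNReal.ofReal ((S.value u ω - dagger ε τ σ u ω) ^ 2)) ∂P := by
  have hεm : ∀ t, Measurable (ε t) := fun t => (hε t).mono (F.le t) le_rfl
  have hA : MeasurableSet (stayEvent ε τ i s) :=
    hs.measurableSet_stayEvent_of_le (fun t _ => hεm t) i
  set φ : Ω → ℝ≥0∞ := fun ω => ∫⁻ u in Set.Ioc (0 : ℝ) s,
    ENNReal.ofReal ((S.value u ω - dagger ε τ σ u ω) ^ 2) with hφ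
  have hφm : Measurable φ := Measurable.lintegral_prod_right'
    (f := fun p : Ω × ℝ => ENNReal.ofReal ((S.value p.2 p.1 - dagger ε τ σ p.2 p.1) ^ 2))
    ((S.measurable_value.sub (hs.measurable_dagger hεm hσ)).pow_const 2).ennreal_ofReal
  -- Some path in the event has an error not exceeding the average over the event, hence at most the
  -- total error divided by the probability of the event. Freezing S along that path costs the term
  -- 2 / P in the constant; the other 2 comes from S itself.
  obtain ⟨ω₀, hω₀, hle⟩ := exists_le_setLAverage hA0 (measure_ne_top P _) hφm.aemeasurable
  rw [setLAverage_eq] at hle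
  have hφ0 : ∫⁻ u in Set.Ioc (0 : ℝ) s,
      ENNReal.ofReal ((S.value u ω₀ - σ i u) ^ 2) = φ ω₀ := by
    refine setLIntegral_congr_fun measurableSet_Ioc fun u hu => ?_
    have hd : dagger ε τ σ u ω₀ = σ i u := by
      rw [hs.dagger_eq (n := 0) σ, hs.time_zero, hω₀.1]
      · simp
      · rw [hs.time_zero]
        exact ⟨hu.1.le, hu.2.trans_lt (NNReal.coe_lt_coe.2 hω₀.2)⟩
    rw [hd]
  have h := S.ofReal_sq_setIntegral_sub_le hB hs hε hσ (S.freeze ω₀) i s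
  rw [integral_sub ((S.memLp_integral hB s).integrable one_le_two).integrableOn
    (((S.freeze ω₀).memLp_integral hB s).integrable one_le_two).integrableOn,
    S.setIntegral_freeze hB ω₀ s hA (hs.indepFun_indicator_stayEvent hBε i s), sub_zero] at h
  simp_rw [S.freeze_value, hφ0] at h
  rw [lintegral_const, measure_univ, mul_one] at h
  refine h.trans ?_
  rw [add_mul]
  refine add_le_add le_rfl ?_
  rw [ENNReal.div_eq_inv_mul, mul_comm _ (2 : ℝ≥0∞), mul_assoc, ← ENNReal.div_eq_inv_mul]
  gcongr
  exact hle.trans (ENNReal.div_le_div_right (setLIntegral_le_lintegral _ _) _)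

/-- Weighted by an indicator known at s, the increment over (s, t] is an elementary integral, hence
centred. -/
theorem SimpleItoProcess.setIntegral_eq_of_le [IsProbabilityMeasure P]
    (hB : IsBrownianRelTo P F B) (S : SimpleItoProcess F) {s t : ℝ≥0} (hst : s ≤ t) {A : Set Ω}
    (hA : MeasurableSet[F s] A) :
    ∫ ω in A, S.integral B t ω ∂P = ∫ ω in A, S.integral B s ω ∂P := by
  have h := (S.isElementaryIntegral B hst (J := A.indicator fun _ => 1)
    (Measurable.indicator measurable_const hA) (C := 1) fun ω => by
      by_cases hω : ω ∈ A <;> simp [hω]).integral_eq_zero hB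
  have h1 : ∀ ω, A.indicator (fun _ => (1 : ℝ)) ω * (S.integral B t ω - S.integral B s ω) =
      A.indicator (fun ω => S.integral B t ω - S.integral B s ω) ω := by
    intro ω
    by_cases hω : ω ∈ A <;> simp [hω]
  simp_rw [h1] at h
  rw [integral_indicator (F.le s A hA),
    integral_sub ((S.memLp_integral hB t).integrable one_le_two).integrableOn
      ((S.memLp_integral hB s).integrable one_le_two).integrableOn] at h
  exact sub_eq_zero.1 h

namespace IsItoIntegral

variable {H : ℝ → Ω → ℝ} {t : ℝ≥0} {W : Ω → ℝ}

theorem memLp [IsProbabilityMeasure P] (hB : IsBrownianRelTo P F B)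
    (hW : IsItoIntegral P F B H t W) : MemLp W 2 P := by
  obtain ⟨hWm, S, -, hS⟩ := hW
  obtain ⟨n, hn⟩ := (hS.eventually_lt_const ENNReal.zero_lt_top).exists
  have hSm := (S n).memLp_integral hB t
  have hd : MemLp (fun ω => (S n).integral B t ω - W ω) 2 P :=
    ⟨hSm.aestronglyMeasurable.sub hWm, hn⟩
  exact (hSm.sub hd).ae_eq (Eventually.of_forall fun ω => by simp)

/-- The Itô integral of a regime switching integrand has mean zero on every event of no
switching. -/
theorem setIntegral_stayEvent [IsProbabilityMeasure P] (hB : IsBrownianRelTo P F B)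
    (hs : IsSwitchingProcess ε τ) (hε : ∀ t, Measurable[F t] (ε t))
    (hBε : IndepFun (fun ω t => B t ω) (fun ω t => ε t ω) P) (hσ : ∀ i, Measurable (σ i))
    (hW : IsItoIntegral P F B (dagger ε τ σ) t W) (i : Fin d) {s : ℝ≥0} (hst : s ≤ t)
    (hA0 : P (stayEvent ε τ i s) ≠ 0) : ∫ ω in stayEvent ε τ i s, W ω ∂P = 0 := by
  have hWL := hW.memLp hB
  obtain ⟨hWm, S, hSH, hS⟩ := hW
  have hSL : ∀ n, MemLp ((S n).integral B t) 2 P := fun n => (S n).memLp_integral hB t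
  have hlim : Tendsto (fun n => ∫ ω in stayEvent ε τ i s, (S n).integral B t ω ∂P) atTop
      (𝓝 (∫ ω in stayEvent ε τ i s, W ω ∂P)) := by
    refine tendsto_setIntegral_of_L1' W hWL.aestronglyMeasurable
      (Eventually.of_forall fun n => (hSL n).integrable one_le_two) ?_ _
    refine tendsto_of_tendsto_of_tendsto_of_le_of_le tendsto_const_nhds hS (fun _ => zero_le)
      fun n => ?_
    exact eLpNorm_le_eLpNorm_of_exponent_le one_le_two
      ((hSL n).aestronglyMeasurable.sub hWm)
  have hA : MeasurableSet[F s] (stayEvent ε τ i s) :=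
    hs.measurableSet_stayEvent_of_le (fun t ht => (hε t).mono (F.mono ht) le_rfl) i
  have hbd : ∀ n, ENNReal.ofReal ((∫ ω in stayEvent ε τ i s, (S n).integral B t ω ∂P) ^ 2) ≤
      (2 + 2 / P (stayEvent ε τ i s)) * ∫⁻ ω, (∫⁻ u in Set.Ioc (0 : ℝ) t,
        ENNReal.ofReal (((S n).value u ω - dagger ε τ σ u ω) ^ 2)) ∂P := by
    intro n
    -- The bound is applied at time s, where the event becomes known; enlarging (0, s] to (0, t]
    -- only increases its right-hand side.
    rw [(S n).setIntegral_eq_of_le hB hst hA]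
    refine ((S n).ofReal_sq_setIntegral_le hB hs hε hBε hσ i s hA0).trans ?_
    gcongr
  have h0 : Tendsto (fun n => (2 + 2 / P (stayEvent ε τ i s)) * ∫⁻ ω, (∫⁻ u in Set.Ioc (0 : ℝ) t,
      ENNReal.ofReal (((S n).value u ω - dagger ε τ σ u ω) ^ 2)) ∂P) atTop (𝓝 0) := by
    have h := ENNReal.Tendsto.const_mul (a := 2 + 2 / P (stayEvent ε τ i s)) hSH
      (Or.inr (ENNReal.add_ne_top.2 ⟨by simp, ENNReal.div_ne_top (by simp) hA0⟩))
    rwa [mul_zero] at h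
  have h1 := tendsto_of_tendsto_of_tendsto_of_le_of_le tendsto_const_nhds h0 (fun _ => zero_le) hbd
  have h2 := tendsto_nhds_unique (ENNReal.tendsto_ofReal (hlim.pow 2)) h1
  rw [ENNReal.ofReal_eq_zero] at h2
  exact pow_eq_zero_iff two_ne_zero |>.1 (le_antisymm h2 (sq_nonneg _))

end IsItoIntegral

end ItoMean

/-! ### Assembly of the equivalence -/

theorem IsSemiMarkov.isRenewalSwitching {Ω : Type*} {mΩ : MeasurableSpace Ω} {P : Measure Ω}
    [IsProbabilityMeasure P] {d : ℕ} {γ : Fin d → Fin d → ℝ → ℝ} {ε : ℝ≥0 → Ω → Fin d}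
    {τ : ℕ → Ω → ℝ≥0} (hsm : IsSemiMarkov P γ ε τ) (hs : IsSwitchingProcess ε τ)
    (hε : ∀ t, Measurable (ε t)) (hγ_meas : ∀ i j, i ≠ j → Measurable (γ i j))
    (hγ_nonneg : ∀ i j, i ≠ j → ∀ t : ℝ, 0 < t → 0 ≤ γ i j t)
    (hγ_int : ∀ i j, i ≠ j → ∀ t : ℝ, 0 ≤ t → IntervalIntegrable (γ i j) volume 0 t)
    (hγ_top : ∀ i j, i ≠ j → Tendsto (fun t : ℝ => ∫ u in (0 : ℝ)..t, γ i j u) atTop atTop) :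
    IsRenewalSwitching P (totalHazard γ) ε τ := by
  have : Nonempty Ω := nonempty_of_isProbabilityMeasure P
  have hz := isHazard_totalHazard hγ_meas hγ_nonneg hγ_int hγ_top hs.exists_ne
  exact ⟨hs, hε, hz, fun n _ hΦ => hs.lintegral_history_sojourn hε hγ_meas hγ_nonneg hz hsm n hΦ⟩

theorem hasCondMean_iff {Ω : Type*} {mΩ : MeasurableSpace Ω} {P : Measure Ω} [IsFiniteMeasure P]
    {A : Set Ω} (hA : P A ≠ 0) {Y : Ω → ℝ} {m : ℝ} :
    HasCondMean P A Y m ↔ IntegrableOn Y A P ∧ ∫ ω in A, Y ω ∂P = P.real A * m := by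
  have h0 : P.real A ≠ 0 := (measureReal_ne_zero_iff).2 hA
  rw [HasCondMean, ProbabilityTheory.cond, integral_smul_measure,
    integrable_smul_measure (ENNReal.inv_ne_zero.2 (measure_ne_top P A)) (ENNReal.inv_ne_top.2 hA),
    ENNReal.toReal_inv, ← measureReal_def, smul_eq_mul, inv_mul_eq_iff_eq_mul₀ h0]
  rfl

theorem corollary2p2 {Ω : Type*} {mΩ : MeasurableSpace Ω} (P : Measure Ω) [IsProbabilityMeasure P]
    (F : Filtration ℝ≥0 mΩ) {d : ℕ}
    -- the hazard rate functions
    (γ : Fin d → Fin d → ℝ → ℝ)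
    (hγ_meas : ∀ i j, i ≠ j → Measurable (γ i j))
    (hγ_nonneg : ∀ i j, i ≠ j → ∀ t : ℝ, 0 < t → 0 ≤ γ i j t)
    (hγ_int : ∀ i j, i ≠ j → ∀ t : ℝ, 0 ≤ t → IntervalIntegrable (γ i j) volume 0 t)
    (hγ_top : ∀ i j, i ≠ j → Tendsto (fun t : ℝ => ∫ u in (0 : ℝ)..t, γ i j u) atTop atTop)
    -- the semi-Markov switching process
    (ε : ℝ≥0 → Ω → Fin d) (τ : ℕ → Ω → ℝ≥0)
    (hε_adapted : ∀ t, Measurable[F t] (ε t))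
    (hε_switch : IsSwitchingProcess ε τ)
    (hε_semiMarkov : IsSemiMarkov P γ ε τ)
    (hε_start : ∀ i, P {ω | ε 0 ω = i} ≠ 0)
    -- the Brownian motion, independent of the switching process
    (B : ℝ≥0 → Ω → ℝ) (hB : IsBrownianRelTo P F B)
    (hBε : IndepFun (fun ω t => B t ω) (fun ω t => ε t ω) P)
    -- the regimes
    (c h σ : Fin d → ℝ → ℝ)
    (hc_meas : ∀ i, Measurable (c i)) (hh_meas : ∀ i, Measurable (h i))
    (hσ_meas : ∀ i, Measurable (σ i))
    (hc_int : ∀ i, ∀ t : ℝ, 0 ≤ t → IntervalIntegrable (c i) volume 0 t)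
    (hσ_int : ∀ i, ∀ t : ℝ, 0 ≤ t → IntervalIntegrable (fun u => σ i u ^ 2) volume 0 t)
    -- the process
    (X : ℝ≥0 → Ω → ℝ) (hX : IsTelegraphJumpDiffusion P F ε τ B c h σ X) :
    ((∀ (i : Fin d) (t : ℝ≥0), HasCondMean P {ω | ε 0 ω = i} (X t) 0) ∧
      (∀ (i : Fin d) (s t : ℝ≥0), s ≤ t →
        HasCondMean P ({ω | ε 0 ω = i} ∩ {ω | switchCount τ s ω = 0}) (X t)
          (∫ u in (0 : ℝ)..s, c i u))) ↔
    ∀ i : Fin d, ∀ᵐ t ∂(volume.restrict (Set.Ici (0 : ℝ))),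
      totalHazard γ i t * h i t + c i t = 0 := by
  have hεm : ∀ t, Measurable (ε t) := fun t => (hε_adapted t).mono (F.le t) le_rfl
  have hR := hε_semiMarkov.isRenewalSwitching hε_switch hεm hγ_meas hγ_nonneg hγ_int hγ_top
  have hA : ∀ i s, {ω | ε 0 ω = i} ∩ {ω | switchCount τ s ω = 0} = stayEvent ε τ i s := by
    intro i s
    ext ω
    simp only [stayEvent, Set.mem_inter_iff, Set.mem_ofPred_eq, hε_switch.switchCount_eq_zero_iff]
  -- Since τ_1 > 0 on every path, conditioning on the initial state alone is the case s = 0.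
  have hA0 : ∀ i, {ω | ε 0 ω = i} = stayEvent ε τ i 0 := by
    intro i
    ext ω
    have h1 : 0 < τ 1 ω := hε_switch.time_zero ω ▸ hε_switch.time_lt 0 ω
    simp only [stayEvent, Set.mem_ofPred_eq, h1, and_true]
  have hpos : ∀ i s, P (stayEvent ε τ i s) ≠ 0 := fun i s =>
    hR.measure_stayEvent_ne_zero (hε_start i) s
  obtain ⟨W, hW, hXW⟩ := hX
  have hWi : ∀ t, Integrable (W t) P := fun t => ((hW t).memLp hB).integrable one_le_two
  have hX' : ∀ t, X t = fun ω => telegraphPart ε τ c t ω + jumpPart ε τ h t ω + W t ω :=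
    fun t => funext (hXW t)
  set f : Fin d → ℝ → ℝ := fun i v => totalHazard γ i v * h i v + c i v with hf
  have hfm : ∀ i, Measurable (f i) := fun i =>
    ((hR.hazard i).measurable.mul (hh_meas i)).add (hc_meas i)
  -- the means in terms of the compensator
  have hmean : (∀ i, ∀ t : ℝ, 0 ≤ t → IntervalIntegrable (fun v => totalHazard γ i v * h i v)
      volume 0 t) → ∀ (i : Fin d) (s t : ℝ≥0), s ≤ t →
      (HasCondMean P (stayEvent ε τ i s) (X t) (∫ u in (0 : ℝ)..s, c i u) ↔
        ∫ p, dagger ε τ f p.2 p.1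
          ∂((P.restrict (stayEvent ε τ i s)).prod (volume.restrict (Set.Ioc (s : ℝ) t))) = 0) := by
    intro hloc i s t hst
    obtain ⟨hi, he⟩ := hR.setIntegral_telegraph_add_jump hc_meas hh_meas hc_int hloc i hst
    rw [hasCondMean_iff (hpos i s), hX', integral_add hi (hWi t).integrableOn, he,
      (hW t).setIntegral_stayEvent hB hε_switch hε_adapted hBε hσ_meas i hst (hpos i s), add_zero,
      add_eq_left]
    exact and_iff_right (hi.add (hWi t).integrableOn)
  constructor
  -- The unconditional-in-s identities are the case s = 0 of the others, because l_i(0) = 0; nothing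
  -- is lost by dropping them.
  · rintro ⟨-, h2⟩
    simp only [hA] at h2
    have hloc : ∀ i, ∀ t : ℝ, 0 ≤ t →
        IntervalIntegrable (fun v => totalHazard γ i v * h i v) volume 0 t := by
      intro i t ht
      lift t to ℝ≥0 using ht
      refine hR.intervalIntegrable_of_integrableOn_jumpPart hh_meas i (hε_start i) t ?_
      have hXi := ((hasCondMean_iff (hpos i 0)).1 (h2 i 0 t zero_le)).1
      have hTi := (hR.setIntegral_telegraphPart hc_meas hc_int i (zero_le (a := t))).1
      rw [hA0]
      refine ((hXi.sub hTi.integrableOn).sub (hWi t).integrableOn).congr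
        (Eventually.of_forall fun ω => ?_)
      simp only [Pi.sub_apply, hXW]
      ring
    have hfint : ∀ i, ∀ t : ℝ, 0 ≤ t → IntervalIntegrable (f i) volume 0 t := fun i t ht =>
      (hloc i t ht).add (hc_int i t ht)
    exact fun i => hR.ae_eq_zero_of_integral_dagger_eq_zero hfm hfint i (hε_start i)
      fun s t hst => (hmean hloc i s t hst).1 (h2 i s t hst)
  · intro hae
    have hloc : ∀ i, ∀ t : ℝ, 0 ≤ t →
        IntervalIntegrable (fun v => totalHazard γ i v * h i v) volume 0 t := by
      intro i t ht
      -- Here γ_i h_i equals -c_i almost everywhere and inherits its local integrability.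
      refine (hc_int i t ht).neg.congr_ae ?_
      rw [Set.uIoc_of_le ht]
      filter_upwards [ae_restrict_of_ae_restrict_of_subset
        (fun u hu => (Set.mem_Ioc.1 hu).1.le) (hae i)] with u hu
      exact (eq_neg_of_add_eq_zero_left hu).symm
    have hfint : ∀ i, ∀ t : ℝ, 0 ≤ t → IntervalIntegrable (f i) volume 0 t := fun i t ht =>
      (hloc i t ht).add (hc_int i t ht)
    have h2 : ∀ (i : Fin d) (s t : ℝ≥0), s ≤ t →
        HasCondMean P (stayEvent ε τ i s) (X t) (∫ u in (0 : ℝ)..s, c i u) := fun i s t hst =>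
      (hmean hloc i s t hst).2 (hR.integral_dagger_eq_zero hfm hfint hae _ s t)
    simp only [hA]
    refine ⟨fun i t => ?_, h2⟩
    have h3 := h2 i 0 t zero_le
    rw [NNReal.coe_zero, intervalIntegral.integral_same] at h3
    rwa [hA0]
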